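/- Write $(z)_k=z(z+1)\cdots(z+k-1)$, $(z,w)_k=(z)_k(w)_k$, and $x^{(N)}_j=x+i\bigl(\tfrac{N+1}{2}-j\bigr)$. All polynomials are in $\mathbb{C}[x]$ (so $\eta=x$). **Base polynomials.** Meixner–Pollaczek (MP), $a,\phi\in\mathbb{R}$: $$P_n(x;a,\phi)=\frac{e^{in\phi}}{n!}\sum_{k=0}^n\frac{(-n)_k(2a+k)_{n-k}}{k!}(1-e^{-2i\phi})^k(a+ix)_k .$$ Continuous Hahn (cH), $a_1,a_2\in\mathbb{C}$, $b_1=a_1+a_2+a_1^*+a_2^*$: $$P_n(x;a_1,a_2)=\frac{i^n}{n!}\sum_{k=0}^n\frac{(-n)_k(n+b_1-1)_k(a_1+a_1^*+k)_{n-k}(a_1+a_2^*+k)_{n-k}}{k!}(a_1+ix)_k,$$ and $c_n(a_1,a_2)=(n+b_1-1)_n/n!$. Put $r_j[c,N](x)=(-1)^{j-1}i^{1-N}(c-\tfrac{N-1}{2}+ix)_{j-1}(c^*-\tfrac{N-1}{2}-ix)_{N-j}$. **Multi-indexed MP polynomials.** For distinct integers $d_1,\dots,d_M\ge 0$ (where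 $M\ge0$) let $\xi_v(x)=P_v(x;1-a,\phi)$ and $$\Xi_{\mathcal D}(x)=i^{M(M-1)/2}\det\bigl(\xi_{d_k}(x^{(M)}_j)\bigr)_{1\le j,k\le M};$$ $P_{\mathcal D,n}(x)$ is $i^{M(M+1)/2}$ times the $(M+1)\times(M+1)$ determinant whose $j$-th row is $\xi_{d_1}(x^{(M+1)}_j),\dots,\xi_{d_M}(x^{(M+1)}_j),\ r_j[a,M+1](x)P_n(x^{(M+1)}_j;a,\phi)$; and $\ell_{\mathcal D}=\sum_j d_j-\tfrac12M(M-1)$. **Multi-indexed cH polynomials.** For distinct integers $d^{\rm I}_1,\dots,d^{\rm I}_{M_{\rm I}}\ge0$ and distinct integers $d^{\rm II}_1,\dots,d^{\rm II}_{M_{\rm II}}\ge0$, let $M=M_{\rm I}+M_{\rm II}$, $\xi^{\rm I}_v(x)=P_v(x;1-a_1^*,a_2)$, $\xi^{\rm II}_v(x)=P_v(x;a_1,1-a_2^*)$. Let $\Delta(x)$ be $i^{M(M-1)/2}$ times the $M\times M$ determinant whose $j$-th row consists of the entries $r_j[a_2,M](x)\,\xi^{\rm I}_{d^{\rm I}_k}(x^{(M)}_j)$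 ($1\le k\le M_{\rm I}$) followed by $r_j[a_1,M](x)\,\xi^{\rm II}_{d^{\rm II}_k}(x^{(M)}_j)$ ($1\le k\le M_{\rm II}$). Let $\Delta_n(x)$ be $i^{M(M+1)/2}$ times the $(M+1)\times(M+1)$ determinant whose $j$-th row consists of the same entries with $M+1$ in place of $M$ in $r_j$ and $x_j$, followed by $r_j[a_2,M+1](x)\,r_j[a_1,M+1](x)\,P_n(x^{(M+1)}_j;a_1,a_2)$. With $$A=\prod_{j=1}^{M_{\rm I}-1}(a_2-\tfrac{M-1}2+ix,\,a_2^*-\tfrac{M-1}2-ix)_j\prod_{j=1}^{M_{\rm II}-1}(a_1-\tfrac{M-1}2+ix,\,a_1^*-\tfrac{M-1}2-ix)_j,$$ $$B=\prod_{j=1}^{M_{\rm I}}(a_2-\tfrac{M}2+ix,\,a_2^*-\tfrac{M}2-ix)_j\prod_{j=1}^{M_{\rm II}}(a_1-\tfrac{M}2+ix,\,a_1^*-\tfrac{M}2-ix)_j,$$ the polynomials $\Xi_{\mathcal D}$ and $P_{\mathcal D,n}$ are the quotients $\Delta/A$ and $\Delta_n/B$ (part of the claim is that both divisions are exact under the assumptions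 below), and $\ell_{\mathcal D}=\sum_j d^{\rm I}_j+\sum_j d^{\rm II}_j-\tfrac12M(M-1)+2M_{\rm I}M_{\rm II}$. **The map $I$.** For $p=\sum_{k=0}^n a_kx^k$, $I[p]=\sum_{k=0}^{n+1}b_kx^k$ with $b_0=0$ and, for $k=n,\dots,0$, $b_{k+1}=\frac{1}{k+1}\bigl(a_k-\sum_{j=k+1}^n g_j^{(j-k)}b_{j+1}\bigr)$, where $g_j^{(m)}=(-1)^{m/2}2^{-m}\binom{j+1}{m+1}$ for even $m$ and $g_j^{(m)}=0$ for odd $m$. Thus $I[p]$ is the polynomial $Q$ with $Q(0)=0$ and $\dfrac{Q(x-\frac i2)-Q(x+\frac i2)}{-i}=p(x)$. **Theorem.** Assume one of the following. * MP: $a>0$, $0<\phi<\pi$, $d_j<2a-1$ for all $j$. * cH: $\operatorname{Re}a_1,\operatorname{Re}a_2>0$, $d^{\rm I}_j<a_1+a_1^*-1$ and $d^{\rm II}_j<a_2+a_2^*-1$ for all $j$, and the following constant is nonzero: $$\begin{aligned}c^{\Xi}_{\mathcal D}={}&\prod_j c_{d^{\rm I}_j}(1-a_1^*,a_2)\prod_j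 c_{d^{\rm II}_j}(a_1,1-a_2^*)\prod_{j<k}(d^{\rm I}_k-d^{\rm I}_j)\prod_{j<k}(d^{\rm II}_k-d^{\rm II}_j)\\&\times\prod_{j,k}(a_1+a_1^*+d^{\rm II}_k-a_2-a_2^*-d^{\rm I}_j).\end{aligned}$$ Assume further that $\Xi_{\mathcal D}$ has no zero in the strip $\{x\in\mathbb{C}:|\operatorname{Im}x|\le\frac12\}$. Let $Y\ne0$ be any polynomial and $X=I[\Xi_{\mathcal D}Y]$. Then $\deg X=L$ with $L=\ell_{\mathcal D}+\deg Y+1$, and there are constants $r_{n,k}\in\mathbb{C}$ ($n\ge 0$, $-L\le k\le L$) such that, for all integers $n\ge0$, $$X(x)\,P_{\mathcal D,n}(x)=\sum_{k=-L}^{L}r_{n,k}\,P_{\mathcal D,n+k}(x),$$ where $P_{\mathcal D,m}=0$ for $m<0$. -/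

import Mathlib

open Polynomial

noncomputable section

namespace MultiIndexed

/-- The rising factorial `(z)_k = z (z + 1) ⋯ (z + k - 1)`. -/
abbrev poch {R : Type} [CommSemiring R] (z : R) (k : ℕ) : R :=
  (ascPochhammer R k).eval z

/-- The polynomial `c + i x`. -/
def linPlus (c : ℂ) : ℂ[X] := C c + C Complex.I * X

/-- The polynomial `c - i x`. -/
def linMinus (c : ℂ) : ℂ[X] := C c - C Complex.I * X

/-- The shifted variable `x_j^{(N)} = x + i ((N + 1) / 2 - j)`, `1 ≤ j ≤ N`;
the index `j : Fin N` is zero-based, so it stands for `j + 1`. -/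
def node (N : ℕ) (j : Fin N) : ℂ[X] :=
  X + C (Complex.I * (((N : ℂ) + 1) / 2 - ((j : ℕ) + 1 : ℂ)))

/-- `r_j(x_j^{(N)}) = (-1)^{j-1} i^{1-N} (c - (N-1)/2 + i x)_{j-1} (c^* - (N-1)/2 - i x)_{N-j}`
as a polynomial in `x`, with zero-based `j`. -/
def rFun (c : ℂ) (N : ℕ) (j : Fin N) : ℂ[X] :=
  C ((-1) ^ (j : ℕ) * Complex.I ^ (1 - (N : ℤ))) *
    poch (linPlus (c - ((N : ℂ) - 1) / 2)) (j : ℕ) *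
    poch (linMinus (star c - ((N : ℂ) - 1) / 2)) (N - 1 - (j : ℕ))

/-! ### Meixner–Pollaczek -/

/-- The Meixner–Pollaczek polynomial
`P_n^{(a)}(x; φ) = (2a)_n / n! * e^{i n φ} * ₂F₁(-n, a + i x; 2a; 1 - e^{-2 i φ})`.
The quotient `(2a)_n / (2a)_k` is written as `(2a + k)_{n-k}`, so that the formula makes sense
for every real `a`. -/
def mpPoly (a φ : ℝ) (n : ℕ) : ℂ[X] :=
  C (Complex.exp (Complex.I * n * φ) / (n.factorial : ℂ)) *
    ∑ k ∈ Finset.range (n + 1),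
      C (poch (-(n : ℂ)) k * poch (2 * (a : ℂ) + k) (n - k) / (k.factorial : ℂ) *
          (1 - Complex.exp (-2 * Complex.I * φ)) ^ k) *
        poch (linPlus a) k

/-- The virtual state polynomial: the Meixner–Pollaczek polynomial at the twisted parameters
`(1 - a, φ)`. -/
def mpXiV (a φ : ℝ) (v : ℕ) : ℂ[X] := mpPoly (1 - a) φ v

/-- The denominator polynomial `Ξ_D` for Meixner–Pollaczek, `D = {d_1, …, d_M}`. -/
def mpDenom (a φ : ℝ) {M : ℕ} (d : Fin M → ℕ) : ℂ[X] :=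
  C (Complex.I ^ (M * (M - 1) / 2)) *
    Matrix.det (Matrix.of fun j k : Fin M => (mpXiV a φ (d k)).comp (node M j))

/-- The multi-indexed Meixner–Pollaczek polynomial `P_{D,n}`. -/
def mpMulti (a φ : ℝ) {M : ℕ} (d : Fin M → ℕ) (n : ℕ) : ℂ[X] :=
  C (Complex.I ^ (M * (M + 1) / 2)) *
    Matrix.det (Matrix.of fun j : Fin (M + 1) =>
      (Fin.snoc (fun k : Fin M => (mpXiV a φ (d k)).comp (node (M + 1) j))
        (rFun a (M + 1) j * (mpPoly a φ n).comp (node (M + 1) j)) : Fin (M + 1) → ℂ[X]))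

/-- `ℓ_D = ∑ d_j - M (M - 1) / 2`; the subtraction does not truncate when the `d_j` are
mutually distinct. -/
def mpEll {M : ℕ} (d : Fin M → ℕ) : ℕ := ∑ j, d j - M * (M - 1) / 2

/-! ### Continuous Hahn -/

/-- `b_1 = a_1 + a_2 + a_1^* + a_2^*`. -/
def chB (a₁ a₂ : ℂ) : ℂ := a₁ + a₂ + star a₁ + star a₂

/-- The continuous Hahn polynomial `p_n(x; a_1, a_2, a_1^*, a_2^*)`, equal to
`i^n (a_1 + a_1^*, a_1 + a_2^*)_n / n! *
  ₃F₂(-n, n + b_1 - 1, a_1 + i x; a_1 + a_1^*, a_1 + a_2^*; 1)`.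
The quotients `(c)_n / (c)_k` are written as `(c + k)_{n-k}`, so that the formula makes sense for
all complex `a_1, a_2`. -/
def chPoly (a₁ a₂ : ℂ) (n : ℕ) : ℂ[X] :=
  C (Complex.I ^ n / (n.factorial : ℂ)) *
    ∑ k ∈ Finset.range (n + 1),
      C (poch (-(n : ℂ)) k * poch ((n : ℂ) + chB a₁ a₂ - 1) k *
          poch (a₁ + star a₁ + k) (n - k) * poch (a₁ + star a₂ + k) (n - k) /
            (k.factorial : ℂ)) *
        poch (linPlus a₁) k

/-- The coefficient `c_n = (n + b_1 - 1)_n / n!` of `x^n` in the continuous Hahn polynomial. -/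
def chLead (a₁ a₂ : ℂ) (n : ℕ) : ℂ :=
  poch ((n : ℂ) + chB a₁ a₂ - 1) n / (n.factorial : ℂ)

/-- Type I virtual state polynomial: twisted parameters `(1 - a_1^*, a_2)`. -/
def chXiI (a₁ a₂ : ℂ) (v : ℕ) : ℂ[X] := chPoly (1 - star a₁) a₂ v

/-- Type II virtual state polynomial: twisted parameters `(a_1, 1 - a_2^*)`. -/
def chXiII (a₁ a₂ : ℂ) (v : ℕ) : ℂ[X] := chPoly a₁ (1 - star a₂) v

/-- Row `j` of the columns `X^{(N)}_{d^I_1}, …, Y^{(N)}_{d^II_1}, …`. -/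
def chRow (a₁ a₂ : ℂ) {M₁ M₂ : ℕ} (d₁ : Fin M₁ → ℕ) (d₂ : Fin M₂ → ℕ) (N : ℕ) (j : Fin N) :
    Fin (M₁ + M₂) → ℂ[X] :=
  Fin.append
    (fun k : Fin M₁ => rFun a₂ N j * (chXiI a₁ a₂ (d₁ k)).comp (node N j))
    (fun k : Fin M₂ => rFun a₁ N j * (chXiII a₁ a₂ (d₂ k)).comp (node N j))

/-- The product
`∏_{j=1}^{m₁} (a_2 - s + i x, a_2^* - s - i x)_j * ∏_{j=1}^{m₂} (a_1 - s + i x, a_1^* - s - i x)_j`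
which is factored out of the determinants. -/
def chFactor (a₁ a₂ s : ℂ) (m₁ m₂ : ℕ) : ℂ[X] :=
  (∏ j ∈ Finset.Icc 1 m₁, poch (linPlus (a₂ - s)) j * poch (linMinus (star a₂ - s)) j) *
  (∏ j ∈ Finset.Icc 1 m₂, poch (linPlus (a₁ - s)) j * poch (linMinus (star a₁ - s)) j)

/-- The determinant (with its power of `i`) that defines `Ξ_D`. -/
def chDenomDet (a₁ a₂ : ℂ) {M₁ M₂ : ℕ} (d₁ : Fin M₁ → ℕ) (d₂ : Fin M₂ → ℕ) : ℂ[X] :=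
  C (Complex.I ^ ((M₁ + M₂) * (M₁ + M₂ - 1) / 2)) *
    Matrix.det (Matrix.of fun j : Fin (M₁ + M₂) => chRow a₁ a₂ d₁ d₂ (M₁ + M₂) j)

/-- The factor `A` of `chDenomDet`; for `M₁ = 0` or `M₂ = 0` the respective product is empty. -/
def chDenomFactor (a₁ a₂ : ℂ) (M₁ M₂ : ℕ) : ℂ[X] :=
  chFactor a₁ a₂ ((((M₁ + M₂ : ℕ) : ℂ) - 1) / 2) (M₁ - 1) (M₂ - 1)

/-- The denominator polynomial `Ξ_D` for continuous Hahn: the quotient of the determinant by its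
(nonzero) factor `A`. That the division is exact is asserted in the theorem. -/
def chDenom (a₁ a₂ : ℂ) {M₁ M₂ : ℕ} (d₁ : Fin M₁ → ℕ) (d₂ : Fin M₂ → ℕ) : ℂ[X] :=
  chDenomDet a₁ a₂ d₁ d₂ / chDenomFactor a₁ a₂ M₁ M₂

/-- The determinant (with its power of `i`) that defines `P_{D,n}`. -/
def chMultiDet (a₁ a₂ : ℂ) {M₁ M₂ : ℕ} (d₁ : Fin M₁ → ℕ) (d₂ : Fin M₂ → ℕ) (n : ℕ) : ℂ[X] :=
  C (Complex.I ^ ((M₁ + M₂) * (M₁ + M₂ + 1) / 2)) *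
    Matrix.det (Matrix.of fun j : Fin (M₁ + M₂ + 1) =>
      (Fin.snoc (chRow a₁ a₂ d₁ d₂ (M₁ + M₂ + 1) j)
        (rFun a₂ (M₁ + M₂ + 1) j * rFun a₁ (M₁ + M₂ + 1) j *
          (chPoly a₁ a₂ n).comp (node (M₁ + M₂ + 1) j)) : Fin (M₁ + M₂ + 1) → ℂ[X]))

/-- The factor `B` of `chMultiDet`. -/
def chMultiFactor (a₁ a₂ : ℂ) (M₁ M₂ : ℕ) : ℂ[X] :=
  chFactor a₁ a₂ (((M₁ + M₂ : ℕ) : ℂ) / 2) M₁ M₂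

/-- The multi-indexed continuous Hahn polynomial `P_{D,n}`: the quotient of the determinant by its
(nonzero) factor `B`. That the division is exact is asserted in the theorem. -/
def chMulti (a₁ a₂ : ℂ) {M₁ M₂ : ℕ} (d₁ : Fin M₁ → ℕ) (d₂ : Fin M₂ → ℕ) (n : ℕ) : ℂ[X] :=
  chMultiDet a₁ a₂ d₁ d₂ n / chMultiFactor a₁ a₂ M₁ M₂

/-- `ℓ_D = ∑ d_j - M (M - 1) / 2 + 2 M_I M_II` with `M = M_I + M_II`; the subtraction does not
truncate when the `d^I_j` and the `d^II_j` are mutually distinct. -/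
def chEll {M₁ M₂ : ℕ} (d₁ : Fin M₁ → ℕ) (d₂ : Fin M₂ → ℕ) : ℕ :=
  (∑ j, d₁ j + ∑ j, d₂ j + 2 * M₁ * M₂) - (M₁ + M₂) * (M₁ + M₂ - 1) / 2

/-- The explicit constant `c_D^Ξ`, the expected coefficient of `x^{ℓ_D}` in `Ξ_D`. -/
def chDenomLead (a₁ a₂ : ℂ) {M₁ M₂ : ℕ} (d₁ : Fin M₁ → ℕ) (d₂ : Fin M₂ → ℕ) : ℂ :=
  (∏ j, chLead (1 - star a₁) a₂ (d₁ j)) * (∏ j, chLead a₁ (1 - star a₂) (d₂ j)) *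
  (∏ j, ∏ k ∈ Finset.Ioi j, ((d₁ k : ℂ) - d₁ j)) *
  (∏ j, ∏ k ∈ Finset.Ioi j, ((d₂ k : ℂ) - d₂ j)) *
  ∏ j, ∏ k, (-a₂ - star a₂ - d₁ j + a₁ + star a₁ + d₂ k)

/-! ### The map `I` -/

/-- `g'_n^{(k)}`: the coefficients in
`((x - i/2)^{n+1} - (x + i/2)^{n+1}) / ((x - i/2) - (x + i/2)) = ∑_{k=0}^n g'_n^{(k)} x^{n-k}`. -/
def gCoeff (n k : ℕ) : ℂ :=
  if Even k then (-1) ^ (k / 2) * ((2 : ℂ) ^ k)⁻¹ * ((n + 1).choose (k + 1) : ℂ) else 0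

/-- The coefficients `b_k` of `I[p]`: `b_0 = 0` and, downwards from `n = deg p`,
`b_{k+1} = (a_k - ∑_{j=k+1}^n g'_j^{(j-k)} b_{j+1}) / g'_k^{(0)}`. -/
def invDiffCoeff (p : ℂ[X]) : ℕ → ℂ
  | 0 => 0
  | k + 1 =>
      (gCoeff k 0)⁻¹ * (p.coeff k -
        ∑ j : {j // j ∈ Finset.Ioc k p.natDegree},
          gCoeff j.1 (j.1 - k) * invDiffCoeff p (j.1 + 1))
termination_by k => p.natDegree + 2 - k
decreasing_by
  have h := Finset.mem_Ioc.1 j.2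
  omega

/-- The polynomial `I[p]`. -/
def invDiff (p : ℂ[X]) : ℂ[X] :=
  ∑ k ∈ Finset.range (p.natDegree + 2), monomial k (invDiffCoeff p k)

theorem shift_pow_sub (n : ℕ) :
    (X - C (Complex.I / 2)) ^ (n + 1) - (X + C (Complex.I / 2)) ^ (n + 1) =
      C (-Complex.I) * ∑ k ∈ Finset.range (n + 1), C (gCoeff n k) * X ^ (n - k) := by
  have key : ∀ h : ℂ, (X + C h) ^ (n + 1) = X ^ (n + 1) + ∑ k ∈ Finset.range (n + 1),
      C (h ^ (k + 1) * ((n + 1).choose (k + 1) : ℂ)) * X ^ (n - k) := by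
    intro h
    rw [add_comm X, add_pow, Finset.sum_range_succ', add_comm]
    simp only [pow_zero, Nat.sub_zero, one_mul, Nat.choose_zero_right, Nat.cast_one, mul_one]
    congr 1
    refine Finset.sum_congr rfl fun k _ => ?_
    rw [Nat.add_sub_add_right]
    simp only [map_mul, map_pow, map_natCast]
    ring
  rw [sub_eq_add_neg X, ← C_neg, key, key, add_sub_add_left_eq_sub, ← Finset.sum_sub_distrib,
    Finset.mul_sum]
  refine Finset.sum_congr rfl fun k _ => ?_
  rw [← sub_mul, ← C_sub, ← mul_assoc, ← C_mul]
  congr 2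
  unfold gCoeff
  split_ifs with hk
  · obtain ⟨m, rfl⟩ := hk
    have h2 : (m + m) / 2 = m := by omega
    have hI : (Complex.I) ^ (m + m) = (-1) ^ m := by rw [← two_mul, pow_mul, Complex.I_sq]
    rw [h2, neg_pow, pow_succ (-1 : ℂ), ← two_mul, pow_mul (-1 : ℂ), neg_one_sq, one_pow, two_mul,
      div_pow, pow_succ Complex.I, hI, pow_succ (2 : ℂ)]
    field_simp
    ring
  · have ho : Even (k + 1) := by
      rw [Nat.even_add_one]; exact hk
    rw [ho.neg_pow]
    simp

/-- `I` inverts the divided difference with the shifts `± i/2`. -/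
theorem invDiff_spec (p : ℂ[X]) :
    (invDiff p).comp (X - C (Complex.I / 2)) - (invDiff p).comp (X + C (Complex.I / 2)) =
      C (-Complex.I) * p := by
  have h0 : invDiffCoeff p 0 = 0 := by rw [invDiffCoeff]
  have hc : ∀ q : ℂ[X], (invDiff p).comp q =
      ∑ m ∈ Finset.range (p.natDegree + 1), C (invDiffCoeff p (m + 1)) * q ^ (m + 1) := by
    intro q
    rw [invDiff, Finset.sum_range_succ', h0, monomial_zero_right, add_zero,
      Polynomial.sum_comp]
    exact Finset.sum_congr rfl fun m _ => monomial_comp _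
  rw [hc, hc, ← Finset.sum_sub_distrib]
  simp_rw [← mul_sub, shift_pow_sub]
  have hsum : p = ∑ m ∈ Finset.range (p.natDegree + 1), C (invDiffCoeff p (m + 1)) *
      ∑ k ∈ Finset.range (m + 1), C (gCoeff m k) * X ^ (m - k) := by
    ext t
    have hin : ∀ m, (∑ k ∈ Finset.range (m + 1), C (gCoeff m k) * X ^ (m - k)).coeff t =
        if t ≤ m then gCoeff m (m - t) else 0 := by
      intro m
      rw [finsetSum_coeff]
      simp only [coeff_C_mul, coeff_X_pow]
      split_ifs with h
      · rw [Finset.sum_eq_single (m - t)]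
        · rw [if_pos (by omega), mul_one]
        · intro k hk hne
          rw [Finset.mem_range] at hk
          rw [if_neg (by omega), mul_zero]
        · intro hk
          exact absurd (Finset.mem_range.2 (by omega)) hk
      · refine Finset.sum_eq_zero fun k _ => ?_
        rw [if_neg (by omega), mul_zero]
    rw [finsetSum_coeff]
    simp only [coeff_C_mul, hin, mul_ite, mul_zero]
    rw [← Finset.sum_filter]
    by_cases ht : t ≤ p.natDegree
    · have hf : (Finset.range (p.natDegree + 1)).filter (fun m => t ≤ m) =
          insert t (Finset.Ioc t p.natDegree) := by
        ext m
        simp only [Finset.mem_filter, Finset.mem_range, Finset.mem_insert, Finset.mem_Ioc]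
        omega
      have hg : gCoeff t 0 ≠ 0 := by
        simp only [gCoeff, Even.zero, if_true]
        simp
        exact_mod_cast Nat.succ_ne_zero t
      rw [hf, Finset.sum_insert (by simp), Nat.sub_self, invDiffCoeff,
        Finset.sum_coe_sort (Finset.Ioc t p.natDegree)
          (fun j => gCoeff j (j - t) * invDiffCoeff p (j + 1))]
      rw [mul_comm _ (gCoeff t 0), ← mul_assoc, mul_inv_cancel₀ hg, one_mul]
      rw [Finset.sum_congr rfl fun j _ => mul_comm (invDiffCoeff p (j + 1)) (gCoeff j (j - t))]
      ring
    · rw [coeff_eq_zero_of_natDegree_lt (by omega), Finset.sum_eq_zero]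
      intro m hm
      simp only [Finset.mem_filter, Finset.mem_range] at hm
      omega
  conv_rhs => rw [hsum, Finset.mul_sum]
  refine Finset.sum_congr rfl fun m _ => ?_
  ring

/-! ### Sequences indexed by integers -/

/-- The extension of a sequence of polynomials to negative indices by zero. -/
def extendZero (P : ℕ → ℂ[X]) (m : ℤ) : ℂ[X] := if 0 ≤ m then P m.toNat else 0

end MultiIndexed

end

open Polynomial

noncomputable section

namespace MultiIndexed

/-! ### Top coefficients -/

-- Let y be the node of the top row, so that the rows of a determinant sit at the points y - ij.
-- Both families P_n are eigenpolynomials of a difference operator H p = V(y)(p(y - i) - p(y)) +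
-- V'(y)(p(y + i) - p(y)), where V = κ ∏ (c_s + iy) and V' = κ' ∏ (c'_s - iy), with one factor for
-- Meixner–Pollaczek and two for continuous Hahn. Each virtual state ξ_k, divided by a gauge factor
-- built from Gamma functions, is a further eigenfunction of H on the lattice y - iℤ, with
-- eigenvalue E_k. Up to constants, shifts and common factors, Ξ is the Casorati determinant of the
-- seeds ξ_k, and the multi-indexed polynomial is F(P_n), the determinant of the seeds together with
-- P_n (`fullDet`). In the coordinate y the definition of X reads Xb(y) - Xb(y + i) = Ξ Yb.
--
-- Lift. Multiplication by Xb lifts through F: there is Z with F(Zp) = Xb F(p). By Cramer's rule Ξ p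
-- is a combination ∑ w_k ξ_k on every M consecutive nodes (up to gauge). One looks for Zp = Xb p -
-- ∑ T_k ξ_k; the failure of Xb to be i-periodic is compensated if T_k solves a first-order
-- difference equation with right-hand side Yb w_k, which has polynomial solutions
-- (`exists_first_order_solution`). A coprimality argument shows that Zp is a polynomial
-- (`exists_isLift`), and column operations give F(Zp) = Xb F(p) (`IsLift.det_fullMatrix`).
--
-- Symmetry. An abstract linear functional L with a Pearson equation makes H symmetric and is
-- nondegenerate (`exists_pearson`, `Pearson.nondegenerate`). Put Q = ∏ (t - E_k). Then Z is
-- symmetric for the form L(p · Q(H) g) (`IsLift.symm`): Green's identity for Q(H) leaves a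
-- concomitant of p and g, summation by parts in the seed terms leaves Casoratians with the seeds,
-- and the two cancel because p and g agree on M nodes with combinations of M eigenvectors
-- annihilated by Q(H) (`lattice_concomitant`, `seed_concomitant_identity`).
--
-- Bandedness. In the basis P_n the form is diagonal with nonzero entries. Since deg F(P_n) = ℓ + n,
-- the expansion of Z P_n stops at index n + deg Xb; symmetry bounds it from below by n - deg Xb
-- (`mul_mem_span_of_symm`). The degrees come from a leading coefficient that forward differences
-- reduce to a Vandermonde determinant (`hasTop_casorati`).
--
-- The lift and the functional need parameters in general position. The remaining parameters are
-- limits of such ones, and the span relation survives because the degrees stay fixed and the F(P_k)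
-- stay linearly independent (`mul_mem_span_of_frequently_generic`). A shift returns to the variable
-- x (`recurrence_of_base`).

/-- `f` has no coefficients above the (possibly negative) degree `d`, and its coefficient in degree
`d` is `a`, where `a = 0` if `d < 0`. -/
def HasTop (f : ℂ[X]) (d : ℤ) (a : ℂ) : Prop :=
  (∀ n : ℕ, d < n → f.coeff n = 0) ∧ (∀ n : ℕ, (n : ℤ) = d → f.coeff n = a) ∧ (d < 0 → a = 0)

theorem HasTop.eq_zero {f : ℂ[X]} {d : ℤ} {a : ℂ} (h : HasTop f d a) (hd : d < 0) : f = 0 := by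
  ext n
  simpa using h.1 n (by omega)

theorem hasTop_zero (d : ℤ) : HasTop 0 d 0 :=
  ⟨fun _ _ => by simp, fun _ _ => by simp, fun _ => rfl⟩

theorem hasTop_natCast {f : ℂ[X]} {n : ℕ} {a : ℂ} :
    HasTop f n a ↔ f.natDegree ≤ n ∧ f.coeff n = a := by
  constructor
  · rintro ⟨h1, h2, -⟩
    refine ⟨natDegree_le_iff_coeff_eq_zero.2 fun m hm => h1 m (by exact_mod_cast hm), h2 n rfl⟩
  · rintro ⟨h1, h2⟩
    refine ⟨fun m hm => coeff_eq_zero_of_natDegree_lt (by omega), fun m hm => ?_, fun h => by omega⟩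
    obtain rfl : m = n := by omega
    exact h2

theorem hasTop_natDegree (f : ℂ[X]) : HasTop f f.natDegree f.leadingCoeff :=
  hasTop_natCast.2 ⟨le_rfl, rfl⟩

theorem HasTop.natDegree_eq {f : ℂ[X]} {n : ℕ} {a : ℂ} (h : HasTop f n a) (ha : a ≠ 0) :
    f.natDegree = n := by
  rw [hasTop_natCast] at h
  exact natDegree_eq_of_le_of_coeff_ne_zero h.1 (by rw [h.2]; exact ha)

theorem HasTop.mul {f g : ℂ[X]} {d e : ℤ} {a b : ℂ} (hf : HasTop f d a) (hg : HasTop g e b) :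
    HasTop (f * g) (d + e) (a * b) := by
  rcases lt_or_ge d 0 with hd | hd
  · rw [hf.eq_zero hd, hf.2.2 hd, zero_mul, zero_mul]
    exact hasTop_zero _
  rcases lt_or_ge e 0 with he | he
  · rw [hg.eq_zero he, hg.2.2 he, mul_zero, mul_zero]
    exact hasTop_zero _
  lift d to ℕ using hd
  lift e to ℕ using he
  rw [hasTop_natCast] at hf hg
  have : ((d : ℤ) + e) = ((d + e : ℕ) : ℤ) := by push_cast; rfl
  rw [this, hasTop_natCast]
  refine ⟨natDegree_mul_le_of_le hf.1 hg.1, ?_⟩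
  rw [coeff_mul_add_eq_of_natDegree_le hf.1 hg.1, hf.2, hg.2]

theorem HasTop.add {f g : ℂ[X]} {d : ℤ} {a b : ℂ} (hf : HasTop f d a) (hg : HasTop g d b) :
    HasTop (f + g) d (a + b) :=
  ⟨fun n hn => by rw [coeff_add, hf.1 n hn, hg.1 n hn, add_zero],
    fun n hn => by rw [coeff_add, hf.2.1 n hn, hg.2.1 n hn],
    fun hd => by rw [hf.2.2 hd, hg.2.2 hd, add_zero]⟩

theorem hasTop_C (a : ℂ) : HasTop (C a) 0 a := by
  have := (hasTop_natCast (f := C a) (n := 0) (a := a)).2 (by simp)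
  simpa using this

theorem HasTop.sum {κ : Type*} {s : Finset κ} {f : κ → ℂ[X]} {d : ℤ} {a : κ → ℂ}
    (h : ∀ i ∈ s, HasTop (f i) d (a i)) : HasTop (∑ i ∈ s, f i) d (∑ i ∈ s, a i) := by
  classical
  induction s using Finset.induction_on with
  | empty => simpa using hasTop_zero d
  | insert i s hi ih =>
    rw [Finset.sum_insert hi, Finset.sum_insert hi]
    exact (h i (Finset.mem_insert_self i s)).add
      (ih fun j hj => h j (Finset.mem_insert_of_mem hj))

theorem HasTop.prod {κ : Type*} {s : Finset κ} {f : κ → ℂ[X]} {d : κ → ℤ} {a : κ → ℂ}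
    (h : ∀ i ∈ s, HasTop (f i) (d i) (a i)) :
    HasTop (∏ i ∈ s, f i) (∑ i ∈ s, d i) (∏ i ∈ s, a i) := by
  classical
  induction s using Finset.induction_on with
  | empty => simpa using hasTop_C 1
  | insert i s hi ih =>
    rw [Finset.prod_insert hi, Finset.prod_insert hi, Finset.sum_insert hi]
    exact (h i (Finset.mem_insert_self i s)).mul
      (ih fun j hj => h j (Finset.mem_insert_of_mem hj))

theorem HasTop.taylor {f : ℂ[X]} {d : ℤ} {a : ℂ} (h : HasTop f d a) (r : ℂ) :
    HasTop (Polynomial.taylor r f) d a := by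
  rcases lt_or_ge d 0 with hd | hd
  · rw [h.eq_zero hd, h.2.2 hd, map_zero]
    exact hasTop_zero _
  lift d to ℕ using hd
  rw [hasTop_natCast] at h ⊢
  refine ⟨by rw [natDegree_taylor]; exact h.1, ?_⟩
  rcases h.1.eq_or_lt with h1 | h1
  · rw [← h1, coeff_taylor_natDegree, ← h.2, ← h1]; rfl
  · rw [coeff_eq_zero_of_natDegree_lt (by rw [natDegree_taylor]; exact h1), ← h.2,
      coeff_eq_zero_of_natDegree_lt h1]

/-- `f` has degree at most `m`, and its coefficients in degrees `m` and `m - 1` are `a` and `b`. -/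
def HasTopTwo (f : ℂ[X]) (m : ℕ) (a b : ℂ) : Prop :=
  f.natDegree ≤ m ∧ (reflect m f).coeff 0 = a ∧ (reflect m f).coeff 1 = b

/-- Reversal turns the two top coefficients into the two lowest ones, which multiply by
`mul_coeff_zero` and `mul_coeff_one`. -/
theorem HasTopTwo.mul {f g : ℂ[X]} {m n : ℕ} {a b a' b' : ℂ} (hf : HasTopTwo f m a b)
    (hg : HasTopTwo g n a' b') : HasTopTwo (f * g) (m + n) (a * a') (a * b' + b * a') := by
  refine ⟨natDegree_mul_le_of_le hf.1 hg.1, ?_, ?_⟩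
  · rw [reflect_mul _ _ hf.1 hg.1, mul_coeff_zero, hf.2.1, hg.2.1]
  · rw [reflect_mul _ _ hf.1 hg.1, mul_coeff_one, hf.2.1, hg.2.1, hf.2.2, hg.2.2]

theorem HasTopTwo.sub {f g : ℂ[X]} {m : ℕ} {a b a' b' : ℂ} (hf : HasTopTwo f m a b)
    (hg : HasTopTwo g m a' b') : HasTopTwo (f - g) m (a - a') (b - b') := by
  refine ⟨(natDegree_sub_le_of_le hf.1 hg.1).trans (max_self m).le, ?_, ?_⟩
  · rw [reflect_sub, coeff_sub, hf.2.1, hg.2.1]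
  · rw [reflect_sub, coeff_sub, hf.2.2, hg.2.2]

theorem HasTopTwo.add {f g : ℂ[X]} {m : ℕ} {a b a' b' : ℂ} (hf : HasTopTwo f m a b)
    (hg : HasTopTwo g m a' b') : HasTopTwo (f + g) m (a + a') (b + b') := by
  refine ⟨natDegree_add_le_of_degree_le hf.1 hg.1, ?_, ?_⟩
  · rw [reflect_add, coeff_add, hf.2.1, hg.2.1]
  · rw [reflect_add, coeff_add, hf.2.2, hg.2.2]

theorem hasTopTwo_of_natDegree_le {f : ℂ[X]} {m : ℕ} (h : f.natDegree ≤ m) :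
    HasTopTwo f m (f.coeff m) ((reflect m f).coeff 1) := by
  refine ⟨h, ?_, rfl⟩
  rw [coeff_reflect, revAt_le (Nat.zero_le _), Nat.sub_zero]

theorem hasTopTwo_C (a : ℂ) : HasTopTwo (C a) 0 a 0 := by
  refine ⟨by simp, ?_, ?_⟩ <;> simp [reflect_C, coeff_C]

theorem hasTopTwo_linear {f : ℂ[X]} {a b : ℂ} (hf : f = C a * X + C b) : HasTopTwo f 1 a b := by
  subst hf
  refine ⟨natDegree_linear_le, ?_, ?_⟩
  · rw [coeff_reflect, revAt_le (Nat.zero_le _)]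
    simp
  · rw [coeff_reflect, revAt_le le_rfl]
    simp

theorem hasTopTwo_linPlus (c : ℂ) : HasTopTwo (linPlus c) 1 Complex.I c :=
  hasTopTwo_linear (by rw [linPlus]; ring)

theorem hasTopTwo_linMinus (c : ℂ) : HasTopTwo (linMinus c) 1 (-Complex.I) c :=
  hasTopTwo_linear (by rw [linMinus, C_neg]; ring)

theorem HasTopTwo.congr {f : ℂ[X]} {m : ℕ} {a b a' b' : ℂ} (h : HasTopTwo f m a b)
    (ha : a = a') (hb : b = b') : HasTopTwo f m a' b' := ha ▸ hb ▸ h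

theorem hasTopTwo_prod_linPlus {ι : Type*} (s : Finset ι) (c : ι → ℂ) :
    HasTopTwo (∏ i ∈ s, linPlus (c i)) s.card (Complex.I ^ s.card)
      (-Complex.I * Complex.I ^ s.card * ∑ i ∈ s, c i) := by
  classical
  induction s using Finset.induction_on with
  | empty => simpa using hasTopTwo_C 1
  | insert i s hi ih =>
    rw [Finset.prod_insert hi, Finset.sum_insert hi, Finset.card_insert_of_notMem hi,
      add_comm s.card 1]
    refine ((hasTopTwo_linPlus (c i)).mul ih).congr (by rw [pow_add, pow_one]) ?_
    rw [pow_add, pow_one]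
    linear_combination (c i * Complex.I ^ s.card) * Complex.I_sq

theorem hasTopTwo_prod_linMinus {ι : Type*} (s : Finset ι) (c : ι → ℂ) :
    HasTopTwo (∏ i ∈ s, linMinus (c i)) s.card ((-Complex.I) ^ s.card)
      (Complex.I * (-Complex.I) ^ s.card * ∑ i ∈ s, c i) := by
  classical
  induction s using Finset.induction_on with
  | empty => simpa using hasTopTwo_C 1
  | insert i s hi ih =>
    rw [Finset.prod_insert hi, Finset.sum_insert hi, Finset.card_insert_of_notMem hi,
      add_comm s.card 1]
    refine ((hasTopTwo_linMinus (c i)).mul ih).congr (by rw [pow_add, pow_one]) ?_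
    rw [pow_add, pow_one]
    linear_combination (c i * (-Complex.I) ^ s.card) * Complex.I_sq

theorem HasTopTwo.taylor {f : ℂ[X]} {m : ℕ} {a b : ℂ} (h : HasTopTwo f m a b) (r : ℂ) :
    HasTopTwo (Polynomial.taylor r f) m a (b + m * r * a) := by
  obtain ⟨h1, h2, h3⟩ := h
  have hT := hasTop_natCast.1 ((hasTop_natCast.2 ⟨h1, rfl⟩ : HasTop f m (f.coeff m)).taylor r)
  rw [coeff_reflect, revAt_le (Nat.zero_le _), Nat.sub_zero] at h2
  refine ⟨hT.1, ?_, ?_⟩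
  · rw [coeff_reflect, revAt_le (Nat.zero_le _), Nat.sub_zero, hT.2, h2]
  rcases m with _ | m
  · rw [coeff_reflect] at h3 ⊢
    rw [revAt_eq_self_of_lt one_pos] at h3 ⊢
    rw [coeff_eq_zero_of_natDegree_lt (by omega)] at h3 ⊢
    simp [← h3]
  · rw [coeff_reflect, revAt_le (by omega), Nat.add_sub_cancel] at h3 ⊢
    -- The `m`-th Hasse derivative of a polynomial of degree at most `m + 1` is linear, so two terms
    -- suffice.
    rw [taylor_coeff, eval_eq_sum_range' (n := 2)]
    · simp only [Finset.sum_range_succ, Finset.sum_range_zero, hasseDeriv_coeff]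
      rw [add_comm 1 m, zero_add, zero_add, h2, h3]
      simp
      ring
    · refine lt_of_le_of_lt (natDegree_hasseDeriv_le f m) (by omega)

theorem HasTopTwo.hasTop {f : ℂ[X]} {m : ℕ} {b : ℂ} (h : HasTopTwo f m 0 b) :
    HasTop f ((m : ℤ) - 1) b := by
  obtain ⟨h1, h2, h3⟩ := h
  rw [coeff_reflect, revAt_le (Nat.zero_le _), Nat.sub_zero] at h2
  have hlt : ∀ n : ℕ, (m : ℤ) - 1 < n → f.coeff n = 0 := by
    intro n hn
    rcases (show m ≤ n by omega).eq_or_lt with rfl | hn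
    · exact h2
    · exact coeff_eq_zero_of_natDegree_lt (by omega)
  refine ⟨hlt, ?_, ?_⟩
  · rintro n hn
    obtain rfl : m = n + 1 := by omega
    rw [coeff_reflect, revAt_le (by omega), Nat.add_sub_cancel] at h3
    exact h3
  · intro hm
    obtain rfl : m = 0 := by omega
    rw [coeff_reflect, revAt_eq_self_of_lt one_pos, hlt 1 (by omega)] at h3
    exact h3.symm

/-- To leading order the shift difference is `r` times the derivative. For `d = 0` the factor `d`
supplies the zero that degree `-1` demands. -/
theorem hasTop_sub_taylor {f : ℂ[X]} {d : ℤ} {a : ℂ} (h : HasTop f d a) (r : ℂ) :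
    HasTop (taylor r f - f) (d - 1) (d * r * a) := by
  rcases lt_or_ge d 0 with hd | hd
  · rw [h.eq_zero hd, h.2.2 hd]
    simpa using hasTop_zero (d - 1)
  lift d to ℕ using hd
  rw [hasTop_natCast] at h
  have h2 := hasTopTwo_of_natDegree_le h.1
  rw [h.2] at h2
  exact ((h2.taylor r).sub h2 |>.congr (sub_self a) (by push_cast; ring)).hasTop

theorem natDegree_eq_zero_of_taylor_eq {f : ℂ[X]} {r : ℂ} (hr : r ≠ 0) (h : taylor r f = f) :
    f.natDegree = 0 := by
  by_contra hne
  have h1 := hasTop_sub_taylor (hasTop_natDegree f) r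
  rw [h, sub_self] at h1
  have h2 := h1.2.1 (f.natDegree - 1) (by omega)
  rw [coeff_zero] at h2
  have hf : f ≠ 0 := by rintro rfl; simp at hne
  have : (f.natDegree : ℂ) ≠ 0 := by exact_mod_cast hne
  exact mul_ne_zero (mul_ne_zero (by exact_mod_cast hne) hr) (leadingCoeff_ne_zero.2 hf) h2.symm

/-- A linear map that multiplies the coefficient of degree `n` of every polynomial of degree at
most `n` by a nonzero factor is onto. -/
theorem surjective_of_hasTop (φ : ℂ[X] →ₗ[ℂ] ℂ[X]) (ev : ℕ → ℂ) (hev : ∀ n, ev n ≠ 0)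
    (h : ∀ f : ℂ[X], ∀ n : ℕ, f.natDegree ≤ n → HasTop (φ f) n (ev n * f.coeff n)) :
    Function.Surjective φ := by
  have key : ∀ n : ℕ, ∀ g : ℂ[X], g.natDegree < n → ∃ f, φ f = g := by
    intro n
    induction n with
    | zero => intro g hg; omega
    | succ n ih =>
      intro g hg
      set f₀ : ℂ[X] := monomial n (g.coeff n / ev n) with hf₀
      have h0 := hasTop_natCast.1 (h f₀ n (natDegree_monomial_le _))
      rw [hf₀, coeff_monomial_same, mul_div_cancel₀ _ (hev n), ← hf₀] at h0
      rcases eq_or_ne (g - φ f₀) 0 with hz | hz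
      · exact ⟨f₀, (sub_eq_zero.1 hz).symm⟩
      have hle : (g - φ f₀).natDegree ≤ n :=
        (natDegree_sub_le_of_le (Nat.lt_succ_iff.1 hg) h0.1).trans (max_self n).le
      -- In degree 0 the induction hypothesis says nothing; there the difference is a constant whose
      -- only coefficient has been cancelled.
      rcases n with _ | n
      · exfalso
        apply hz
        rw [eq_C_of_natDegree_le_zero hle, coeff_sub, h0.2, sub_self, C_0]
      have hlt : (g - φ f₀).natDegree < n + 1 := by
        refine lt_of_le_of_ne hle fun he => hz ?_
        rw [← leadingCoeff_eq_zero, leadingCoeff, he, coeff_sub, h0.2, sub_self]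
      obtain ⟨f, hf⟩ := ih _ hlt
      exact ⟨f + f₀, by rw [map_add, hf, sub_add_cancel]⟩
  exact fun g => key _ g (Nat.lt_succ_self _)

/-! ### The bilinear concomitant of a polynomial in an operator -/

section Concomitant

variable {W U Y : Type*} [AddCommGroup W] [Module ℂ W] [AddCommGroup U] [Module ℂ U]
  [AddCommGroup Y] [Module ℂ Y]

/-- For `P = ∑ aₙ Xⁿ`, the bilinear map `∑ₙ aₙ ∑_{i < n} w (Hⁱ p) (H^{n-1-i} g)`. -/
def concomitant (H : Module.End ℂ W) (w : W →ₗ[ℂ] W →ₗ[ℂ] U) (P : ℂ[X]) : W →ₗ[ℂ] W →ₗ[ℂ] U :=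
  ∑ n ∈ P.support, P.coeff n •
    ∑ i ∈ Finset.range n, w.compl₁₂ (H ^ i) (H ^ (n - 1 - i))

theorem concomitant_apply (H : Module.End ℂ W) (w : W →ₗ[ℂ] W →ₗ[ℂ] U) (P : ℂ[X]) (p g : W) :
    concomitant H w P p g = ∑ n ∈ P.support, P.coeff n •
      ∑ i ∈ Finset.range n, w ((H ^ i) p) ((H ^ (n - 1 - i)) g) := by
  simp [concomitant, LinearMap.sum_apply]

theorem concomitant_swap {H : Module.End ℂ W} {w : W →ₗ[ℂ] W →ₗ[ℂ] U}
    (hw : ∀ p g, w p g = -w g p) (P : ℂ[X]) (p g : W) :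
    concomitant H w P p g = -concomitant H w P g p := by
  rw [concomitant_apply, concomitant_apply, ← Finset.sum_neg_distrib]
  refine Finset.sum_congr rfl fun n _ => ?_
  rw [← smul_neg, ← Finset.sum_neg_distrib]
  congr 1
  rw [← Finset.sum_range_reflect]
  refine Finset.sum_congr rfl fun i hi => ?_
  rw [Finset.mem_range] at hi
  rw [hw, show n - 1 - (n - 1 - i) = i by omega]

theorem aeval_apply_eq_sum (H : Module.End ℂ W) (P : ℂ[X]) (g : W) :
    aeval H P g = ∑ n ∈ P.support, P.coeff n • (H ^ n) g := by
  rw [aeval_eq_sum_range, LinearMap.sum_apply]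
  symm
  refine Finset.sum_subset_zero_on_sdiff supp_subset_range_natDegree_succ ?_ fun n _ => rfl
  intro n hn
  rw [Finset.mem_sdiff, notMem_support_iff] at hn
  rw [hn.2, zero_smul, LinearMap.zero_apply]

/-- Green's identity for polynomials in `H`. -/
theorem green_aeval {H : Module.End ℂ W} {w : W →ₗ[ℂ] W →ₗ[ℂ] U} (b : W →ₗ[ℂ] W →ₗ[ℂ] Y)
    (δ : U →ₗ[ℂ] Y) (h : ∀ p g, b p (H g) - b (H p) g = δ (w p g)) (P : ℂ[X]) (p g : W) :
    b p (aeval H P g) - b (aeval H P p) g = δ (concomitant H w P p g) := by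
  rw [aeval_apply_eq_sum, aeval_apply_eq_sum, concomitant_apply]
  simp only [map_sum, map_smul, LinearMap.sum_apply, LinearMap.smul_apply]
  rw [← Finset.sum_sub_distrib]
  refine Finset.sum_congr rfl fun n _ => ?_
  rw [← smul_sub]
  congr 1
  simp only [← h]
  -- Moving one factor `H` at a time from the right slot to the left makes the sum telescope.
  have : ∀ i ∈ Finset.range n, b ((H ^ i) p) (H ((H ^ (n - 1 - i)) g)) -
      b (H ((H ^ i) p)) ((H ^ (n - 1 - i)) g) =
      b ((H ^ i) p) ((H ^ (n - i)) g) - b ((H ^ (i + 1)) p) ((H ^ (n - (i + 1))) g) := by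
    intro i hi
    rw [Finset.mem_range] at hi
    rw [show n - i = n - 1 - i + 1 by omega, show n - (i + 1) = n - 1 - i by omega,
      pow_succ', pow_succ' H i]
    rfl
  rw [Finset.sum_congr rfl this,
    Finset.sum_range_sub' (fun i => b ((H ^ i) p) ((H ^ (n - i)) g)) n]
  simp

theorem pow_apply_eigen {H : Module.End ℂ W} {ψ : W} {E : ℂ} (h : H ψ = E • ψ) (i : ℕ) :
    (H ^ i) ψ = E ^ i • ψ := by
  induction i with
  | zero => simp
  | succ i ih => rw [pow_succ', Module.End.mul_apply, ih, map_smul, h, smul_smul, pow_succ]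

theorem aeval_apply_eigen {H : Module.End ℂ W} {ψ : W} {E : ℂ} (h : H ψ = E • ψ) (P : ℂ[X]) :
    aeval H P ψ = P.eval E • ψ := by
  rw [aeval_apply_eq_sum, eval_eq_sum, sum_def, Finset.sum_smul]
  refine Finset.sum_congr rfl fun n _ => ?_
  rw [pow_apply_eigen h, smul_smul]

/-- On the eigenvector `H ^ i` acts as `E ^ i`, and ∑ aₙ ∑_{i<n} Eⁱ Xⁿ⁻¹⁻ⁱ is the divided difference
(P - P(E)) / (X - E), which is `P₁` because P(E) = 0. -/
theorem concomitant_eigen {H : Module.End ℂ W} (w : W →ₗ[ℂ] W →ₗ[ℂ] U) {ψ : W} {E : ℂ}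
    (h : H ψ = E • ψ) {P P₁ : ℂ[X]} (hP : P = (X - C E) * P₁) (g : W) :
    concomitant H w P ψ g = w ψ (aeval H P₁ g) := by
  have hQ : P₁ = ∑ n ∈ P.support, C (P.coeff n) *
      ∑ i ∈ Finset.range n, C E ^ i * X ^ (n - 1 - i) := by
    apply mul_left_cancel₀ (X_sub_C_ne_zero E)
    rw [← hP, Finset.mul_sum]
    have hE : ∑ n ∈ P.support, C (P.coeff n) * C E ^ n = 0 := by
      have : P.eval E = 0 := by rw [hP]; simp
      rw [eval_eq_sum, sum_def] at this
      rw [← C_0, ← this, map_sum]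
      simp
    conv_lhs => rw [P.as_sum_support_C_mul_X_pow, ← sub_zero (∑ i ∈ P.support, _), ← hE,
      ← Finset.sum_sub_distrib]
    refine Finset.sum_congr rfl fun n _ => ?_
    rw [mul_left_comm, ← mul_sub]
    congr 1
    have := (Commute.all (C E) (X : ℂ[X])).mul_geom_sum₂ n
    linear_combination this
  rw [hQ, concomitant_apply, map_sum, LinearMap.sum_apply, map_sum]
  refine Finset.sum_congr rfl fun n _ => ?_
  rw [← smul_eq_C_mul, map_smul, LinearMap.smul_apply, map_smul]
  congr 1
  rw [map_sum, LinearMap.sum_apply, map_sum]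
  refine Finset.sum_congr rfl fun i _ => ?_
  rw [pow_apply_eigen h, map_smul, LinearMap.smul_apply, ← C_pow, ← smul_eq_C_mul, map_smul,
    LinearMap.smul_apply, map_smul, map_pow, aeval_X]

end Concomitant

/-! ### Three-term operators on two-sided sequences -/

/-- The three-term operator `(H f)_j = v_j f_{j+1} + v'_j f_{j-1} + u_j f_j`. -/
def latticeOp (v v' u : ℤ → ℂ) : Module.End ℂ (ℤ → ℂ) where
  toFun f j := v j * f (j + 1) + v' j * f (j - 1) + u j * f j
  map_add' f g := by ext j; simp only [Pi.add_apply]; ring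
  map_smul' a f := by ext j; simp only [Pi.smul_apply, smul_eq_mul, RingHom.id_apply]; ring

theorem latticeOp_apply (v v' u f : ℤ → ℂ) (j : ℤ) :
    latticeOp v v' u f j = v j * f (j + 1) + v' j * f (j - 1) + u j * f j := rfl

/-- The Casoratian `p_{h-1} g_h - p_h g_{h-1}`. -/
def latticeCasorati (h : ℤ) : (ℤ → ℂ) →ₗ[ℂ] (ℤ → ℂ) →ₗ[ℂ] ℂ :=
  LinearMap.mk₂ ℂ (fun p g => p (h - 1) * g h - p h * g (h - 1))
    (fun p p' g => by simp only [Pi.add_apply]; ring)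
    (fun a p g => by simp only [Pi.smul_apply, smul_eq_mul]; ring)
    (fun p g g' => by simp only [Pi.add_apply]; ring)
    (fun a p g => by simp only [Pi.smul_apply, smul_eq_mul]; ring)

theorem latticeCasorati_apply (h : ℤ) (p g : ℤ → ℂ) :
    latticeCasorati h p g = p (h - 1) * g h - p h * g (h - 1) := rfl

/-- Finite speed of propagation: each application of a three-term operator shortens an interval of
zeros by one site at either end. -/
theorem latticeOp_pow_eq_zero (v v' u : ℤ → ℂ) {f : ℤ → ℂ} {lo hi : ℤ}
    (hf : ∀ j, lo ≤ j → j ≤ hi → f j = 0) (i : ℕ) :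
    ∀ j, lo + i ≤ j → j ≤ hi - i → ((latticeOp v v' u) ^ i) f j = 0 := by
  induction i with
  | zero => intro j h1 h2; exact hf j (by simpa using h1) (by simpa using h2)
  | succ i ih =>
    intro j h1 h2
    push_cast at h1 h2
    rw [pow_succ', Module.End.mul_apply, latticeOp_apply, ih _ (by omega) (by omega),
      ih _ (by omega) (by omega), ih _ (by omega) (by omega)]
    ring

/-- If `p` and `g` agree with `∑ t_k ψ_k` and `∑ s_k ψ_k` on `M` consecutive sites, where `ψ_k`
are `M` eigenvectors of a three-term operator, then the concomitant of `∏ (X - E_k)` in the middle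
of these sites is expressed by Casoratians with the `ψ_k`. -/
theorem lattice_concomitant {M : ℕ} (v v' u : ℤ → ℂ) (E : Fin M → ℂ) (ψ : Fin M → ℤ → ℂ)
    (hψ : ∀ k, latticeOp v v' u (ψ k) = E k • ψ k) (p g : ℤ → ℂ) (t s : Fin M → ℂ)
    (hp : ∀ j : ℤ, 0 ≤ j → j < M → p j = ∑ k, t k * ψ k j)
    (hg : ∀ j : ℤ, 0 ≤ j → j < M → g j = ∑ k, s k * ψ k j) :
    concomitant (latticeOp v v' u) (latticeCasorati ((M / 2 : ℕ) : ℤ)) (∏ k, (X - C (E k))) p g =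
      ∑ k, (t k * latticeCasorati ((M / 2 : ℕ) : ℤ) (ψ k)
          (aeval (latticeOp v v' u) (∏ l ∈ Finset.univ.erase k, (X - C (E l))) g) -
        s k * latticeCasorati ((M / 2 : ℕ) : ℤ) (ψ k)
          (aeval (latticeOp v v' u) (∏ l ∈ Finset.univ.erase k, (X - C (E l))) p)) := by
  set H := latticeOp v v' u with hH
  set w := latticeCasorati ((M / 2 : ℕ) : ℤ) with hw
  set P : ℂ[X] := ∏ k, (X - C (E k)) with hP
  set P' : Fin M → ℂ[X] := fun k => ∏ l ∈ Finset.univ.erase k, (X - C (E l)) with hP'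
  have hPP : ∀ k, P = (X - C (E k)) * P' k := fun k =>
    (Finset.mul_prod_erase _ _ (Finset.mem_univ k)).symm
  set p₀ : ℤ → ℂ := ∑ k, t k • ψ k with hp₀
  set g₀ : ℤ → ℂ := ∑ k, s k • ψ k with hg₀
  have hanti : ∀ a b, w a b = -w b a := by
    intro a b; simp only [hw, latticeCasorati_apply]; ring
  have hself : ∀ a, w a a = 0 := by
    intro a; simp only [hw, latticeCasorati_apply]; ring
  have h1 : ∀ (r : Fin M → ℂ) b, concomitant H w P (∑ k, r k • ψ k) b =
      ∑ k, r k * w (ψ k) (aeval H (P' k) b) := by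
    intro r b
    rw [map_sum, LinearMap.sum_apply]
    refine Finset.sum_congr rfl fun k _ => ?_
    rw [map_smul, LinearMap.smul_apply, concomitant_eigen w (hψ k) (hPP k), smul_eq_mul]
  -- The product over `l ≠ k` maps `g₀` to a multiple of `ψ k`, whose Casoratian with `ψ k`
  -- vanishes.
  have h2 : concomitant H w P p₀ g₀ = 0 := by
    rw [hp₀, h1]
    refine Finset.sum_eq_zero fun k _ => ?_
    have : aeval H (P' k) g₀ = (s k * (P' k).eval (E k)) • ψ k := by
      rw [hg₀, map_sum, Finset.sum_eq_single k]
      · rw [map_smul, aeval_apply_eigen (hψ k), smul_smul]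
      · intro l _ hl
        rw [map_smul, aeval_apply_eigen (hψ l)]
        have : (P' k).eval (E l) = 0 := by
          simp only [hP', eval_prod]
          exact Finset.prod_eq_zero (Finset.mem_erase.2 ⟨hl, Finset.mem_univ l⟩) (by simp)
        rw [this, zero_smul, smul_zero]
      · intro h; exact absurd (Finset.mem_univ k) h
    rw [this, map_smul, hself, smul_zero, mul_zero]
  have hdeg : P.natDegree = M := by
    rw [hP, natDegree_prod_of_monic _ _ fun k _ => monic_X_sub_C (E k)]
    simp
  -- Both remainders vanish on the sites 0, …, M - 1, and the two powers of `H` add up to at most M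
  -- - 1. So one of them still leaves zeros at both middle sites, or M is odd and both leave a zero
  -- at site M / 2; each way the Casoratian is zero.
  have h3 : concomitant H w P (p - p₀) (g - g₀) = 0 := by
    rw [concomitant_apply]
    refine Finset.sum_eq_zero fun n hn => ?_
    rw [Finset.sum_eq_zero, smul_zero]
    intro i hi
    rw [Finset.mem_range] at hi
    have hnM : n ≤ M := hdeg ▸ le_natDegree_of_mem_supp n hn
    have hz1 : ∀ j : ℤ, 0 ≤ j → j ≤ (M : ℤ) - 1 → (p - p₀) j = 0 := by
      intro j h0 h1
      rw [Pi.sub_apply, hp j h0 (by omega), hp₀]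
      simp
    have hz2 : ∀ j : ℤ, 0 ≤ j → j ≤ (M : ℤ) - 1 → (g - g₀) j = 0 := by
      intro j h0 h1
      rw [Pi.sub_apply, hg j h0 (by omega), hg₀]
      simp
    have z1 := latticeOp_pow_eq_zero v v' u hz1 i
    have z2 := latticeOp_pow_eq_zero v v' u hz2 (n - 1 - i)
    rw [hw, latticeCasorati_apply]
    by_cases hi1 : i + 1 ≤ M / 2
    · rw [z1 _ (by omega) (by omega), z1 _ (by omega) (by omega)]; ring
    by_cases hi2 : n - 1 - i + 1 ≤ M / 2
    · rw [z2 _ (by omega) (by omega), z2 _ (by omega) (by omega)]; ring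
    rw [z1 ((M / 2 : ℕ) : ℤ) (by omega) (by omega), z2 ((M / 2 : ℕ) : ℤ) (by omega) (by omega)]
    ring
  have h4 : concomitant H w P p g =
      concomitant H w P p₀ g - concomitant H w P g₀ p - concomitant H w P p₀ g₀ +
        concomitant H w P (p - p₀) (g - g₀) := by
    rw [← neg_eq_iff_eq_neg.2 (concomitant_swap hanti P p g₀)]
    simp only [map_sub, LinearMap.sub_apply]
    ring
  rw [h4, h2, h3, hp₀, hg₀, h1, h1, sub_zero, add_zero, Finset.sum_sub_distrib]

/-! ### Gauge factors -/

theorem poch_zero {R : Type} [CommSemiring R] (z : R) : poch z 0 = 1 := by simp [poch]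

theorem poch_succ {R : Type} [CommSemiring R] (z : R) (k : ℕ) :
    poch z (k + 1) = poch z k * (z + k) := ascPochhammer_succ_eval k z

theorem poch_succ_left {R : Type} [CommSemiring R] (z : R) (k : ℕ) :
    poch z (k + 1) = z * poch (z + 1) k := by
  simp [poch, ascPochhammer_succ_left]

theorem map_poch {R S : Type} [CommSemiring R] [CommSemiring S] (φ : R →+* S) (z : R) (k : ℕ) :
    φ (poch z k) = poch (φ z) k := by
  induction k with
  | zero => simp [poch_zero]
  | succ k ih => rw [poch_succ, poch_succ, map_mul, ih, map_add, map_natCast]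

theorem poch_eq_prod {R : Type} [CommSemiring R] (z : R) (k : ℕ) :
    poch z k = ∏ r ∈ Finset.range k, (z + r) := by
  induction k with
  | zero => simp [poch_zero]
  | succ k ih => rw [poch_succ, Finset.prod_range_succ, ih]

theorem eval_poch (f : ℂ[X]) (k : ℕ) (y : ℂ) : (poch f k).eval y = poch (f.eval y) k :=
  map_poch (evalRingHom y) f k

theorem eval_linPlus (c y : ℂ) : (linPlus c).eval y = c + Complex.I * y := by simp [linPlus]

theorem eval_linMinus (c y : ℂ) : (linMinus c).eval y = c - Complex.I * y := by simp [linMinus]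

theorem linPlus_ne_zero (c : ℂ) : linPlus c ≠ 0 := by
  intro h
  have := congrArg (fun p => p.coeff 1) h
  simp [linPlus] at this

theorem linMinus_ne_zero (c : ℂ) : linMinus c ≠ 0 := by
  intro h
  have := congrArg (fun p => p.coeff 1) h
  simp [linMinus] at this

theorem linPlus_add_natCast (c : ℂ) (r : ℕ) : linPlus c + r = linPlus (c + r) := by
  simp only [linPlus, C_add, map_natCast]; ring

theorem linMinus_add_natCast (c : ℂ) (r : ℕ) : linMinus c + r = linMinus (c + r) := by
  simp only [linMinus, C_add, map_natCast]; ring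

theorem poch_linPlus_ne_zero (c : ℂ) (k : ℕ) : poch (linPlus c) k ≠ 0 := by
  rw [poch_eq_prod]
  exact Finset.prod_ne_zero_iff.2 fun r _ => by
    rw [linPlus_add_natCast]; exact linPlus_ne_zero _

theorem poch_linMinus_ne_zero (c : ℂ) (k : ℕ) : poch (linMinus c) k ≠ 0 := by
  rw [poch_eq_prod]
  exact Finset.prod_ne_zero_iff.2 fun r _ => by
    rw [linMinus_add_natCast]; exact linMinus_ne_zero _

theorem isCoprime_linMinus_linPlus {a b : ℂ} (h : a + b ≠ 0) :
    IsCoprime (linMinus a) (linPlus b) := by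
  refine ⟨C (a + b)⁻¹, C (a + b)⁻¹, ?_⟩
  have : linMinus a + linPlus b = C (a + b) := by simp only [linMinus, linPlus, C_add]; ring
  rw [← mul_add, this, ← C_mul, inv_mul_cancel₀ h, C_1]

/-- `(-1)^j (c + i y)_j (c' - n - i y)_{n - j}`: the gauge factor of row `j` of a determinant
with `n + 1` rows, as a polynomial in the node `y` of row `0`. -/
def gaugeFactor (c c' : ℂ) (n j : ℕ) : ℂ[X] :=
  C ((-1) ^ j) * poch (linPlus c) j * poch (linMinus (c' - n)) (n - j)

theorem eval_gaugeFactor (c c' : ℂ) (n j : ℕ) (y : ℂ) : (gaugeFactor c c' n j).eval y =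
    (-1) ^ j * poch (c + Complex.I * y) j * poch (c' - n - Complex.I * y) (n - j) := by
  rw [gaugeFactor, eval_mul, eval_mul, eval_C, eval_poch, eval_poch, eval_linPlus, eval_linMinus]

theorem gaugeFactor_ne_zero (c c' : ℂ) (n j : ℕ) : gaugeFactor c c' n j ≠ 0 :=
  mul_ne_zero (mul_ne_zero (C_ne_zero.2 (pow_ne_zero _ (by norm_num))) (poch_linPlus_ne_zero _ _))
    (poch_linMinus_ne_zero _ _)

/-- Row `j + 1` seen from `y + i` and row `j` seen from `y` are the same point y - ij, so the two
gauge factors differ only in their outermost linear factors. This is how a window of nodes slides by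
one. -/
theorem gaugeFactor_shift (c c' : ℂ) {n j : ℕ} (hj : j < n) (y : ℂ) :
    (c' - n - Complex.I * y) * (gaugeFactor c c' n (j + 1)).eval (y + Complex.I) =
      -(c - 1 + Complex.I * y) * (gaugeFactor c c' n j).eval y := by
  rw [eval_gaugeFactor, eval_gaugeFactor]
  have e1 : c + Complex.I * (y + Complex.I) = c - 1 + Complex.I * y := by
    linear_combination Complex.I_mul_I
  have e2 : c' - n - Complex.I * (y + Complex.I) = c' - n - Complex.I * y + 1 := by
    linear_combination -Complex.I_mul_I
  obtain ⟨l, rfl⟩ : ∃ l, n = j + 1 + l := ⟨n - (j + 1), by omega⟩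
  rw [e1, e2, poch_succ_left (c - 1 + Complex.I * y), show j + 1 + l - (j + 1) = l by omega,
    show j + 1 + l - j = l + 1 by omega, poch_succ_left (c' - _ - Complex.I * y)]
  rw [show c - 1 + Complex.I * y + 1 = c + Complex.I * y by ring]
  ring

/-- With one more row, the upper rows form the old window at `y`, and the lower rows form the old
window at `y - i` (`gaugeFactor_succ_succ`). -/
theorem gaugeFactor_succ (c c' : ℂ) {n j : ℕ} (hj : j ≤ n) (y : ℂ) :
    (gaugeFactor c c' (n + 1) j).eval y =
      (c' - (n + 1) - Complex.I * y) * (gaugeFactor c c' n j).eval y := by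
  rw [eval_gaugeFactor, eval_gaugeFactor]
  obtain ⟨l, rfl⟩ : ∃ l, n = j + l := ⟨n - j, by omega⟩
  rw [show j + l + 1 - j = l + 1 by omega, show j + l - j = l by omega, poch_succ_left]
  push_cast
  rw [show c' - (j + l + 1) - Complex.I * y + 1 = c' - (j + l) - Complex.I * y by ring]
  ring

theorem gaugeFactor_succ_succ (c c' : ℂ) (n j : ℕ) (y : ℂ) :
    (gaugeFactor c c' (n + 1) (j + 1)).eval y =
      -(c + Complex.I * y) * (gaugeFactor c c' n j).eval (y - Complex.I) := by
  rw [eval_gaugeFactor, eval_gaugeFactor]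
  have e1 : c + Complex.I * (y - Complex.I) = c + Complex.I * y + 1 := by
    linear_combination -Complex.I_mul_I
  have e2 : c' - n - Complex.I * (y - Complex.I) = c' - (n + 1) - Complex.I * y := by
    linear_combination Complex.I_mul_I
  rw [e1, e2, poch_succ_left, show n + 1 - (j + 1) = n - j by omega]
  push_cast
  ring

/-- The leading parts i and -i of the two linear factors cancel, so the operator preserves degree
and multiplies the coefficient of degree `n` by `a + b + n`; a triangular operator with nonzero
diagonal is onto. -/
theorem exists_first_order_solution {a b : ℂ} (h : ∀ n : ℕ, a + b + n ≠ 0) (g : ℂ[X]) :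
    ∃ R : ℂ[X], linPlus a * R + linMinus b * taylor Complex.I R = g := by
  let φ : ℂ[X] →ₗ[ℂ] ℂ[X] := LinearMap.mulLeft ℂ (linPlus a) +
    (LinearMap.mulLeft ℂ (linMinus b)).comp (taylor Complex.I)
  have := surjective_of_hasTop φ (fun n => a + b + n) h ?_ g
  · simpa [φ] using this
  intro f n hf
  have h2 := hasTopTwo_of_natDegree_le hf
  have h3 := ((hasTopTwo_linPlus a).mul h2).add ((hasTopTwo_linMinus b).mul (h2.taylor Complex.I))
  have h4 := (h3.congr (a' := 0) (b' := (a + b + n) * f.coeff n) (by ring)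
    (by linear_combination (-n * f.coeff n) * Complex.I_mul_I)).hasTop
  have e : ((1 + n : ℕ) : ℤ) - 1 = n := by push_cast; ring
  rw [e] at h4
  simpa [φ] using h4

-- Lifting multiplication by `Xb` through the Casorati determinant

section Window

variable {ι : Type*} (c c' : ι → ℂ)

/-- The product of the gauge factors over a set of parameters. -/
def colFactor (S : Finset ι) (n j : ℕ) : ℂ[X] := ∏ s ∈ S, gaugeFactor (c s) (c' s) n j

/-- The entry `f(y - i j)` with its gauge factors. -/
def entry (S : Finset ι) (n j : ℕ) (f : ℂ[X]) : ℂ[X] :=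
  colFactor c c' S n j * taylor (-(Complex.I * j)) f

theorem eval_entry (S : Finset ι) (n j : ℕ) (f : ℂ[X]) (y : ℂ) :
    (entry c c' S n j f).eval y = (∏ s ∈ S, (gaugeFactor (c s) (c' s) n j).eval y) *
      f.eval (y - Complex.I * j) := by
  rw [entry, colFactor, eval_mul, eval_prod, taylor_eval, ← sub_eq_add_neg]

theorem eval_entry_shift (S : Finset ι) {n j : ℕ} (hj : j < n) (f : ℂ[X]) (y : ℂ) :
    (∏ s ∈ S, (c' s - n - Complex.I * y)) * (entry c c' S n (j + 1) f).eval (y + Complex.I) =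
      (∏ s ∈ S, -(c s - 1 + Complex.I * y)) * (entry c c' S n j f).eval y := by
  rw [eval_entry, eval_entry, ← mul_assoc, ← mul_assoc, ← Finset.prod_mul_distrib,
    ← Finset.prod_mul_distrib, Finset.prod_congr rfl fun s _ => gaugeFactor_shift (c s) (c' s) hj y]
  congr 2
  push_cast
  ring

theorem eval_entry_succ (S : Finset ι) {n j : ℕ} (hj : j ≤ n) (f : ℂ[X]) (y : ℂ) :
    (entry c c' S (n + 1) j f).eval y =
      (∏ s ∈ S, (c' s - (n + 1) - Complex.I * y)) * (entry c c' S n j f).eval y := by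
  rw [eval_entry, eval_entry, ← mul_assoc, ← Finset.prod_mul_distrib,
    Finset.prod_congr rfl fun s _ => gaugeFactor_succ (c s) (c' s) hj y]

theorem eval_entry_succ_succ (S : Finset ι) (n j : ℕ) (f : ℂ[X]) (y : ℂ) :
    (entry c c' S (n + 1) (j + 1) f).eval y =
      (∏ s ∈ S, -(c s + Complex.I * y)) * (entry c c' S n j f).eval (y - Complex.I) := by
  rw [eval_entry, eval_entry, ← mul_assoc, ← Finset.prod_mul_distrib,
    Finset.prod_congr rfl fun s _ => gaugeFactor_succ_succ (c s) (c' s) n j y]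
  congr 2
  push_cast
  ring

variable [Fintype ι] [DecidableEq ι] {M : ℕ} (τ : Fin M → ι) (ξ : Fin M → ℂ[X])

/-- The `M × M` Casorati matrix of the seeds. -/
def seedMatrix : Matrix (Fin M) (Fin M) ℂ[X] :=
  Matrix.of fun j k => entry c c' (Finset.univ.erase (τ k)) (M - 1) j (ξ k)

/-- The `(M + 1) × (M + 1)` Casorati matrix of the seeds and `p`. -/
def fullMatrix (p : ℂ[X]) : Matrix (Fin (M + 1)) (Fin (M + 1)) ℂ[X] :=
  Matrix.of fun j => Fin.snoc (fun k => entry c c' (Finset.univ.erase (τ k)) M j (ξ k))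
    (entry c c' Finset.univ M j p)

/-- Data expressing that `q` is the preimage of `Xb * F p`, where `F p` is the determinant of
`fullMatrix p`: on every window of `M` consecutive nodes, `q - Xb p` is a combination of the
seeds. -/
structure IsLift (Ξ Xb Yb p : ℂ[X]) (w R : Fin M → ℂ[X]) (q : ℂ[X]) : Prop where
  expand : ∀ j : Fin M, ∑ k, entry c c' (Finset.univ.erase (τ k)) (M - 1) j (ξ k) * w k =
    Ξ * entry c c' Finset.univ (M - 1) j p
  first_order : ∀ k, linPlus (c (τ k)) * R k +
    linMinus (c' (τ k) - (M - 1 : ℕ)) * taylor Complex.I (R k) = Yb * w k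
  lift : ∀ j : Fin M, entry c c' Finset.univ (M - 1) j q =
    Xb * entry c c' Finset.univ (M - 1) j p -
      ∑ k, entry c c' (Finset.univ.erase (τ k)) (M - 1) j (ξ k) * (linPlus (c (τ k)) * R k)

variable {c c' τ ξ}

/-- The lift as read from the window at `y` and as read from the window at `y + i`. The two readings
differ by `Yb` times (Ξ p - ∑ wₖ ξₖ), with gauge factors, and this is zero by the expansion of `p`.
-/
theorem sum_erase_shift {Ξ Xb Yb p : ℂ[X]} {w R : Fin M → ℂ[X]}
    (hX : Xb - taylor Complex.I Xb = Ξ * Yb)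
    (hw : ∀ j : Fin M, ∑ k, entry c c' (Finset.univ.erase (τ k)) (M - 1) j (ξ k) * w k =
      Ξ * entry c c' Finset.univ (M - 1) j p)
    (hR : ∀ k, linPlus (c (τ k)) * R k +
      linMinus (c' (τ k) - (M - 1 : ℕ)) * taylor Complex.I (R k) = Yb * w k)
    (j : Fin M) (y : ℂ) :
    Xb.eval y * (entry c c' Finset.univ (M - 1) j p).eval y -
        ∑ k, (entry c c' (Finset.univ.erase (τ k)) (M - 1) j (ξ k)).eval y *
          ((c (τ k) + Complex.I * y) * (R k).eval y) =
      Xb.eval (y + Complex.I) * (entry c c' Finset.univ (M - 1) j p).eval y +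
        ∑ k, (entry c c' (Finset.univ.erase (τ k)) (M - 1) j (ξ k)).eval y *
          ((c' (τ k) - (M - 1 : ℕ) - Complex.I * y) * (R k).eval (y + Complex.I)) := by
  have h1 := congrArg (eval y) (hw j)
  rw [eval_finsetSum, eval_mul] at h1
  have h2 := congrArg (eval y) hX
  rw [eval_sub, taylor_eval, eval_mul] at h2
  have h3 : ∀ k, (c (τ k) + Complex.I * y) * (R k).eval y +
      (c' (τ k) - (M - 1 : ℕ) - Complex.I * y) * (R k).eval (y + Complex.I) =
      Yb.eval y * (w k).eval y := by
    intro k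
    have := congrArg (eval y) (hR k)
    rwa [eval_add, eval_mul, eval_mul, eval_linPlus, eval_linMinus, taylor_eval, eval_mul] at this
  have h4 : ∑ k, (entry c c' (Finset.univ.erase (τ k)) (M - 1) j (ξ k)).eval y *
          ((c (τ k) + Complex.I * y) * (R k).eval y) +
        ∑ k, (entry c c' (Finset.univ.erase (τ k)) (M - 1) j (ξ k)).eval y *
          ((c' (τ k) - (M - 1 : ℕ) - Complex.I * y) * (R k).eval (y + Complex.I)) =
      Yb.eval y * (Ξ.eval y * (entry c c' Finset.univ (M - 1) j p).eval y) := by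
    rw [← h1, Finset.mul_sum, ← Finset.sum_add_distrib]
    refine Finset.sum_congr rfl fun k _ => ?_
    rw [← mul_add, h3, eval_mul]
    ring
  linear_combination (-1 : ℂ) * h4 +
    (entry c c' Finset.univ (M - 1) j p).eval y * h2

/-- Existence of lifts for parameters in general position. -/
theorem exists_isLift {m : ℕ} {τ : Fin (m + 1) → ι} {ξ : Fin (m + 1) → ℂ[X]}
    (hgen : ∀ (s s' : ι) (n : ℤ), c s + c' s' ≠ n)
    {A Ξ Xb Yb : ℂ[X]} (hA : A ≠ 0) (hdet : (seedMatrix c c' τ ξ).det = A * Ξ)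
    (hdvd : ∀ p k, A ∣ (seedMatrix c c' τ ξ).cramer
      (fun j => entry c c' Finset.univ m j p) k)
    (hX : Xb - taylor Complex.I Xb = Ξ * Yb) (p : ℂ[X]) :
    ∃ w R q, IsLift c c' τ ξ Ξ Xb Yb p w R q := by
  -- The coefficients are Cramer's numerators with the common factor `A` removed.
  choose w hw using hdvd p
  have hexp : ∀ j : Fin (m + 1),
      ∑ k, entry c c' (Finset.univ.erase (τ k)) (m + 1 - 1) j (ξ k) * w k =
        Ξ * entry c c' Finset.univ (m + 1 - 1) j p := by
    intro j
    apply mul_left_cancel₀ hA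
    have := congrFun (Matrix.mulVec_cramer (seedMatrix c c' τ ξ)
      (fun j => entry c c' Finset.univ m j p)) j
    rw [Pi.smul_apply, smul_eq_mul, hdet] at this
    rw [← mul_assoc, Nat.add_sub_cancel, ← this, Matrix.mulVec, dotProduct, Finset.mul_sum]
    refine Finset.sum_congr rfl fun k _ => ?_
    rw [hw k, seedMatrix, Matrix.of_apply, Nat.add_sub_cancel]
    ring
  have hR : ∀ k, ∃ R : ℂ[X], linPlus (c (τ k)) * R +
      linMinus (c' (τ k) - (m + 1 - 1 : ℕ)) * taylor Complex.I R = Yb * w k := by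
    intro k
    refine exists_first_order_solution (fun n h => hgen (τ k) (τ k) (m - n) ?_) _
    rw [Nat.add_sub_cancel] at h
    push_cast
    linear_combination h
  choose R hR using hR
  -- `N j` is what row `j` of the sought polynomial must be, gauge factors included; it remains to
  -- show that one `q` serves all rows.
  set N : Fin (m + 1) → ℂ[X] := fun j => Xb * entry c c' Finset.univ (m + 1 - 1) j p -
      ∑ k, entry c c' (Finset.univ.erase (τ k)) (m + 1 - 1) j (ξ k) * (linPlus (c (τ k)) * R k)
    with hN
  have hNe : ∀ (j : Fin (m + 1)) y, (N j).eval y =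
      Xb.eval y * (entry c c' Finset.univ (m + 1 - 1) j p).eval y -
        ∑ k, (entry c c' (Finset.univ.erase (τ k)) (m + 1 - 1) j (ξ k)).eval y *
          ((c (τ k) + Complex.I * y) * (R k).eval y) := by
    intro j y
    simp only [hN, eval_sub, eval_mul, eval_finsetSum, eval_linPlus]
  -- the polynomials `N j` satisfy the same recurrence in `j` as the entries
  have hrec : ∀ (j : ℕ) (hj : j < m) y, (∏ s, (c' s - m - Complex.I * y)) *
      (N ⟨j + 1, by omega⟩).eval (y + Complex.I) =
      (∏ s, -(c s - 1 + Complex.I * y)) * (N ⟨j, by omega⟩).eval y := by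
    intro j hj y
    rw [hNe, hNe, sum_erase_shift hX hexp hR ⟨j, by omega⟩ y]
    simp only [Nat.add_sub_cancel]
    rw [mul_sub, mul_add (∏ s, -(c s - 1 + Complex.I * y)), mul_left_comm,
      eval_entry_shift c c' Finset.univ hj p y, Finset.mul_sum, Finset.mul_sum, sub_eq_add_neg,
      ← Finset.sum_neg_distrib]
    congr 1
    · ring
    refine Finset.sum_congr rfl fun k _ => ?_
    have h1 := eval_entry_shift c c' (Finset.univ.erase (τ k)) hj (ξ k) y
    have h2 : (∏ s, (c' s - m - Complex.I * y)) =
        (∏ s ∈ Finset.univ.erase (τ k), (c' s - m - Complex.I * y)) *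
          (c' (τ k) - m - Complex.I * y) :=
      (Finset.prod_erase_mul _ _ (Finset.mem_univ _)).symm
    have h3 : (∏ s, -(c s - 1 + Complex.I * y)) =
        (∏ s ∈ Finset.univ.erase (τ k), -(c s - 1 + Complex.I * y)) *
          -(c (τ k) - 1 + Complex.I * y) :=
      (Finset.prod_erase_mul _ _ (Finset.mem_univ _)).symm
    have h4 : c (τ k) + Complex.I * (y + Complex.I) = c (τ k) - 1 + Complex.I * y := by
      linear_combination Complex.I_mul_I
    rw [h2, h3, h4]
    linear_combination (-(c' (τ k) - m - Complex.I * y) * (c (τ k) - 1 + Complex.I * y) *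
      (R k).eval (y + Complex.I)) * h1
  have hiter : ∀ (j : ℕ) (hj : j ≤ m) y,
      (∏ s, poch (c' s - m - Complex.I * y) j) *
        (N ⟨j, by omega⟩).eval (y + Complex.I * j) =
      (∏ s, ∏ r ∈ Finset.range j, -(c s - (r + 1) + Complex.I * y)) *
        (N ⟨0, by omega⟩).eval y := by
    intro j
    induction j with
    | zero => intro _ y; simp [poch_zero]
    | succ j ih =>
      intro hj y
      have h1 := ih (by omega) y
      have h2 := hrec j (by omega) (y + Complex.I * j)
      have e1 : ∀ s, c' s - m - Complex.I * (y + Complex.I * j) =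
          c' s - m - Complex.I * y + j := fun s => by
        linear_combination (-j : ℂ) * Complex.I_mul_I
      have e2 : ∀ s, -(c s - 1 + Complex.I * (y + Complex.I * j)) =
          -(c s - (j + 1) + Complex.I * y) := fun s => by
        linear_combination (-j : ℂ) * Complex.I_mul_I
      simp only [e1, e2] at h2
      simp only [poch_succ, Finset.prod_range_succ, Finset.prod_mul_distrib]
      rw [show y + Complex.I * ((j + 1 : ℕ) : ℂ) = y + Complex.I * j + Complex.I by
        push_cast; ring]
      linear_combination (∏ s, poch (c' s - m - Complex.I * y) j) * h2 +
        (∏ s, -(c s - (j + 1) + Complex.I * y)) * h1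
  -- Iterating the recurrence from the first row to the last links `N 0` and `N m`. General position
  -- makes the two products of linear factors coprime, so the left one divides `N 0`.
  have hpoly : (∏ s, poch (linMinus (c' s - m)) m) * taylor (Complex.I * m) (N (Fin.last m)) =
      (∏ s, ∏ r ∈ Finset.range m, -linPlus (c s - (r + 1))) * N 0 := by
    apply Polynomial.funext
    intro y
    have := hiter m le_rfl y
    rw [show N (Fin.last m) = N ⟨m, by omega⟩ from rfl]
    simpa [eval_prod, eval_poch, eval_linPlus, eval_linMinus, taylor_eval] using this
  have hcop : IsCoprime (∏ s, poch (linMinus (c' s - m)) m)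
      (∏ s, ∏ r ∈ Finset.range m, -linPlus (c s - (r + 1))) := by
    refine IsCoprime.prod_left fun s _ => IsCoprime.prod_right fun s' _ =>
      IsCoprime.prod_right fun r _ => ?_
    rw [poch_eq_prod]
    refine IsCoprime.prod_left fun r' _ => ?_
    rw [linMinus_add_natCast, IsCoprime.neg_right_iff]
    refine isCoprime_linMinus_linPlus fun h => hgen s' s (m - r' + (r + 1)) ?_
    push_cast
    linear_combination h
  obtain ⟨q, hq⟩ := hcop.dvd_of_dvd_mul_left (Dvd.intro _ hpoly)
  -- The divisor just found is exactly the gauge factor of row 0, so row 0 holds by the choice of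
  -- `q`. The other rows follow, since `N` and the entries of `q` obey the same recurrence.
  have hlift : ∀ (j : ℕ) (hj : j ≤ m), entry c c' Finset.univ m j q = N ⟨j, by omega⟩ := by
    intro j
    induction j with
    | zero =>
      intro _
      change _ = N 0
      rw [hq, entry, colFactor]
      simp [gaugeFactor, poch_zero]
    | succ j ih =>
      intro hj
      apply taylor_injective Complex.I
      have hne : (∏ s, linMinus (c' s - m)) ≠ 0 :=
        Finset.prod_ne_zero_iff.2 fun s _ => linMinus_ne_zero _
      apply mul_left_cancel₀ hne
      apply Polynomial.funext
      intro y
      rw [eval_mul, eval_mul, eval_prod, taylor_eval, taylor_eval]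
      simp only [eval_linMinus]
      rw [hrec j (by omega) y, eval_entry_shift c c' Finset.univ (by omega) q y, ih (by omega)]
  refine ⟨w, R, q, hexp, hR, fun j => ?_⟩
  have := hlift j (by omega)
  rw [Nat.add_sub_cancel]
  exact this

end Window

-- The lifted determinant

section Intertwining

variable {ι : Type*} {c c' : ι → ℂ} [Fintype ι] [DecidableEq ι] {m : ℕ} {τ : Fin (m + 1) → ι}
  {ξ : Fin (m + 1) → ℂ[X]} {Ξ Xb Yb p q : ℂ[X]} {w R : Fin (m + 1) → ℂ[X]}

/-- The first m + 1 rows are read from the window at `y`, the last one from the window at `y - i` in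
the second form of `sum_erase_shift`. The coefficient of each seed then comes out the same in all m
+ 2 rows, as a column operation requires. -/
theorem IsLift.entry_eq (hX : Xb - taylor Complex.I Xb = Ξ * Yb)
    (h : IsLift c c' τ ξ Ξ Xb Yb p w R q) (j : Fin (m + 2)) :
    entry c c' Finset.univ (m + 1) j q = Xb * entry c c' Finset.univ (m + 1) j p -
      ∑ k, entry c c' (Finset.univ.erase (τ k)) (m + 1) j (ξ k) *
        (linMinus (c' (τ k) - (m + 1 : ℕ)) * linPlus (c (τ k)) * R k) := by
  apply Polynomial.funext
  intro y
  simp only [eval_sub, eval_mul, eval_finsetSum, eval_linPlus, eval_linMinus]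
  rcases Nat.lt_or_ge j (m + 1) with hj | hj
  · have hl := congrArg (eval y) (h.lift ⟨j, hj⟩)
    simp only [eval_sub, eval_mul, eval_finsetSum, eval_linPlus, Nat.add_sub_cancel] at hl
    have hj' : (j : ℕ) ≤ m := by omega
    rw [eval_entry_succ c c' _ hj', eval_entry_succ c c' _ hj', hl, mul_sub, Finset.mul_sum,
      mul_left_comm]
    congr 1
    refine Finset.sum_congr rfl fun k _ => ?_
    rw [eval_entry_succ c c' _ hj', ← Finset.prod_erase_mul _ _ (Finset.mem_univ (τ k))]
    push_cast
    ring
  · obtain ⟨i, hi⟩ : ∃ i : ℕ, (j : ℕ) = i + 1 := ⟨j - 1, by omega⟩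
    have him : i < m + 1 := by omega
    have hs := sum_erase_shift hX h.expand h.first_order ⟨i, him⟩ (y - Complex.I)
    have hl := congrArg (eval (y - Complex.I)) (h.lift ⟨i, him⟩)
    simp only [eval_sub, eval_mul, eval_finsetSum, eval_linPlus, Nat.add_sub_cancel] at hl
    simp only [Nat.add_sub_cancel] at hs
    rw [hs, sub_add_cancel] at hl
    rw [hi, eval_entry_succ_succ, eval_entry_succ_succ, hl, mul_add, Finset.mul_sum,
      mul_left_comm, ← sub_neg_eq_add, ← Finset.sum_neg_distrib]
    congr 1
    refine Finset.sum_congr rfl fun k _ => ?_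
    rw [eval_entry_succ_succ, ← Finset.prod_erase_mul _ _ (Finset.mem_univ (τ k))]
    push_cast
    linear_combination (∏ s ∈ Finset.univ.erase (τ k), -(c s + Complex.I * y)) *
      (entry c c' (Finset.univ.erase (τ k)) m i (ξ k)).eval (y - Complex.I) *
      (c (τ k) + Complex.I * y) * (R k).eval y * Complex.I_mul_I

/-- The last column for `q` is `Xb` times the one for `p` plus multiples of the seed columns. -/
theorem IsLift.det_fullMatrix (hX : Xb - taylor Complex.I Xb = Ξ * Yb)
    (h : IsLift c c' τ ξ Ξ Xb Yb p w R q) :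
    (fullMatrix c c' τ ξ q).det = Xb * (fullMatrix c c' τ ξ p).det := by
  set S : Fin (m + 2) → ℂ[X] := Fin.snoc (fun k =>
    -(linMinus (c' (τ k) - (m + 1 : ℕ)) * linPlus (c (τ k)) * R k)) Xb with hS
  have : fullMatrix c c' τ ξ q = (fullMatrix c c' τ ξ p).updateCol (Fin.last (m + 1))
      (fun j => ∑ i, S i • fullMatrix c c' τ ξ p j i) := by
    ext1 j k
    refine Fin.lastCases ?_ (fun k => ?_) k
    · rw [Matrix.updateCol_self, Fin.sum_univ_castSucc]
      simp only [fullMatrix, Matrix.of_apply, Fin.snoc_last, Fin.snoc_castSucc, hS]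
      rw [h.entry_eq hX j, sub_eq_add_neg, add_comm, ← Finset.sum_neg_distrib]
      simp only [smul_eq_mul]
      congr 1
      exact Finset.sum_congr rfl fun k _ => by ring
    · rw [Matrix.updateCol_ne (Fin.castSucc_lt_last k).ne]
      simp only [fullMatrix, Matrix.of_apply, Fin.snoc_castSucc]
  rw [this, Matrix.det_updateCol_sum, hS, Fin.snoc_last, smul_eq_mul]

end Intertwining

/-! ### The difference operator and its moment functionals -/

theorem taylor_I_taylor_neg_I (f : ℂ[X]) : taylor Complex.I (taylor (-Complex.I) f) = f := by
  rw [taylor_taylor, add_neg_cancel, taylor_zero]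

theorem taylor_neg_I_taylor_I (f : ℂ[X]) : taylor (-Complex.I) (taylor Complex.I f) = f := by
  rw [taylor_taylor, neg_add_cancel, taylor_zero]

/-- The operator `p ↦ V (p(x - i) - p) + V' (p(x + i) - p)`. -/
def diffOp (V V' : ℂ[X]) : Module.End ℂ ℂ[X] :=
  (LinearMap.mulLeft ℂ V).comp (taylor (-Complex.I)) +
    (LinearMap.mulLeft ℂ V').comp (taylor Complex.I) - LinearMap.mulLeft ℂ (V + V')

theorem diffOp_apply (V V' p : ℂ[X]) : diffOp V V' p =
    V * taylor (-Complex.I) p + V' * taylor Complex.I p - (V + V') * p := rfl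

/-- The Casoratian `p(x) g(x - i) - p(x - i) g(x)`. -/
def casorati : ℂ[X] →ₗ[ℂ] ℂ[X] →ₗ[ℂ] ℂ[X] :=
  LinearMap.mk₂ ℂ (fun p g => p * taylor (-Complex.I) g - taylor (-Complex.I) p * g)
    (fun p p' g => by simp only [map_add]; ring)
    (fun a p g => by simp only [smul_eq_C_mul, taylor_mul, taylor_C]; ring)
    (fun p g g' => by simp only [map_add]; ring)
    (fun a p g => by simp only [smul_eq_C_mul, taylor_mul, taylor_C]; ring)

theorem casorati_apply (p g : ℂ[X]) :
    casorati p g = p * taylor (-Complex.I) g - taylor (-Complex.I) p * g := rfl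

theorem green_diffOp (V V' P p g : ℂ[X]) :
    p * aeval (diffOp V V') P g - aeval (diffOp V V') P p * g =
      V * concomitant (diffOp V V') casorati P p g -
        V' * taylor Complex.I (concomitant (diffOp V V') casorati P p g) := by
  refine green_aeval (LinearMap.mul ℂ ℂ[X]) (LinearMap.mulLeft ℂ V -
    (LinearMap.mulLeft ℂ V').comp (taylor Complex.I)) (fun p g => ?_) P p g
  simp only [LinearMap.mul_apply', LinearMap.sub_apply, LinearMap.mulLeft_apply,
    LinearMap.comp_apply, diffOp_apply, casorati_apply, map_sub, taylor_mul,
    taylor_I_taylor_neg_I]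
  ring

/-- The Pearson equation of a moment functional. -/
def Pearson (L : ℂ[X] →ₗ[ℂ] ℂ) (V V' : ℂ[X]) : Prop :=
  ∀ g, L (V * taylor (-Complex.I) g) = L (V' * g)

/-- Summation by parts: the functional kills V f - V' f(· + i), so a multiplier `Z` contributes only
through its difference. -/
theorem Pearson.apply_mul_sub {L : ℂ[X] →ₗ[ℂ] ℂ} {V V' : ℂ[X]} (h : Pearson L V V')
    (Z f : ℂ[X]) : L (Z * (V * f - V' * taylor Complex.I f)) =
      L (V' * taylor Complex.I f * (taylor Complex.I Z - Z)) := by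
  have h1 := h (taylor Complex.I (Z * f))
  rw [taylor_neg_I_taylor_I, taylor_mul] at h1
  rw [show Z * (V * f - V' * taylor Complex.I f) = V * (Z * f) - Z * V' * taylor Complex.I f by
    ring, map_sub, h1, ← map_sub]
  congr 1
  ring

theorem Pearson.symm {L : ℂ[X] →ₗ[ℂ] ℂ} {V V' : ℂ[X]} (h : Pearson L V V') (P p g : ℂ[X]) :
    L (p * aeval (diffOp V V') P g) = L (aeval (diffOp V V') P p * g) := by
  rw [← sub_eq_zero, ← map_sub, green_diffOp]
  have := h.apply_mul_sub 1 (concomitant (diffOp V V') casorati P p g)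
  rw [one_mul] at this
  rw [this, taylor_one, C_1, sub_self, mul_zero, map_zero]

/-- If `V g(x - i) - V' g` is never a nonzero constant, then a nonzero functional satisfies the
Pearson equation. -/
theorem exists_pearson {V V' : ℂ[X]} (h : ∀ g : ℂ[X], V * taylor (-Complex.I) g - V' * g ≠ 1) :
    ∃ L : ℂ[X] →ₗ[ℂ] ℂ, L ≠ 0 ∧ Pearson L V V' := by
  let φ : ℂ[X] →ₗ[ℂ] ℂ[X] :=
    (LinearMap.mulLeft ℂ V).comp (taylor (-Complex.I)) - LinearMap.mulLeft ℂ V'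
  have h1 : (1 : ℂ[X]) ∉ LinearMap.range φ := by
    rintro ⟨g, hg⟩
    exact h g hg
  -- The functional is obtained by linear algebra alone: it kills the range of `φ` but not the
  -- constant 1.
  obtain ⟨L, hL, hker⟩ := Submodule.exists_le_ker_of_notMem h1
  refine ⟨L, fun h0 => hL (by rw [h0]; rfl), fun g => ?_⟩
  have : L (φ g) = 0 := hker ⟨g, rfl⟩
  rw [← sub_eq_zero, ← map_sub]
  exact this

theorem eq_zero_of_apply_C_mul {L : ℂ[X] →ₗ[ℂ] ℂ} (hL : L ≠ 0) {a : ℂ}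
    (h : ∀ r, L (C a * r) = 0) : a = 0 := by
  by_contra hne
  apply hL
  refine LinearMap.ext fun f => ?_
  have := h (C a⁻¹ * f)
  rwa [← mul_assoc, ← C_mul, mul_inv_cancel₀ hne, C_1, one_mul] at this

theorem taylor_neg_I_linPlus (a : ℂ) : taylor (-Complex.I) (linPlus a) = linPlus (a + 1) := by
  simp only [linPlus, map_add, taylor_mul, taylor_C, taylor_X, mul_add, ← C_mul,
    mul_neg, Complex.I_mul_I, neg_neg]
  ring

/-- Multiplying a functional by `V` shifts the Pearson equation. -/
theorem Pearson.comp_mulLeft {L : ℂ[X] →ₗ[ℂ] ℂ} {V V' : ℂ[X]} (h : Pearson L V V') :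
    Pearson (L.comp (LinearMap.mulLeft ℂ V)) (taylor (-Complex.I) V) V' := by
  intro g
  have h1 := h (V * g)
  rw [taylor_mul] at h1
  change L (V * (taylor (-Complex.I) V * taylor (-Complex.I) g)) = L (V * (V' * g))
  rw [h1, mul_left_comm]

/-- If `q` is in the radical of `L`, its difference is in the radical of the functional shifted by
`V`; this is the degree-lowering step for nondegeneracy. -/
theorem Pearson.apply_comp_mulLeft {L : ℂ[X] →ₗ[ℂ] ℂ} {V V' : ℂ[X]} (h : Pearson L V V')
    {q : ℂ[X]} (hq : ∀ r, L (q * r) = 0) (r : ℂ[X]) :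
    L.comp (LinearMap.mulLeft ℂ V) ((taylor (-Complex.I) q - q) * r) = 0 := by
  have h1 := hq (V * r)
  have h3 := h (taylor Complex.I r * q)
  rw [taylor_mul, taylor_neg_I_taylor_I] at h3
  change L (V * ((taylor (-Complex.I) q - q) * r)) = 0
  rw [show V * ((taylor (-Complex.I) q - q) * r) = V * (r * taylor (-Complex.I) q) -
      q * (V * r) by ring, map_sub, h1, h3,
    show V' * (taylor Complex.I r * q) = q * (V' * taylor Complex.I r) by ring, hq, sub_zero]

/-- If `L` killed all multiples of `V`, the Pearson equation would make it kill all multiples of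
`V'`, and together these are all polynomials. -/
theorem Pearson.comp_mulLeft_ne_zero {L : ℂ[X] →ₗ[ℂ] ℂ} {V V' : ℂ[X]} (h : Pearson L V V')
    (hL : L ≠ 0) (hcop : IsCoprime V' V) : L.comp (LinearMap.mulLeft ℂ V) ≠ 0 := by
  intro h0
  have h1 : ∀ f, L (V * f) = 0 := fun f => LinearMap.congr_fun h0 f
  have h2 : ∀ f, L (V' * f) = 0 := fun f => by rw [← h, h1]
  obtain ⟨a, b, hab⟩ := hcop
  apply hL
  refine LinearMap.ext fun f => ?_
  rw [LinearMap.zero_apply, ← one_mul f, ← hab,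
    show (a * V' + b * V) * f = V' * (a * f) + V * (b * f) by ring, map_add, h1, h2, add_zero]

/-- A nonzero solution of the Pearson equation for parameters in general position is
nondegenerate. -/
theorem Pearson.nondegenerate {ι : Type*} [Fintype ι] {c' : ι → ℂ} {κ κ' : ℂ} (hκ : κ ≠ 0)
    (hκ' : κ' ≠ 0) (n : ℕ) : ∀ (c : ι → ℂ) (L : ℂ[X] →ₗ[ℂ] ℂ), L ≠ 0 →
      (∀ (s s' : ι) (r : ℤ), c s + c' s' ≠ r) →
      Pearson L (C κ * ∏ s, linPlus (c s)) (C κ' * ∏ s, linMinus (c' s)) →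
      ∀ q : ℂ[X], q.natDegree ≤ n → (∀ r, L (q * r) = 0) → q = 0 := by
  induction n with
  | zero =>
    intro c L hL _ _ q hq h
    rw [eq_C_of_natDegree_le_zero hq] at h ⊢
    rw [eq_zero_of_apply_C_mul hL h, C_0]
  | succ n ih =>
    intro c L hL hgen hP q hq h
    have hcop : IsCoprime (C κ' * ∏ s, linMinus (c' s)) (C κ * ∏ s, linPlus (c s)) := by
      refine (isCoprime_mul_unit_left_left (isUnit_C.2 hκ'.isUnit) _ _).2
        ((isCoprime_mul_unit_left_right (isUnit_C.2 hκ.isUnit) _ _).2 ?_)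
      refine IsCoprime.prod_left fun s _ => IsCoprime.prod_right fun s' _ =>
        isCoprime_linMinus_linPlus ?_
      rw [add_comm]
      exact_mod_cast hgen s' s 0
    have hTV : taylor (-Complex.I) (C κ * ∏ s, linPlus (c s)) =
        C κ * ∏ s, linPlus (c s + 1) := by
      rw [taylor_mul, taylor_C, ← taylorAlgHom_apply, map_prod]
      simp only [taylorAlgHom_apply, taylor_neg_I_linPlus]
    have hP1 := hP.comp_mulLeft
    rw [hTV] at hP1
    -- The induction runs over all `c` at once: the functional multiplied by `V` belongs to `c + 1`,
    -- which is still in general position, and the difference of `q` has lower degree. Hence `q` is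
    -- periodic, so constant.
    have hT : taylor (-Complex.I) q - q = 0 := by
      refine ih (fun s => c s + 1) _ (hP.comp_mulLeft_ne_zero hL hcop)
        (fun s s' r hr => hgen s s' (r - 1) ?_) hP1 _ ?_ (hP.apply_comp_mulLeft h)
      · push_cast
        linear_combination hr
      · have h1 := hasTop_sub_taylor ((hasTop_natCast.2 ⟨hq, rfl⟩)) (-Complex.I)
        rw [Nat.cast_succ, add_sub_cancel_right] at h1
        exact (hasTop_natCast.1 h1).1
    have hdeg := natDegree_eq_zero_of_taylor_eq (neg_ne_zero.2 Complex.I_ne_zero)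
      (sub_eq_zero.1 hT)
    rw [eq_C_of_natDegree_eq_zero hdeg] at h ⊢
    rw [eq_zero_of_apply_C_mul hL h, C_0]

theorem taylor_I_linPlus (a : ℂ) : taylor Complex.I (linPlus a) = linPlus (a - 1) := by
  rw [← taylor_I_taylor_neg_I (linPlus (a - 1)), taylor_neg_I_linPlus, sub_add_cancel]

theorem taylor_I_linMinus (a : ℂ) : taylor Complex.I (linMinus a) = linMinus (a + 1) := by
  simp only [linMinus, map_sub, taylor_mul, taylor_C, taylor_X, mul_add, ← C_mul,
    Complex.I_mul_I, C_neg, C_add]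
  ring

theorem pow_map_apply {W W' : Type*} [AddCommGroup W] [Module ℂ W] [AddCommGroup W'] [Module ℂ W']
    {H : Module.End ℂ W} {H' : Module.End ℂ W'} (φ : W →ₗ[ℂ] W')
    (hH : ∀ p, φ (H p) = H' (φ p)) (i : ℕ) (p : W) : (H' ^ i) (φ p) = φ ((H ^ i) p) := by
  induction i generalizing p with
  | zero => simp
  | succ i ih => rw [pow_succ, pow_succ, Module.End.mul_apply, Module.End.mul_apply, ← hH, ih]

theorem concomitant_map {W W' U U' : Type*} [AddCommGroup W] [Module ℂ W] [AddCommGroup U]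
    [Module ℂ U] [AddCommGroup W'] [Module ℂ W'] [AddCommGroup U'] [Module ℂ U']
    {H : Module.End ℂ W} {w : W →ₗ[ℂ] W →ₗ[ℂ] U} {H' : Module.End ℂ W'}
    {w' : W' →ₗ[ℂ] W' →ₗ[ℂ] U'} (φ : W →ₗ[ℂ] W') (χ : U →ₗ[ℂ] U')
    (hH : ∀ p, φ (H p) = H' (φ p)) (hw : ∀ p g, w' (φ p) (φ g) = χ (w p g)) (P : ℂ[X]) (p g : W) :
    concomitant H' w' P (φ p) (φ g) = χ (concomitant H w P p g) := by
  simp only [concomitant_apply, map_sum, map_smul, pow_map_apply φ hH, hw]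

theorem aeval_map_apply {W W' : Type*} [AddCommGroup W] [Module ℂ W] [AddCommGroup W'] [Module ℂ W']
    {H : Module.End ℂ W} {H' : Module.End ℂ W'} (φ : W →ₗ[ℂ] W')
    (hH : ∀ p, φ (H p) = H' (φ p)) (P : ℂ[X]) (p : W) :
    aeval H' P (φ p) = φ (aeval H P p) := by
  simp only [aeval_apply_eq_sum, map_sum, map_smul, pow_map_apply φ hH]

-- Row functionals and summation by parts against a seed

section Symmetry

variable {ι : Type*} (c c' : ι → ℂ)

theorem entry_mul (S : Finset ι) (n j : ℕ) (f g : ℂ[X]) :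
    entry c c' S n j (f * g) = entry c c' S n j f * taylor (-(Complex.I * j)) g := by
  rw [entry, entry, taylor_mul, mul_assoc]

theorem entry_add (S : Finset ι) (n j : ℕ) (f g : ℂ[X]) :
    entry c c' S n j (f + g) = entry c c' S n j f + entry c c' S n j g := by
  rw [entry, entry, entry, map_add, mul_add]

/-- The gauge factor of row `j` converts the coefficient V evaluated in row `j` into V evaluated in
row 0, at the cost of raising `c'` by one. `entry_prod_linMinus` does the same for V', whose `c'`
becomes `c' - n`; thus a single functional in the row-0 variable serves every row. -/
theorem entry_prod_linPlus (κ : ℂ) (S : Finset ι) (n j : ℕ) (g : ℂ[X]) :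
    entry c c' S n j ((C κ * ∏ s ∈ S, linPlus (c s)) * taylor (-Complex.I) g) =
      (C κ * ∏ s ∈ S, linPlus (c s)) *
        taylor (-Complex.I) (entry c (fun s => c' s + 1) S n j g) := by
  apply Polynomial.funext
  intro y
  simp only [eval_mul, eval_entry, eval_prod, eval_C, taylor_eval, eval_linPlus, eval_gaugeFactor]
  rw [show y - Complex.I * j + -Complex.I = y + -Complex.I - Complex.I * j by ring]
  have : ∀ s ∈ S, (-1) ^ j * poch (c s + Complex.I * y) j *
      poch (c' s - n - Complex.I * y) (n - j) * (c s + Complex.I * (y - Complex.I * j)) =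
      (c s + Complex.I * y) * ((-1) ^ j * poch (c s + Complex.I * (y + -Complex.I)) j *
        poch (c' s + 1 - n - Complex.I * (y + -Complex.I)) (n - j)) := by
    intro s _
    have e1 : c s + Complex.I * (y + -Complex.I) = c s + Complex.I * y + 1 := by
      linear_combination -Complex.I_mul_I
    have e2 : c' s + 1 - n - Complex.I * (y + -Complex.I) = c' s - n - Complex.I * y := by
      linear_combination Complex.I_mul_I
    have e3 : c s + Complex.I * (y - Complex.I * j) = c s + Complex.I * y + j := by
      linear_combination (-j : ℂ) * Complex.I_mul_I
    rw [e1, e2, e3]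
    have := (poch_succ (c s + Complex.I * y) j).symm.trans (poch_succ_left _ _)
    linear_combination ((-1) ^ j * poch (c' s - n - Complex.I * y) (n - j)) * this
  have h := Finset.prod_congr (rfl : S = S) this
  simp only [Finset.prod_mul_distrib] at h ⊢
  linear_combination κ * g.eval (y + -Complex.I - Complex.I * j) * h

theorem entry_prod_linMinus (κ : ℂ) (S : Finset ι) {n j : ℕ} (hj : j ≤ n) (g : ℂ[X]) :
    entry c c' S n j ((C κ * ∏ s ∈ S, linMinus (c' s)) * g) =
      (C κ * ∏ s ∈ S, linMinus (c' s - n)) * entry c (fun s => c' s + 1) S n j g := by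
  apply Polynomial.funext
  intro y
  simp only [eval_mul, eval_entry, eval_prod, eval_C, eval_linMinus, eval_gaugeFactor]
  have : ∀ s ∈ S, (-1) ^ j * poch (c s + Complex.I * y) j *
      poch (c' s - n - Complex.I * y) (n - j) * (c' s - Complex.I * (y - Complex.I * j)) =
      (c' s - n - Complex.I * y) * ((-1) ^ j * poch (c s + Complex.I * y) j *
        poch (c' s + 1 - n - Complex.I * y) (n - j)) := by
    intro s _
    have e1 : c' s + 1 - n - Complex.I * y = c' s - n - Complex.I * y + 1 := by ring
    have e3 : c' s - Complex.I * (y - Complex.I * j) =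
        c' s - n - Complex.I * y + (n - j : ℕ) := by
      rw [Nat.cast_sub hj]
      linear_combination (j : ℂ) * Complex.I_mul_I
    rw [e1, e3]
    have := (poch_succ (c' s - n - Complex.I * y) (n - j)).symm.trans (poch_succ_left _ _)
    linear_combination ((-1) ^ j * poch (c s + Complex.I * y) j) * this
  have h := Finset.prod_congr (rfl : S = S) this
  simp only [Finset.prod_mul_distrib] at h ⊢
  linear_combination κ * g.eval (y - Complex.I * j) * h

variable [Fintype ι]

/-- The functional `f ↦ Lb (entry f)` in the row `j`. -/
def rowFunctional (Lb : ℂ[X] →ₗ[ℂ] ℂ) (n j : ℕ) : ℂ[X] →ₗ[ℂ] ℂ :=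
  Lb.comp ((LinearMap.mulLeft ℂ (colFactor c c' Finset.univ n j)).comp
    (taylor (-(Complex.I * j))))

theorem rowFunctional_apply (Lb : ℂ[X] →ₗ[ℂ] ℂ) (n j : ℕ) (f : ℂ[X]) :
    rowFunctional c c' Lb n j f = Lb (entry c c' Finset.univ n j f) := rfl

variable {c c'} {κ κ' : ℂ}

/-- The shift by `n` in the Pearson equation of `Lb` is absorbed by the gauge factors, so that each
row carries a functional for the original operator. -/
theorem pearson_rowFunctional {Lb : ℂ[X] →ₗ[ℂ] ℂ} {n j : ℕ} (hj : j ≤ n)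
    (hL : Pearson Lb (C κ * ∏ s, linPlus (c s)) (C κ' * ∏ s, linMinus (c' s - n))) :
    Pearson (rowFunctional c c' Lb n j) (C κ * ∏ s, linPlus (c s))
      (C κ' * ∏ s, linMinus (c' s)) := by
  intro g
  rw [rowFunctional_apply, rowFunctional_apply, entry_prod_linPlus,
    entry_prod_linMinus c c' κ' _ hj, hL]

theorem rowFunctional_nondegenerate {Lb : ℂ[X] →ₗ[ℂ] ℂ} {n j : ℕ}
    (hLb : ∀ q, (∀ r, Lb (q * r) = 0) → q = 0) {q : ℂ[X]}
    (hq : ∀ r, rowFunctional c c' Lb n j (q * r) = 0) : q = 0 := by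
  have h1 : entry c c' Finset.univ n j q = 0 := by
    refine hLb _ fun r => ?_
    have := hq (taylor (Complex.I * j) r)
    rwa [rowFunctional_apply, entry_mul, taylor_taylor, neg_add_cancel, taylor_zero] at this
  rw [entry, mul_eq_zero, taylor_eq_zero] at h1
  refine h1.resolve_left ?_
  exact Finset.prod_ne_zero_iff.2 fun s _ => gaugeFactor_ne_zero _ _ _ _

variable (c c' κ κ') [DecidableEq ι]

/-- `ξ`, in the gauge of type `s`, is an eigenfunction of the difference operator. -/
def IsSeed (s : ι) (ξ : ℂ[X]) (E : ℂ) : Prop :=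
  -((C κ * ∏ i ∈ Finset.univ.erase s, linPlus (c i)) * linMinus (c' s - 1) *
      taylor (-Complex.I) ξ) -
    (C κ' * ∏ i ∈ Finset.univ.erase s, linMinus (c' i)) * linPlus (c s - 1) * taylor Complex.I ξ -
    (C κ * ∏ i, linPlus (c i) + C κ' * ∏ i, linMinus (c' i)) * ξ = C E * ξ

/-- The Casoratian of a seed `ξ` of type `s` and `f`, without its gauge factor. -/
def seedCasorati (s : ι) (ξ f : ℂ[X]) : ℂ[X] :=
  linPlus (c s) * ξ * taylor (-Complex.I) f + linMinus (c' s - 1) * taylor (-Complex.I) ξ * f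

variable {c c' κ κ'}

/-- Green's identity for `f` and the gauged seed, cleared of gauge factors. The eigenvalue equation
of the seed removes the diagonal terms, and the sign in the gauge recurrence turns the usual
difference into a sum. -/
theorem IsSeed.mul_diffOp {s : ι} {ξ : ℂ[X]} {E : ℂ} (h : IsSeed c c' κ κ' s ξ E) (f : ℂ[X]) :
    ξ * (diffOp (C κ * ∏ i, linPlus (c i)) (C κ' * ∏ i, linMinus (c' i)) f - C E * f) =
      (C κ * ∏ i ∈ Finset.univ.erase s, linPlus (c i)) * seedCasorati c c' s ξ f +
      (C κ' * ∏ i ∈ Finset.univ.erase s, linMinus (c' i)) *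
        taylor Complex.I (seedCasorati c c' s ξ f) := by
  have h1 := h
  rw [IsSeed] at h1
  have e1 := (Finset.prod_erase_mul Finset.univ (fun i => linPlus (c i)) (Finset.mem_univ s)).symm
  have e2 := (Finset.prod_erase_mul Finset.univ (fun i => linMinus (c' i)) (Finset.mem_univ s)).symm
  simp only [diffOp_apply, seedCasorati, map_add, taylor_mul, taylor_I_taylor_neg_I,
    taylor_I_linPlus, taylor_I_linMinus, sub_add_cancel]
  rw [e1, e2] at h1 ⊢
  linear_combination f * h1

/-- By `IsSeed.mul_diffOp` the seed splits H f - E f into a term at y - i and a term at y. The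
Pearson equation moves the first shift onto `R`, where the first-order operator that defines `R` in
a lift appears. -/
theorem seed_term {Lb : ℂ[X] →ₗ[ℂ] ℂ} {n j : ℕ} (hj : j ≤ n)
    (hL : Pearson Lb (C κ * ∏ s, linPlus (c s)) (C κ' * ∏ s, linMinus (c' s - n)))
    {s : ι} {ξ : ℂ[X]} {E : ℂ} (h : IsSeed c c' κ κ' s ξ E) (R f : ℂ[X]) :
    Lb (entry c c' (Finset.univ.erase s) n j ξ * (linPlus (c s) * R) *
      taylor (-(Complex.I * j))
        (diffOp (C κ * ∏ i, linPlus (c i)) (C κ' * ∏ i, linMinus (c' i)) f - C E * f)) =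
    Lb ((linPlus (c s) * R + linMinus (c' s - n) * taylor Complex.I R) *
      entry c c' (Finset.univ.erase s) n j
        ((C κ' * ∏ i ∈ Finset.univ.erase s, linMinus (c' i)) *
          taylor Complex.I (seedCasorati c c' s ξ f))) := by
  set G := seedCasorati c c' s ξ f with hG
  set D := diffOp (C κ * ∏ i, linPlus (c i)) (C κ' * ∏ i, linMinus (c' i)) f - C E * f with hD
  set K := entry c (fun s => c' s + 1) (Finset.univ.erase s) n j (taylor Complex.I G) with hK
  have e1 := (Finset.prod_erase_mul Finset.univ (fun i => linPlus (c i)) (Finset.mem_univ s)).symm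
  have e2 := (Finset.prod_erase_mul Finset.univ (fun i => linMinus (c' i - n))
    (Finset.mem_univ s)).symm
  have h1 : entry c c' (Finset.univ.erase s) n j ξ * taylor (-(Complex.I * j)) D =
      (C κ * ∏ i ∈ Finset.univ.erase s, linPlus (c i)) * taylor (-Complex.I) K +
      (C κ' * ∏ i ∈ Finset.univ.erase s, linMinus (c' i - n)) * K := by
    rw [← entry_mul, hD, h.mul_diffOp, entry_add, ← hG, entry_prod_linMinus c c' κ' _ hj]
    conv_lhs => rw [← taylor_neg_I_taylor_I G]
    rw [entry_prod_linPlus, taylor_neg_I_taylor_I]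
  have h2 := hL (taylor Complex.I R * K)
  rw [taylor_mul, taylor_neg_I_taylor_I, e1, e2] at h2
  rw [entry_prod_linMinus c c' κ' _ hj, ← hK]
  rw [show entry c c' (Finset.univ.erase s) n j ξ * (linPlus (c s) * R) *
      taylor (-(Complex.I * j)) D = linPlus (c s) * R *
        (entry c c' (Finset.univ.erase s) n j ξ * taylor (-(Complex.I * j)) D) by ring, h1,
    show linPlus (c s) * R * ((C κ * ∏ i ∈ Finset.univ.erase s, linPlus (c i)) *
        taylor (-Complex.I) K + (C κ' * ∏ i ∈ Finset.univ.erase s, linMinus (c' i - n)) * K) =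
      C κ * ((∏ i ∈ Finset.univ.erase s, linPlus (c i)) * linPlus (c s)) *
        (R * taylor (-Complex.I) K) + linPlus (c s) * R *
        ((C κ' * ∏ i ∈ Finset.univ.erase s, linMinus (c' i - n)) * K) by ring, map_add, h2,
    ← map_add]
  congr 1
  ring

end Symmetry

-- Gauge factors and seeds on the whole lattice

theorem gaugeFactor_row (c c' : ℂ) {n j : ℕ} (hj : j < n) (y : ℂ) :
    (gaugeFactor c c' n (j + 1)).eval y * (c' - 1 - Complex.I * y - j) =
      -(c + Complex.I * y + j) * (gaugeFactor c c' n j).eval y := by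
  rw [eval_gaugeFactor, eval_gaugeFactor, poch_succ]
  obtain ⟨l, rfl⟩ : ∃ l, n = j + 1 + l := ⟨n - (j + 1), by omega⟩
  rw [show j + 1 + l - (j + 1) = l by omega, show j + 1 + l - j = l + 1 by omega, poch_succ]
  push_cast
  ring

/-- The gauge factors extend to a nowhere vanishing solution of their recurrence on all of `ℤ`. -/
theorem exists_gauge {c c' y : ℂ} (h1 : ∀ n : ℤ, c + Complex.I * y ≠ n)
    (h2 : ∀ n : ℤ, c' - Complex.I * y ≠ n) (m : ℕ) : ∃ ρ : ℤ → ℂ, (∀ j, ρ j ≠ 0) ∧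
      (∀ j, ρ (j + 1) * (c' - 1 - Complex.I * y - j) = -(c + Complex.I * y + j) * ρ j) ∧
      ∀ j : ℕ, j ≤ m → ρ j = (gaugeFactor c c' m j).eval y := by
  -- This quotient of Gamma functions solves the recurrence, and it has neither zeros nor poles
  -- since no argument is an integer. It is then normalised to match the gauge polynomial at 0.
  set σ : ℤ → ℂ := fun j => Complex.Gamma (c + Complex.I * y + j) /
    Complex.Gamma (1 - c' + Complex.I * y + j) with hσ
  have n1 : ∀ j n : ℤ, c + Complex.I * y + j ≠ n := fun j n h => h1 (n - j) (by
    push_cast; linear_combination h)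
  have n2 : ∀ j n : ℤ, 1 - c' + Complex.I * y + j ≠ n := fun j n h => h2 (1 + j - n) (by
    push_cast; linear_combination -h)
  have hne : ∀ j, σ j ≠ 0 := fun j => div_ne_zero
    (Complex.Gamma_ne_zero fun n => by have := n1 j (-n); push_cast at this; exact this)
    (Complex.Gamma_ne_zero fun n => by have := n2 j (-n); push_cast at this; exact this)
  have hrec : ∀ j, σ (j + 1) * (1 - c' + Complex.I * y + j) = (c + Complex.I * y + j) * σ j := by
    intro j
    have a1 : c + Complex.I * y + j ≠ 0 := by exact_mod_cast n1 j 0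
    have a2 : 1 - c' + Complex.I * y + j ≠ 0 := by exact_mod_cast n2 j 0
    have a3 : Complex.Gamma (1 - c' + Complex.I * y + j) ≠ 0 :=
      Complex.Gamma_ne_zero fun n => by have := n2 j (-n); push_cast at this; exact this
    simp only [hσ]
    push_cast
    rw [← add_assoc, ← add_assoc, Complex.Gamma_add_one _ a1, Complex.Gamma_add_one _ a2]
    field_simp
  set g0 := (gaugeFactor c c' m 0).eval y with hg0
  have hgne : g0 ≠ 0 := by
    rw [hg0, eval_gaugeFactor, poch_zero, pow_zero, one_mul, one_mul, poch_eq_prod]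
    refine Finset.prod_ne_zero_iff.2 fun r _ h => h2 (m - r) ?_
    push_cast
    linear_combination h
  refine ⟨fun j => g0 / σ 0 * σ j, fun j => mul_ne_zero (div_ne_zero hgne (hne 0)) (hne j),
    fun j => ?_, fun j => ?_⟩
  · linear_combination (-(g0 / σ 0)) * hrec j
  · induction j with
    | zero =>
      intro _
      simp only [Nat.cast_zero]
      rw [div_mul_cancel₀ _ (hne 0)]
    | succ j ih =>
      intro hj
      have a2 : c' - 1 - Complex.I * y - j ≠ 0 := fun h => h2 (1 + j) (by
        push_cast; linear_combination h)
      apply mul_right_cancel₀ a2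
      rw [gaugeFactor_row c c' (by omega) y, ← ih (by omega)]
      push_cast
      have := hrec j
      push_cast at this
      linear_combination (-(g0 / σ 0)) * this

theorem eq_zero_of_forall_notMem_countable {f : ℂ[X]} {B : Set ℂ} (hB : B.Countable)
    (h : ∀ y, y ∉ B → f.eval y = 0) : f = 0 := by
  refine eq_zero_of_infinite_isRoot f ?_
  have : (Bᶜ).Infinite := by
    intro hfin
    have h1 : (Set.univ : Set ℂ).Countable := by
      rw [← Set.union_compl_self B]
      exact hB.union hfin.countable
    exact not_countable_complex h1
  exact this.mono fun y hy => h y hy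

section Symmetry

variable {ι : Type*} [Fintype ι] [DecidableEq ι] {c c' : ι → ℂ} {κ κ' : ℂ} {m : ℕ}
  {τ : Fin (m + 1) → ι} {ξ : Fin (m + 1) → ℂ[X]} {E : Fin (m + 1) → ℂ}

/-- The restriction of a polynomial to the points `y - i j`. -/
def restrictLattice (y : ℂ) : ℂ[X] →ₗ[ℂ] (ℤ → ℂ) :=
  LinearMap.pi fun j => leval (y - Complex.I * j)

theorem restrictLattice_apply (y : ℂ) (p : ℂ[X]) (j : ℤ) :
    restrictLattice y p j = p.eval (y - Complex.I * j) := rfl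

theorem restrictLattice_diffOp (V V' : ℂ[X]) (y : ℂ) (p : ℂ[X]) :
    restrictLattice y (diffOp V V' p) = latticeOp (restrictLattice y V) (restrictLattice y V')
      (-(restrictLattice y (V + V'))) (restrictLattice y p) := by
  ext j
  rw [latticeOp_apply]
  simp only [restrictLattice_apply, diffOp_apply, eval_sub, eval_add, eval_mul, taylor_eval,
    Pi.neg_apply]
  push_cast
  rw [show y - Complex.I * j + -Complex.I = y - Complex.I * (j + 1) by ring,
    show y - Complex.I * j + Complex.I = y - Complex.I * (j - 1) by ring]
  ring

/-- The recurrence of ρ exchanges c + iy with -(c' - 1 - iy) and c' - iy with -(c - 1 + iy), which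
is exactly how the twisted coefficients of the seed equation differ from those of H. -/
theorem IsSeed.latticeOp {s : ι} {f : ℂ[X]} {e : ℂ} (h : IsSeed c c' κ κ' s f e) {y : ℂ}
    {ρ : ℤ → ℂ} (hne : ∀ j, ρ j ≠ 0)
    (hρ : ∀ j, ρ (j + 1) * (c' s - 1 - Complex.I * y - j) = -(c s + Complex.I * y + j) * ρ j) :
    latticeOp (restrictLattice y (C κ * ∏ i, linPlus (c i)))
      (restrictLattice y (C κ' * ∏ i, linMinus (c' i)))
      (-(restrictLattice y (C κ * ∏ i, linPlus (c i) + C κ' * ∏ i, linMinus (c' i))))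
      (fun j : ℤ => f.eval (y - Complex.I * j) / ρ j) =
    e • fun j : ℤ => f.eval (y - Complex.I * j) / ρ j := by
  ext j
  have h1 := congrArg (eval (y - Complex.I * j)) h
  have e1 := (Finset.prod_erase_mul Finset.univ (fun i => linPlus (c i)) (Finset.mem_univ s)).symm
  have e2 := (Finset.prod_erase_mul Finset.univ (fun i => linMinus (c' i)) (Finset.mem_univ s)).symm
  rw [MultiIndexed.latticeOp_apply]
  simp only [restrictLattice_apply, Pi.neg_apply, Pi.smul_apply, smul_eq_mul]
  rw [e1, e2] at h1 ⊢
  simp only [eval_sub, eval_add, eval_mul, eval_neg, taylor_eval, eval_C, eval_linPlus,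
    eval_linMinus] at h1 ⊢
  push_cast
  rw [show y - Complex.I * j + -Complex.I = y - Complex.I * (j + 1) by ring,
    show y - Complex.I * j + Complex.I = y - Complex.I * (j - 1) by ring] at h1
  set P := (∏ i ∈ Finset.univ.erase s, linPlus (c i)).eval (y - Complex.I * j)
  set Q := (∏ i ∈ Finset.univ.erase s, linMinus (c' i)).eval (y - Complex.I * j)
  have r1 := hρ j
  have r2 := hρ (j - 1)
  rw [sub_add_cancel] at r2
  push_cast at r2
  have q1 : (c s + Complex.I * (y - Complex.I * j)) / ρ (j + 1) =
      -(c' s - 1 - Complex.I * (y - Complex.I * j)) / ρ j := by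
    rw [div_eq_div_iff (hne _) (hne _)]
    linear_combination r1 + (ρ (j + 1) - ρ j) * j * Complex.I_mul_I
  have q2 : (c' s - Complex.I * (y - Complex.I * j)) / ρ (j - 1) =
      -(c s - 1 + Complex.I * (y - Complex.I * j)) / ρ j := by
    rw [div_eq_div_iff (hne _) (hne _)]
    linear_combination r2 + (ρ j - ρ (j - 1)) * j * Complex.I_mul_I
  rw [show κ * (P * (c s + Complex.I * (y - Complex.I * j))) *
      (eval (y - Complex.I * (j + 1)) f / ρ (j + 1)) = κ * P * eval (y - Complex.I * (j + 1)) f *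
        ((c s + Complex.I * (y - Complex.I * j)) / ρ (j + 1)) by ring, q1,
    show κ' * (Q * (c' s - Complex.I * (y - Complex.I * j))) *
      (eval (y - Complex.I * (j - 1)) f / ρ (j - 1)) = κ' * Q * eval (y - Complex.I * (j - 1)) f *
        ((c' s - Complex.I * (y - Complex.I * j)) / ρ (j - 1)) by ring, q2]
  linear_combination (ρ j)⁻¹ * h1

/-- The cancellation behind symmetry. On the lattice y - iℤ it is `lattice_concomitant` with the
expansion coefficients `wp / Ξ` and `wg / Ξ`; after multiplication by gauge factors and `Ξ` it is an
identity of polynomials in y. -/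
theorem seed_concomitant_identity (hseed : ∀ k, IsSeed c c' κ κ' (τ k) (ξ k) (E k))
    {Ξ p g : ℂ[X]} (hΞ : Ξ ≠ 0) {wp wg : Fin (m + 1) → ℂ[X]}
    (hp : ∀ j : Fin (m + 1), ∑ k, entry c c' (Finset.univ.erase (τ k)) m j (ξ k) * wp k =
      Ξ * entry c c' Finset.univ m j p)
    (hg : ∀ j : Fin (m + 1), ∑ k, entry c c' (Finset.univ.erase (τ k)) m j (ξ k) * wg k =
      Ξ * entry c c' Finset.univ m j g)
    {V V' : ℂ[X]} (hV : V = C κ * ∏ i, linPlus (c i)) (hV' : V' = C κ' * ∏ i, linMinus (c' i)) :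
    Ξ * entry c c' Finset.univ m ((m + 1) / 2) (V' * taylor Complex.I
        (concomitant (diffOp V V') casorati (∏ k, (X - C (E k))) p g)) +
      ∑ k, (wp k * entry c c' (Finset.univ.erase (τ k)) m ((m + 1) / 2)
          ((C κ' * ∏ i ∈ Finset.univ.erase (τ k), linMinus (c' i)) * taylor Complex.I
            (seedCasorati c c' (τ k) (ξ k) (aeval (diffOp V V')
              (∏ l ∈ Finset.univ.erase k, (X - C (E l))) g))) -
        wg k * entry c c' (Finset.univ.erase (τ k)) m ((m + 1) / 2)
          ((C κ' * ∏ i ∈ Finset.univ.erase (τ k), linMinus (c' i)) * taylor Complex.I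
            (seedCasorati c c' (τ k) (ξ k) (aeval (diffOp V V')
              (∏ l ∈ Finset.univ.erase k, (X - C (E l))) p)))) = 0 := by
  -- Outside this countable set `Ξ` does not vanish and all gauge factors extend to ℤ without zeros.
  set B : Set ℂ := {y | Ξ.IsRoot y} ∪
    ⋃ i : ι, ⋃ n : ℤ, ({-Complex.I * (n - c i)} ∪ {-Complex.I * (c' i - n)}) with hB
  refine eq_zero_of_forall_notMem_countable (B := B) ?_ fun y hy => ?_
  · refine (finite_setOfPred_isRoot hΞ).countable.union ?_
    exact Set.countable_iUnion fun i => Set.countable_iUnion fun n =>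
      (Set.countable_singleton _).union (Set.countable_singleton _)
  simp only [hB, Set.mem_union, Set.mem_iUnion, not_or, not_exists, Set.mem_singleton_iff,
    Set.mem_ofPred_eq] at hy
  obtain ⟨hy0, hy1⟩ := hy
  have hΞy : Ξ.eval y ≠ 0 := hy0
  have g1 : ∀ i (n : ℤ), c i + Complex.I * y ≠ n := fun i n h => (hy1 i n).1 (by
    linear_combination (-Complex.I) * h + y * Complex.I_mul_I)
  have g2 : ∀ i (n : ℤ), c' i - Complex.I * y ≠ n := fun i n h => (hy1 i n).2 (by
    linear_combination Complex.I * h + y * Complex.I_mul_I)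
  choose ρ hρne hρrec hρeq using fun i => exists_gauge (g1 i) (g2 i) m
  set ψ : Fin (m + 1) → ℤ → ℂ := fun k j => (ξ k).eval (y - Complex.I * j) / ρ (τ k) j with hψ
  have hfull : ∀ (k : Fin (m + 1)) (j : ℕ) (hj : j ≤ m) (f : ℂ[X]),
      (entry c c' (Finset.univ.erase (τ k)) m j f).eval y * ρ (τ k) j =
        (entry c c' Finset.univ m j f).eval y := by
    intro k j hj f
    rw [eval_entry, eval_entry, ← Finset.prod_erase_mul _ _ (Finset.mem_univ (τ k)), hρeq _ j hj]
    ring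
  have hcol : ∀ j : ℕ, j ≤ m → (∏ s, (gaugeFactor (c s) (c' s) m j).eval y) ≠ 0 := by
    intro j hj
    refine Finset.prod_ne_zero_iff.2 fun s _ => ?_
    rw [← hρeq s j hj]
    exact hρne s j
  have hexp : ∀ (f : ℂ[X]) (wf : Fin (m + 1) → ℂ[X]),
      (∀ j : Fin (m + 1), ∑ k, entry c c' (Finset.univ.erase (τ k)) m j (ξ k) * wf k =
        Ξ * entry c c' Finset.univ m j f) → ∀ j : ℤ, 0 ≤ j → j < (m + 1 : ℕ) →
      restrictLattice y f j = ∑ k, ((wf k).eval y / Ξ.eval y) * ψ k j := by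
    intro f wf hf j hj0 hjm
    lift j to ℕ using hj0
    have hjm' : j < m + 1 := by exact_mod_cast hjm
    have h1 := congrArg (eval y) (hf ⟨j, hjm'⟩)
    simp only [eval_finsetSum, eval_mul] at h1
    have h2 := hcol j (by omega)
    apply mul_left_cancel₀ (mul_ne_zero hΞy h2)
    rw [restrictLattice_apply, Int.cast_natCast, mul_assoc, ← eval_entry, ← h1, Finset.mul_sum]
    refine Finset.sum_congr rfl fun k _ => ?_
    have h3 := hfull k j (by omega) (ξ k)
    have h4 := hρne (τ k) j
    rw [eval_entry c c' Finset.univ] at h3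
    rw [hψ]
    simp only [Int.cast_natCast]
    field_simp
    linear_combination (wf k).eval y * h3
  have key := lattice_concomitant (restrictLattice y V) (restrictLattice y V')
    (-(restrictLattice y (V + V'))) E ψ
    (fun k => by rw [hV, hV']; exact (hseed k).latticeOp (hρne (τ k)) (hρrec (τ k)))
    (restrictLattice y p) (restrictLattice y g) (fun k => (wp k).eval y / Ξ.eval y)
    (fun k => (wg k).eval y / Ξ.eval y) (hexp p wp hp) (hexp g wg hg)
  -- The middle of the window of m + 1 nodes; the Casoratian involves the sites `h - 1` and `h`.
  set h := (m + 1) / 2 with hh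
  have hhm : h ≤ m := by omega
  have hyh : y - Complex.I * ((h : ℤ) - 1 : ℤ) = y - Complex.I * h + Complex.I := by
    push_cast; ring
  rw [concomitant_map (restrictLattice y) (leval (y - Complex.I * h + Complex.I))
    (restrictLattice_diffOp V V' y) (w := casorati)] at key
  swap
  · intro a b
    rw [latticeCasorati_apply, leval_apply, casorati_apply, eval_sub, eval_mul, eval_mul,
      taylor_eval, taylor_eval, restrictLattice_apply, restrictLattice_apply,
      restrictLattice_apply, restrictLattice_apply, hyh, Int.cast_natCast, add_neg_cancel_right]
  rw [leval_apply] at key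
  simp only [aeval_map_apply (restrictLattice y) (restrictLattice_diffOp V V' y)] at key
  -- the Casoratian with a seed in terms of `seedCasorati`
  have hcas : ∀ (k : Fin (m + 1)) (f : ℂ[X]),
      (entry c c' Finset.univ m h V').eval y * latticeCasorati (h : ℤ) (ψ k) (restrictLattice y f) =
      -(entry c c' (Finset.univ.erase (τ k)) m h
          ((C κ' * ∏ i ∈ Finset.univ.erase (τ k), linMinus (c' i)) * taylor Complex.I
            (seedCasorati c c' (τ k) (ξ k) f))).eval y := by
    intro k f
    rw [← hfull k h hhm, hV',
      ← Finset.prod_erase_mul Finset.univ (fun i => linMinus (c' i)) (Finset.mem_univ (τ k)),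
      latticeCasorati_apply, eval_entry, eval_entry]
    simp only [hψ, restrictLattice_apply, hyh, Int.cast_natCast, seedCasorati, eval_mul, eval_add,
      taylor_eval, eval_linPlus, eval_linMinus, add_neg_cancel_right]
    have r := hρrec (τ k) ((h : ℤ) - 1)
    rw [sub_add_cancel] at r
    push_cast at r
    have n1 := hρne (τ k) h
    have n2 := hρne (τ k) ((h : ℤ) - 1)
    have q : (c' (τ k) - Complex.I * (y - Complex.I * h)) * ρ (τ k) h / ρ (τ k) ((h : ℤ) - 1) =
        -(c (τ k) + Complex.I * (y - Complex.I * h + Complex.I)) := by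
      rw [div_eq_iff n2]
      linear_combination r + (h * ρ (τ k) h - (h - 1) * ρ (τ k) ((h : ℤ) - 1)) * Complex.I_mul_I
    set G := ∏ s ∈ Finset.univ.erase (τ k), (gaugeFactor (c s) (c' s) m h).eval y
    set Q := (C κ').eval (y - Complex.I * h) *
      (∏ i ∈ Finset.univ.erase (τ k), linMinus (c' i)).eval (y - Complex.I * h) with hQ
    set a1 := (ξ k).eval (y - Complex.I * h + Complex.I)
    set a0 := (ξ k).eval (y - Complex.I * h)
    set f1 := f.eval (y - Complex.I * h + Complex.I)
    set f0 := f.eval (y - Complex.I * h)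
    have n3 : a0 / ρ (τ k) h * ρ (τ k) h = a0 := div_mul_cancel₀ _ n1
    have q' : (c' (τ k) - Complex.I * (y - Complex.I * h)) * ρ (τ k) h *
        (a1 / ρ (τ k) ((h : ℤ) - 1)) =
        -(c (τ k) + Complex.I * (y - Complex.I * h + Complex.I)) * a1 := by
      rw [← q]; ring
    linear_combination G * Q * f0 * q' -
      G * Q * f1 * (c' (τ k) - Complex.I * (y - Complex.I * h)) * n3 -
      G * Q * a0 * f1 * Complex.I_mul_I
  rw [eval_add, eval_mul, entry_mul, eval_mul, taylor_eval, taylor_eval, eval_finsetSum,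
    ← sub_eq_add_neg, key, Finset.mul_sum, Finset.mul_sum, ← Finset.sum_add_distrib]
  refine Finset.sum_eq_zero fun k _ => ?_
  rw [eval_sub, eval_mul, eval_mul]
  have k1 := hcas k (aeval (diffOp V V') (∏ l ∈ Finset.univ.erase k, (X - C (E l))) g)
  have k2 := hcas k (aeval (diffOp V V') (∏ l ∈ Finset.univ.erase k, (X - C (E l))) p)
  have d1 := mul_div_cancel₀ ((wp k).eval y) hΞy
  have d2 := mul_div_cancel₀ ((wg k).eval y) hΞy
  rw [mul_sub, mul_sub]
  linear_combination (wp k).eval y * k1 - (wg k).eval y * k2 +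
    (entry c c' Finset.univ m h V').eval y * latticeCasorati (h : ℤ) (ψ k)
      (restrictLattice y (aeval (diffOp V V') (∏ l ∈ Finset.univ.erase k, (X - C (E l))) g)) * d1 -
    (entry c c' Finset.univ m h V').eval y * latticeCasorati (h : ℤ) (ψ k)
      (restrictLattice y (aeval (diffOp V V') (∏ l ∈ Finset.univ.erase k, (X - C (E l))) p)) * d2

end Symmetry

-- Symmetry of the lift

section Symmetry

variable {ι : Type*} [Fintype ι] [DecidableEq ι] {c c' : ι → ℂ} {κ κ' : ℂ} {m : ℕ}
  {τ : Fin (m + 1) → ι} {ξ : Fin (m + 1) → ℂ[X]} {E : Fin (m + 1) → ℂ}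

/-- For each seed one factor of ∏ (H - E_l) is split off, the one with its own eigenvalue, so that
`seed_term` applies. The shift of `Xb` appears because `Xb` is a polynomial in the row-0 variable.
-/
theorem IsLift.rowFunctional_mul {Lb : ℂ[X] →ₗ[ℂ] ℂ}
    (hL : Pearson Lb (C κ * ∏ s, linPlus (c s)) (C κ' * ∏ s, linMinus (c' s - m)))
    (hseed : ∀ k, IsSeed c c' κ κ' (τ k) (ξ k) (E k)) {Ξ Xb Yb p q : ℂ[X]}
    {w R : Fin (m + 1) → ℂ[X]} (h : IsLift c c' τ ξ Ξ Xb Yb p w R q) {j : ℕ} (hj : j ≤ m)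
    {V V' : ℂ[X]} (hV : V = C κ * ∏ i, linPlus (c i)) (hV' : V' = C κ' * ∏ i, linMinus (c' i))
    (g : ℂ[X]) :
    rowFunctional c c' Lb m j (q * aeval (diffOp V V') (∏ k, (X - C (E k))) g) =
      rowFunctional c c' Lb m j (taylor (Complex.I * j) Xb *
        (p * aeval (diffOp V V') (∏ k, (X - C (E k))) g)) -
      ∑ k, Lb (Yb * (w k * entry c c' (Finset.univ.erase (τ k)) m j
          ((C κ' * ∏ i ∈ Finset.univ.erase (τ k), linMinus (c' i)) * taylor Complex.I
            (seedCasorati c c' (τ k) (ξ k) (aeval (diffOp V V')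
              (∏ l ∈ Finset.univ.erase k, (X - C (E l))) g))))) := by
  set u := aeval (diffOp V V') (∏ k, (X - C (E k))) g with hu
  have hl := h.lift ⟨j, by omega⟩
  simp only [Nat.add_sub_cancel] at hl
  rw [rowFunctional_apply, rowFunctional_apply, entry_mul, hl, sub_mul, map_sub, Finset.sum_mul,
    map_sum]
  congr 1
  · congr 1
    rw [show taylor (Complex.I * j) Xb * (p * u) = p * u * taylor (Complex.I * j) Xb by ring,
      entry_mul, entry_mul, taylor_taylor, neg_add_cancel, taylor_zero]
    ring
  · refine Finset.sum_congr rfl fun k _ => ?_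
    have huk : u = diffOp V V' (aeval (diffOp V V')
        (∏ l ∈ Finset.univ.erase k, (X - C (E l))) g) - C (E k) * aeval (diffOp V V')
        (∏ l ∈ Finset.univ.erase k, (X - C (E l))) g := by
      rw [hu, ← Finset.mul_prod_erase _ _ (Finset.mem_univ k), map_mul, Module.End.mul_apply,
        map_sub, aeval_X, aeval_C, LinearMap.sub_apply, Module.algebraMap_end_apply, smul_eq_C_mul]
    have h1 := seed_term hj hL (hseed k) (R k) (aeval (diffOp V V')
      (∏ l ∈ Finset.univ.erase k, (X - C (E l))) g)
    have h2 := h.first_order k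
    rw [Nat.add_sub_cancel] at h2
    rw [← hV, ← hV', ← huk, h2, mul_assoc Yb] at h1
    exact h1

/-- The lifts are symmetric with respect to the moment functional. -/
theorem IsLift.symm {Lb : ℂ[X] →ₗ[ℂ] ℂ}
    (hL : Pearson Lb (C κ * ∏ s, linPlus (c s)) (C κ' * ∏ s, linMinus (c' s - m)))
    (hseed : ∀ k, IsSeed c c' κ κ' (τ k) (ξ k) (E k)) {Ξ Xb Yb p q g r : ℂ[X]} (hΞ : Ξ ≠ 0)
    (hX : Xb - taylor Complex.I Xb = Ξ * Yb) {w R w' R' : Fin (m + 1) → ℂ[X]}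
    (hp : IsLift c c' τ ξ Ξ Xb Yb p w R q) (hg : IsLift c c' τ ξ Ξ Xb Yb g w' R' r)
    {V V' : ℂ[X]} (hV : V = C κ * ∏ i, linPlus (c i)) (hV' : V' = C κ' * ∏ i, linMinus (c' i)) :
    rowFunctional c c' Lb m ((m + 1) / 2) (q * aeval (diffOp V V') (∏ k, (X - C (E k))) g) =
      rowFunctional c c' Lb m ((m + 1) / 2) (r * aeval (diffOp V V') (∏ k, (X - C (E k))) p) := by
  have hj : (m + 1) / 2 ≤ m := by omega
  set j := (m + 1) / 2 with hjdef
  have hid := seed_concomitant_identity hseed hΞ hp.expand hg.expand hV hV'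
  rw [← hjdef] at hid
  set Cc := concomitant (diffOp V V') casorati (∏ k, (X - C (E k))) p g with hCc
  have hP := pearson_rowFunctional hj hL
  rw [← hV, ← hV'] at hP
  -- Green's identity tested against the multiplier: since Xb(· + i) - Xb = -Ξ Yb, only the
  -- concomitant times Ξ Yb survives, and the identity `hid` multiplied by `Yb` cancels it.
  have h1 := hP.apply_mul_sub (taylor (Complex.I * j) Xb) Cc
  rw [← green_diffOp, rowFunctional_apply c c' Lb m j (V' * taylor Complex.I Cc * _), entry_mul,
    map_sub, taylor_taylor, taylor_taylor, taylor_taylor, neg_add_cancel, taylor_zero,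
    show -(Complex.I * j) + Complex.I + Complex.I * j = Complex.I by ring,
    show taylor Complex.I Xb - Xb = -(Ξ * Yb) by rw [← hX]; ring] at h1
  rw [hp.rowFunctional_mul hL hseed hj hV hV' g, hg.rowFunctional_mul hL hseed hj hV hV' p,
    ← sub_eq_zero]
  have h2 := congrArg (fun f => Lb (Yb * f)) hid
  simp only [mul_zero, map_zero, mul_add, map_add, Finset.mul_sum, map_sum, mul_sub, map_sub,
    Finset.sum_sub_distrib] at h2
  rw [mul_sub, map_sub] at h1
  rw [mul_comm g]
  have h3 : Lb (entry c c' Finset.univ m j (V' * taylor Complex.I Cc) * -(Ξ * Yb)) =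
      -Lb (Yb * (Ξ * entry c c' Finset.univ m j (V' * taylor Complex.I Cc))) := by
    rw [← map_neg]
    congr 1
    ring
  rw [h3] at h1
  linear_combination h1 - h2

end Symmetry

/-! ### From symmetry to recurrence relations -/

/-- A sequence of eigenpolynomials of a symmetric operator: if multiplication by `Xb` on the image
of `F` lifts to a symmetric operator, then it has finitely many diagonals. -/
theorem mul_mem_span_of_symm {H : Module.End ℂ ℂ[X]} {L : ℂ[X] →ₗ[ℂ] ℂ}
    (hnd : ∀ q, (∀ r, L (q * r) = 0) → q = 0) (hH : ∀ p g, L (p * H g) = L (H p * g))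
    {P : ℕ → ℂ[X]} (hdeg : ∀ n, (P n).degree = n) {ev : ℕ → ℂ} (hev : ∀ n, H (P n) = ev n • P n)
    (hinj : Function.Injective ev) {Q : ℂ[X]} (hQ : ∀ n, Q.eval (ev n) ≠ 0)
    {F : ℂ[X] →ₗ[ℂ] ℂ[X]} {ℓ : ℕ} (hF : ∀ n, (F (P n)).natDegree = ℓ + n)
    {Xb : ℂ[X]} {N : ℕ} (hX : Xb.natDegree ≤ N) {Z : ℂ[X] → ℂ[X]}
    (hZ : ∀ p, F (Z p) = Xb * F p)
    (hsymm : ∀ p g, L (Z p * aeval H Q g) = L (Z g * aeval H Q p)) (n : ℕ) :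
    Xb * F (P n) ∈ Submodule.span ℂ ((fun k => F (P k)) '' {k | n ≤ k + N ∧ k ≤ n + N}) := by
  let S : Polynomial.Sequence ℂ := ⟨P, hdeg⟩
  have hS : ∀ i, IsUnit (S i).leadingCoeff := fun i => by
    have : S i ≠ 0 := S.ne_zero i
    exact (leadingCoeff_ne_zero.2 this).isUnit
  let b := S.basis hS
  have hb : ∀ i, b i = P i := fun i => by simp [b, S]
  have horth : ∀ i j, i ≠ j → L (P i * P j) = 0 := by
    intro i j hij
    have h1 := hH (P i) (P j)
    rw [hev, hev, mul_smul_comm, smul_mul_assoc, map_smul, map_smul, smul_eq_mul, smul_eq_mul] at h1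
    have h2 : (ev j - ev i) * L (P i * P j) = 0 := by linear_combination h1
    exact (mul_eq_zero.1 h2).resolve_left (sub_ne_zero.2 (hinj.ne hij.symm))
  have hrepr : ∀ f j, L (f * P j) = b.repr f j * L (P j * P j) := by
    intro f j
    conv_lhs => rw [← b.linearCombination_repr f, Finsupp.linearCombination_apply, Finsupp.sum,
      Finset.sum_mul, map_sum]
    rw [Finset.sum_eq_single j]
    · rw [hb, smul_mul_assoc, map_smul, smul_eq_mul]
    · intro i _ hij
      rw [hb, smul_mul_assoc, map_smul, horth i j hij, smul_zero]
    · intro hj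
      rw [Finsupp.notMem_support_iff.1 hj, zero_smul, zero_mul, map_zero]
  -- By orthogonality a vanishing norm would put `P j` into the radical of `L`.
  have hnorm : ∀ j, L (P j * P j) ≠ 0 := by
    intro j h0
    have : P j = 0 := hnd _ fun r => by rw [mul_comm, hrepr, h0, mul_zero]
    have h1 := hdeg j
    rw [this, degree_zero] at h1
    exact absurd h1 (by simp)
  have hexp : ∀ i, F (Z (P i)) = ∑ k ∈ (b.repr (Z (P i))).support,
      b.repr (Z (P i)) k • F (P k) := by
    intro i
    conv_lhs => rw [← b.linearCombination_repr (Z (P i)), Finsupp.linearCombination_apply,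
      Finsupp.sum, map_sum]
    exact Finset.sum_congr rfl fun k _ => by rw [map_smul, hb]
  -- The polynomials F(P_k) have distinct degrees, so the highest one in the expansion cannot cancel
  -- and is bounded by the degree of Xb F(P_i).
  have hupper : ∀ i j, b.repr (Z (P i)) j ≠ 0 → j ≤ i + N := by
    intro i j hij
    set s := (b.repr (Z (P i))).support with hs
    have hd : ∀ k ∈ s, (b.repr (Z (P i)) k • F (P k)).natDegree = ℓ + k := by
      intro k hk
      rw [smul_eq_C_mul, natDegree_C_mul (Finsupp.mem_support_iff.1 hk), hF]
    have h2 := natDegree_sum_eq_of_disjoint (fun k => b.repr (Z (P i)) k • F (P k)) s (by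
      intro k hk l hl hkl h
      simp only [Function.comp_apply] at h
      rw [hd k hk.1, hd l hl.1] at h
      omega)
    rw [← hexp i, hZ] at h2
    have h3 : ℓ + j ≤ (Xb * F (P i)).natDegree := by
      rw [h2, ← hd j (Finsupp.mem_support_iff.2 hij)]
      exact Finset.le_sup (f := fun k => (b.repr (Z (P i)) k • F (P k)).natDegree)
        (Finsupp.mem_support_iff.2 hij)
    have h4 : (Xb * F (P i)).natDegree ≤ N + (ℓ + i) := natDegree_mul_le_of_le hX (hF i).le
    omega
  -- Symmetry relates the coefficients (i, j) and (j, i) through the nonzero diagonal entries of the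
  -- form, so the upper bound transposes.
  have hlower : ∀ i j, b.repr (Z (P i)) j ≠ 0 → i ≤ j + N := by
    intro i j hij
    apply hupper j i
    intro h0
    have h1 := hsymm (P i) (P j)
    rw [aeval_apply_eigen (hev j), aeval_apply_eigen (hev i), mul_smul_comm, mul_smul_comm,
      map_smul, map_smul, hrepr (Z (P i)) j, hrepr (Z (P j)) i, h0, zero_mul, smul_zero,
      smul_eq_mul] at h1
    exact (mul_ne_zero (hQ j) (mul_ne_zero hij (hnorm j))) h1
  rw [← hZ, hexp]
  refine Submodule.sum_mem _ fun k hk => ?_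
  refine Submodule.smul_mem _ _ (Submodule.subset_span ⟨k, ⟨?_, ?_⟩, rfl⟩)
  · exact hlower n k (Finsupp.mem_support_iff.1 hk)
  · exact hupper n k (Finsupp.mem_support_iff.1 hk)

/-! ### Degrees of Casorati determinants -/

section Degree

variable {ι : Type*} {c c' : ι → ℂ}

/-- A difference of neighbouring rows is again an entry, with one row fewer and `c'` lowered by one.
This allows iterated forward differences to be treated by induction. -/
theorem entry_succ_sub_entry (S : Finset ι) {n j : ℕ} (hj : j ≤ n) (f : ℂ[X]) :
    entry c c' S (n + 1) (j + 1) f - entry c c' S (n + 1) j f =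
      entry c (fun s => c' s - 1) S n j (C ((-1) ^ S.card) * (∏ s ∈ S, linPlus (c s)) *
        taylor (-Complex.I) f - (∏ s ∈ S, linMinus (c' s - 1)) * f) := by
  apply Polynomial.funext
  intro y
  have h1 : ∀ s, (gaugeFactor (c s) (c' s) (n + 1) (j + 1)).eval y =
      -(c s + Complex.I * (y - Complex.I * j)) * (gaugeFactor (c s) (c' s - 1) n j).eval y := by
    intro s
    rw [eval_gaugeFactor, eval_gaugeFactor, poch_succ, Nat.add_sub_add_right]
    rw [show c' s - (n + 1 : ℕ) = c' s - 1 - n by push_cast; ring]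
    linear_combination (((-1) ^ j * poch (c s + Complex.I * y) j *
      poch (c' s - 1 - n - Complex.I * y) (n - j)) * (-j : ℂ)) * Complex.I_mul_I
  have h2 : ∀ s, (gaugeFactor (c s) (c' s) (n + 1) j).eval y =
      (c' s - 1 - Complex.I * (y - Complex.I * j)) *
        (gaugeFactor (c s) (c' s - 1) n j).eval y := by
    intro s
    rw [eval_gaugeFactor, eval_gaugeFactor, Nat.sub_add_comm hj, poch_succ,
      show c' s - (n + 1 : ℕ) = c' s - 1 - n by push_cast; ring]
    push_cast [Nat.cast_sub hj]
    linear_combination (((-1) ^ j * poch (c s + Complex.I * y) j *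
      poch (c' s - 1 - n - Complex.I * y) (n - j)) * (-j : ℂ)) * Complex.I_mul_I
  rw [eval_sub, eval_entry, eval_entry, eval_entry, Finset.prod_congr rfl fun s _ => h1 s,
    Finset.prod_congr rfl fun s _ => h2 s, Finset.prod_mul_distrib, Finset.prod_mul_distrib,
    Finset.prod_neg]
  simp only [eval_sub, eval_mul, eval_C, eval_prod, eval_linPlus, eval_linMinus, taylor_eval]
  rw [show y - Complex.I * ((j + 1 : ℕ) : ℂ) = y - Complex.I * j + -Complex.I by push_cast; ring]
  ring

/-- The leading terms of the two products cancel; comparing their second coefficients leaves `d`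
from the shift of `f` and the sum of c + c' - 1 from the linear factors. -/
theorem hasTop_entry_difference (S : Finset ι) {f : ℂ[X]} {d : ℤ} {a : ℂ} (h : HasTop f d a) :
    HasTop (C ((-1) ^ S.card) * (∏ s ∈ S, linPlus (c s)) *
        taylor (-Complex.I) f - (∏ s ∈ S, linMinus (c' s - 1)) * f) (S.card + d - 1)
      ((-Complex.I) ^ S.card * -Complex.I * (d + ∑ s ∈ S, (c s + c' s - 1)) * a) := by
  rcases lt_or_ge d 0 with hd | hd
  · rw [h.eq_zero hd, h.2.2 hd]
    simpa using hasTop_zero _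
  lift d to ℕ using hd
  have h1 := hasTop_natCast.1 h
  have h2 := hasTopTwo_of_natDegree_le h1.1
  rw [h1.2] at h2
  have h3 := ((((hasTopTwo_C ((-1) ^ S.card)).mul (hasTopTwo_prod_linPlus S c)).mul
    (h2.taylor (-Complex.I))).congr (a' := (-Complex.I) ^ S.card * a)
      (by rw [neg_pow Complex.I]) rfl)
  rw [Nat.zero_add] at h3
  have h4 := (h3.sub ((hasTopTwo_prod_linMinus S (fun s => c' s - 1)).mul h2))
  have h5 := (h4.congr (a' := 0) (b' := (-Complex.I) ^ S.card * -Complex.I *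
    ((d : ℤ) + ∑ s ∈ S, (c s + c' s - 1)) * a) (by ring) (by
      have : ∑ s ∈ S, (c s + c' s - 1) = ∑ s ∈ S, c s + ∑ s ∈ S, (c' s - 1) := by
        rw [← Finset.sum_add_distrib]
        exact Finset.sum_congr rfl fun s _ => by ring
      rw [this, neg_pow Complex.I]
      push_cast
      ring)).hasTop
  rwa [Nat.cast_add] at h5

theorem fwdDiff_iter_congr {G : Type*} [AddCommGroup G] {u v : ℕ → G} (k : ℕ)
    (h : ∀ j ≤ k, u j = v j) : (fwdDiff 1)^[k] u 0 = (fwdDiff 1)^[k] v 0 := by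
  rw [fwdDiff_iter_eq_sum_shift, fwdDiff_iter_eq_sum_shift]
  refine Finset.sum_congr rfl fun j hj => ?_
  rw [Finset.mem_range] at hj
  rw [h]
  simp
  omega

theorem hasTop_gaugeFactor_zero (c c' : ℂ) (n : ℕ) :
    HasTop (gaugeFactor c c' n 0) n ((-Complex.I) ^ n) := by
  rw [gaugeFactor, pow_zero, C_1, poch_zero, one_mul, one_mul, Nat.sub_zero, poch_eq_prod]
  have : ∀ r ∈ Finset.range n, HasTop (linMinus (c' - n) + (r : ℂ[X])) 1 (-Complex.I) := by
    intro r _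
    rw [linMinus_add_natCast]
    have h := hasTopTwo_linMinus (c' - n + r)
    have h2 := (hasTop_natCast (n := 1)).2 ⟨h.1, rfl⟩
    have h3 := h.2.1
    rw [coeff_reflect, revAt_le (Nat.zero_le _), Nat.sub_zero] at h3
    rw [h3] at h2
    exact_mod_cast h2
  simpa using HasTop.prod this

/-- At each difference `d` grows by |S| - 1 while the sum of c + c' - 1 drops by |S|. The factor
produced therefore falls by one at each step, and a falling factorial accumulates. -/
theorem hasTop_fwdDiff_entry (S : Finset ι) (k : ℕ) : ∀ (c' : ι → ℂ) {n : ℕ} {f : ℂ[X]} {d : ℤ}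
    {a : ℂ}, k ≤ n → HasTop f d a → HasTop ((fwdDiff 1)^[k] (fun j => entry c c' S n j f) 0)
      (S.card * n + d - k) ((-Complex.I) ^ (S.card * n) * (-Complex.I) ^ k *
        (descPochhammer ℂ k).eval (d + ∑ s ∈ S, (c s + c' s - 1)) * a) := by
  induction k with
  | zero =>
    intro c' n f d a _ h
    have h1 : HasTop (colFactor c c' S n 0) (∑ s ∈ S, (n : ℤ)) (∏ s ∈ S, (-Complex.I) ^ n) :=
      HasTop.prod fun s _ => hasTop_gaugeFactor_zero _ _ _
    have h2 := h1.mul h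
    simp only [Finset.sum_const, nsmul_eq_mul, Finset.prod_const] at h2
    simpa [entry, mul_comm, pow_mul] using h2
  | succ k ih =>
    intro c' n f d a hn h
    obtain ⟨n, rfl⟩ : ∃ l, n = l + 1 := ⟨n - 1, by omega⟩
    rw [Function.iterate_succ_apply, fwdDiff_iter_congr
      (u := fwdDiff 1 fun j => entry c c' S (n + 1) j f)
      (v := fun j => entry c (fun s => c' s - 1)
      S n j (C ((-1) ^ S.card) * (∏ s ∈ S, linPlus (c s)) *
        taylor (-Complex.I) f - (∏ s ∈ S, linMinus (c' s - 1)) * f)) k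
      (fun j hj => entry_succ_sub_entry S (by omega) f)]
    have h1 := ih (fun s => c' s - 1) (by omega : k ≤ n)
      (hasTop_entry_difference (c := c) (c' := c') S h)
    have e1 : (S.card : ℤ) * n + (S.card + d - 1) - k =
        S.card * (n + 1 : ℕ) + d - (k + 1 : ℕ) := by push_cast; ring
    have e2 : (((S.card + d - 1 : ℤ)) : ℂ) + ∑ s ∈ S, (c s + (c' s - 1) - 1) =
        d + ∑ s ∈ S, (c s + c' s - 1) - 1 := by
      have : ∑ s ∈ S, (c s + (c' s - 1) - 1) = ∑ s ∈ S, (c s + c' s - 1) - S.card := by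
        rw [Finset.card_eq_sum_ones]
        push_cast
        rw [← Finset.sum_sub_distrib]
        exact Finset.sum_congr rfl fun s _ => by ring
      rw [this]
      push_cast
      ring
    rw [e1, e2] at h1
    convert h1 using 1
    rw [descPochhammer_succ_left, eval_mul, eval_X, eval_comp, eval_sub, eval_X, eval_one,
      mul_add_one, pow_add, pow_succ (-Complex.I) k]
    ring

/-- Every permutation contributes a product of the same formal degree, because the row indices are
only rearranged. -/
theorem HasTop.det {N : ℕ} {A : Matrix (Fin N) (Fin N) ℂ[X]} {α : Fin N → ℤ}
    {B : Matrix (Fin N) (Fin N) ℂ} (h : ∀ i j, HasTop (A i j) (α j - (i : ℕ)) (B i j)) :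
    HasTop A.det (∑ j, α j - ∑ i : Fin N, ((i : ℕ) : ℤ)) B.det := by
  rw [Matrix.det_apply', Matrix.det_apply']
  refine HasTop.sum fun σ _ => ?_
  have h1 := (hasTop_C ((Equiv.Perm.sign σ : ℤ) : ℂ)).mul
    (HasTop.prod (s := Finset.univ) fun j _ => h (σ j) j)
  rw [Finset.sum_sub_distrib, Equiv.sum_comp σ (fun i : Fin N => ((i : ℕ) : ℤ)), zero_add] at h1
  simpa using h1

/-- Forward differences at 0 are a unitriangular combination of the rows, with signed binomial
coefficients. -/
theorem det_fwdDiff {R : Type*} [CommRing R] {N : ℕ} (u : Fin N → ℕ → R) :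
    (Matrix.of fun s k : Fin N => (fwdDiff 1)^[(s : ℕ)] (u k) 0).det =
      (Matrix.of fun j k : Fin N => u k j).det := by
  let T : Matrix (Fin N) (Fin N) R := Matrix.of fun s j =>
    (((-1 : ℤ) ^ ((s : ℕ) - (j : ℕ)) * ((s : ℕ).choose j) : ℤ) : R)
  have hT : T.det = 1 := by
    rw [Matrix.det_of_isLowerTriangular]
    · simp [T]
    · intro i j hij
      have hij' : i < j := hij
      simp [T, Nat.choose_eq_zero_of_lt (show (i : ℕ) < j from hij')]
  rw [← one_mul (Matrix.det (Matrix.of fun j k : Fin N => u k j)), ← hT, ← Matrix.det_mul]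
  congr 1
  ext s k
  rw [Matrix.of_apply, Matrix.mul_apply, fwdDiff_iter_eq_sum_shift]
  have hs : (s : ℕ) + 1 ≤ N := s.2
  simp only [T, Matrix.of_apply]
  rw [Fin.sum_univ_eq_sum_range (fun j => (((-1 : ℤ) ^ ((s : ℕ) - j) * ((s : ℕ).choose j) : ℤ) : R)
    * u k j) N, ← Finset.sum_subset (Finset.range_subset_range.2 hs)]
  · refine Finset.sum_congr rfl fun j _ => ?_
    simp [zsmul_eq_mul]
  · intro j _ hj
    rw [Finset.mem_range] at hj
    rw [Nat.choose_eq_zero_of_lt (by omega)]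
    simp

/-- The leading coefficient of a Casorati determinant. -/
theorem hasTop_casorati {n : ℕ} (S : Fin (n + 1) → Finset ι) {f : Fin (n + 1) → ℂ[X]}
    {d : Fin (n + 1) → ℤ} {a : Fin (n + 1) → ℂ} (h : ∀ k, HasTop (f k) (d k) (a k)) :
    ∃ u : ℂ, u ≠ 0 ∧
    HasTop (Matrix.of fun j k : Fin (n + 1) => entry c c' (S k) n j (f k)).det
      (∑ k, ((S k).card * n + d k) - ∑ i : Fin (n + 1), ((i : ℕ) : ℤ))
      (u * (∏ k, a k) * ∏ i, ∏ j ∈ Finset.Ioi i,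
        ((d j + ∑ s ∈ S j, (c s + c' s - 1)) - (d i + ∑ s ∈ S i, (c s + c' s - 1)))) := by
  refine ⟨(∏ k, (-Complex.I) ^ ((S k).card * n)) * ∏ i : Fin (n + 1), (-Complex.I) ^ (i : ℕ),
    mul_ne_zero ?_ ?_, ?_⟩
  · exact Finset.prod_ne_zero_iff.2 fun _ _ => pow_ne_zero _ (neg_ne_zero.2 Complex.I_ne_zero)
  · exact Finset.prod_ne_zero_iff.2 fun _ _ => pow_ne_zero _ (neg_ne_zero.2 Complex.I_ne_zero)
  rw [← det_fwdDiff (fun k j => entry c c' (S k) n j (f k))]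
  have h1 := HasTop.det (A := Matrix.of fun s k : Fin (n + 1) =>
    (fwdDiff 1)^[(s : ℕ)] (fun j => entry c c' (S k) n j (f k)) 0)
    fun s k => hasTop_fwdDiff_entry (c := c) (S k) s c' (by omega) (h k)
  convert h1 using 1
  -- After row and column constants are taken out, entry (i, j) is a monic polynomial of degree i at
  -- the node of column j, so a Vandermonde determinant remains.
  have h2 : (fun (i j : Fin (n + 1)) => (-Complex.I) ^ ((S j).card * n) * (-Complex.I) ^ (i : ℕ) *
      (descPochhammer ℂ i).eval (d j + ∑ s ∈ S j, (c s + c' s - 1)) * a j) =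
      Matrix.of fun i j : Fin (n + 1) => (-Complex.I) ^ (i : ℕ) * (Matrix.of fun i j =>
        ((-Complex.I) ^ ((S j).card * n) * a j) * (Matrix.of fun j i : Fin (n + 1) =>
          (descPochhammer ℂ i).eval (d j + ∑ s ∈ S j, (c s + c' s - 1))).transpose i j) i j := by
    ext i j
    simp only [Matrix.of_apply, Matrix.transpose_apply]
    ring
  rw [h2, Matrix.det_mul_column, Matrix.det_mul_row, Matrix.det_transpose,
    ← Matrix.det_eval_matrixOfPolynomials_eq_det_vandermonde, Matrix.det_vandermonde,
    Finset.prod_mul_distrib]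
  · ring
  · intro i
    rw [descPochhammer_natDegree]
  · intro i
    exact monic_descPochhammer ℂ i

end Degree

/-! ### Common factors of Casorati determinants -/

/-- In a divisibility chain the product over m distinct indices is divisible by that over the m
smallest ones, since the largest index is at least m - 1. -/
theorem prod_range_dvd_prod {R : Type*} [CommMonoid R] {f : ℕ → R}
    (hf : ∀ i j, i ≤ j → f i ∣ f j) (m : ℕ) :
    ∀ J : Finset ℕ, J.card = m → (∏ r ∈ Finset.range m, f r) ∣ ∏ j ∈ J, f j := by
  induction m with
  | zero => intro J _; simp
  | succ m ih =>
    intro J hJ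
    have hne : J.Nonempty := Finset.card_pos.1 (by omega)
    have hmem := J.max'_mem hne
    have hle : m ≤ J.max' hne := by
      have h1 : J ⊆ Finset.range (J.max' hne + 1) := fun j hj =>
        Finset.mem_range.2 (Nat.lt_succ_of_le (J.le_max' j hj))
      have h2 := Finset.card_le_card h1
      rw [Finset.card_range] at h2
      omega
    rw [Finset.prod_range_succ, ← Finset.prod_erase_mul _ _ hmem]
    exact mul_dvd_mul (ih _ (by rw [Finset.card_erase_of_mem hmem]; omega)) (hf _ _ hle)

theorem poch_dvd_poch {R : Type} [CommSemiring R] (z : R) (i j : ℕ) (h : i ≤ j) :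
    poch z i ∣ poch z j := by
  rw [poch_eq_prod, poch_eq_prod]
  exact Finset.prod_dvd_prod_of_subset _ _ _ (Finset.range_subset_range.2 h)

section Divisibility

variable {ι : Type*} [Fintype ι] (c c' : ι → ℂ)

/-- The common factor of Casorati determinants with `n + 1` rows in which the gauge factor of `s`
occurs in `m s` columns. -/
def gaugeDenom (n : ℕ) (m : ι → ℕ) : ℂ[X] :=
  ∏ s, ∏ r ∈ Finset.range (m s), (poch (linPlus (c s)) r * poch (linMinus (c' s - n)) r)

theorem gaugeDenom_ne_zero (n : ℕ) (m : ι → ℕ) : gaugeDenom c c' n m ≠ 0 :=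
  Finset.prod_ne_zero_iff.2 fun _ _ => Finset.prod_ne_zero_iff.2 fun _ _ =>
    mul_ne_zero (poch_linPlus_ne_zero _ _) (poch_linMinus_ne_zero _ _)

theorem gaugeDenom_dvd (n : ℕ) {m m' : ι → ℕ} (h : ∀ s, m s ≤ m' s) :
    gaugeDenom c c' n m ∣ gaugeDenom c c' n m' :=
  Finset.prod_dvd_prod_of_dvd _ _ fun s _ =>
    Finset.prod_dvd_prod_of_subset _ _ _ (Finset.range_subset_range.2 (h s))

theorem hasTop_linPlus (c : ℂ) : HasTop (linPlus c) 1 Complex.I := by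
  have h := hasTopTwo_linPlus c
  have h3 := h.2.1
  rw [coeff_reflect, revAt_le (Nat.zero_le _), Nat.sub_zero] at h3
  exact_mod_cast (hasTop_natCast (n := 1)).2 ⟨h.1, h3⟩

theorem hasTop_linMinus (c : ℂ) : HasTop (linMinus c) 1 (-Complex.I) := by
  have h := hasTopTwo_linMinus c
  have h3 := h.2.1
  rw [coeff_reflect, revAt_le (Nat.zero_le _), Nat.sub_zero] at h3
  exact_mod_cast (hasTop_natCast (n := 1)).2 ⟨h.1, h3⟩

theorem hasTop_poch_linPlus (c : ℂ) (k : ℕ) : HasTop (poch (linPlus c) k) k (Complex.I ^ k) := by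
  rw [poch_eq_prod]
  simpa using HasTop.prod (s := Finset.range k) (f := fun r : ℕ => linPlus c + (r : ℂ[X]))
    (d := fun _ => 1) (a := fun _ => Complex.I) fun r _ => by
      simp only [linPlus_add_natCast]; exact hasTop_linPlus _

theorem hasTop_poch_linMinus (c : ℂ) (k : ℕ) :
    HasTop (poch (linMinus c) k) k ((-Complex.I) ^ k) := by
  rw [poch_eq_prod]
  simpa using HasTop.prod (s := Finset.range k) (f := fun r : ℕ => linMinus c + (r : ℂ[X]))
    (d := fun _ => 1) (a := fun _ => -Complex.I) fun r _ => by
      simp only [linMinus_add_natCast]; exact hasTop_linMinus _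

theorem natDegree_gaugeDenom (n : ℕ) (m : ι → ℕ) :
    (gaugeDenom c c' n m).natDegree = ∑ s, m s * (m s - 1) := by
  rw [gaugeDenom, natDegree_prod _ _ fun s _ => Finset.prod_ne_zero_iff.2 fun r _ =>
    mul_ne_zero (poch_linPlus_ne_zero _ _) (poch_linMinus_ne_zero _ _)]
  refine Finset.sum_congr rfl fun s _ => ?_
  rw [natDegree_prod _ _ fun r _ =>
    mul_ne_zero (poch_linPlus_ne_zero _ _) (poch_linMinus_ne_zero _ _)]
  have : ∀ r ∈ Finset.range (m s),
      (poch (linPlus (c s)) r * poch (linMinus (c' s - n)) r).natDegree = r * 2 := by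
    intro r _
    rw [natDegree_mul (poch_linPlus_ne_zero _ _) (poch_linMinus_ne_zero _ _),
      (hasTop_poch_linPlus (c s) r).natDegree_eq (pow_ne_zero _ Complex.I_ne_zero),
      (hasTop_poch_linMinus (c' s - n) r).natDegree_eq
        (pow_ne_zero _ (neg_ne_zero.2 Complex.I_ne_zero))]
    ring
  rw [Finset.sum_congr rfl this, ← Finset.sum_mul, Finset.sum_range_id_mul_two]

variable {c c'} [DecidableEq ι]

/-- In each permutation term the columns carrying the gauge of `s` sit in distinct rows. Their
Pochhammer lengths `j`, and likewise `n - j`, are distinct, and `prod_range_dvd_prod` applies to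
each term. -/
theorem gaugeDenom_dvd_det {n : ℕ} (S : Fin (n + 1) → Finset ι) (f : Fin (n + 1) → ℂ[X]) :
    gaugeDenom c c' n (fun s => (Finset.univ.filter fun k => s ∈ S k).card) ∣
      (Matrix.of fun j k : Fin (n + 1) => entry c c' (S k) n j (f k)).det := by
  rw [Matrix.det_apply']
  refine Finset.dvd_sum fun σ _ => Dvd.dvd.mul_left ?_ _
  simp only [Matrix.of_apply, entry, Finset.prod_mul_distrib]
  refine Dvd.dvd.mul_right ?_ _
  have h1 : ∏ k, colFactor c c' (S k) n (σ k : Fin (n + 1)) =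
      ∏ s, ∏ k ∈ Finset.univ.filter (fun k => s ∈ S k),
        gaugeFactor (c s) (c' s) n (σ k : Fin (n + 1)) := by
    simp only [colFactor]
    exact Finset.prod_comm' (by simp)
  rw [h1, gaugeDenom]
  refine Finset.prod_dvd_prod_of_dvd _ _ fun s _ => ?_
  set K := Finset.univ.filter fun k => s ∈ S k
  simp only [gaugeFactor, Finset.prod_mul_distrib]
  have hinj : ∀ x ∈ K, ∀ y ∈ K, ((σ x : Fin (n + 1)) : ℕ) = (σ y : Fin (n + 1)) → x = y :=
    fun x _ y _ h => σ.injective (Fin.ext h)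
  refine mul_dvd_mul (Dvd.dvd.mul_left ?_ _) ?_
  · have := prod_range_dvd_prod (poch_dvd_poch (linPlus (c s))) K.card
      (K.image fun k => ((σ k : Fin (n + 1)) : ℕ)) (Finset.card_image_of_injOn hinj)
    rwa [Finset.prod_image hinj] at this
  · have hinj' : ∀ x ∈ K, ∀ y ∈ K,
        n - ((σ x : Fin (n + 1)) : ℕ) = n - (σ y : Fin (n + 1)) → x = y :=
      fun x hx y hy h => hinj x hx y hy (by omega)
    have := prod_range_dvd_prod (poch_dvd_poch (linMinus (c' s - n))) K.card
      (K.image fun k => n - ((σ k : Fin (n + 1)) : ℕ)) (Finset.card_image_of_injOn hinj')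
    rwa [Finset.prod_image hinj'] at this

variable (c c')

theorem det_fullMatrix_eq_cramer {M : ℕ} (τ : Fin M → ι) (ξ : Fin M → ℂ[X]) (p : ℂ[X]) :
    (fullMatrix c c' τ ξ p).det = (fullMatrix c c' τ ξ 0).cramer
      (fun j => entry c c' Finset.univ M j p) (Fin.last M) := by
  rw [Matrix.cramer_apply]
  congr 1
  ext j k : 2
  refine Fin.lastCases ?_ (fun k => ?_) k
  · simp [fullMatrix]
  · simp [fullMatrix]

/-- The common factor of the Casorati determinant of the seeds. -/
def seedDenom {M : ℕ} (τ : Fin M → ι) : ℂ[X] :=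
  gaugeDenom c c' (M - 1) fun s => (Finset.univ.filter fun k => τ k ≠ s).card

/-- The common factor of the Casorati determinants of the seeds and a polynomial. -/
def fullDenom {M : ℕ} (τ : Fin M → ι) : ℂ[X] :=
  gaugeDenom c c' M fun s => (Finset.univ.filter fun k => τ k ≠ s).card + 1

/-- The determinant of `fullMatrix` as a linear map. -/
def fullDet {M : ℕ} (τ : Fin M → ι) (ξ : Fin M → ℂ[X]) : ℂ[X] →ₗ[ℂ] ℂ[X] where
  toFun p := (fullMatrix c c' τ ξ p).det
  map_add' p q := by
    have h : (fun j : Fin (M + 1) => entry c c' Finset.univ M j (p + q)) =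
        (fun j : Fin (M + 1) => entry c c' Finset.univ M j p) +
          fun j : Fin (M + 1) => entry c c' Finset.univ M j q :=
      funext fun j => entry_add c c' _ _ _ _ _
    simp only [det_fullMatrix_eq_cramer c c' τ ξ, h, map_add, Pi.add_apply]
  map_smul' a p := by
    have h : (fun j : Fin (M + 1) => entry c c' Finset.univ M j (a • p)) =
        C a • (fun j : Fin (M + 1) => entry c c' Finset.univ M j p) := funext fun j => by
      rw [Pi.smul_apply, smul_eq_mul, smul_eq_C_mul, mul_comm, entry_mul, taylor_C, mul_comm]
    rw [det_fullMatrix_eq_cramer, det_fullMatrix_eq_cramer c c' τ ξ p, h, map_smul,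
      Pi.smul_apply, smul_eq_mul, RingHom.id_apply, smul_eq_C_mul]

theorem fullDet_apply {M : ℕ} (τ : Fin M → ι) (ξ : Fin M → ℂ[X]) (p : ℂ[X]) :
    fullDet c c' τ ξ p = (fullMatrix c c' τ ξ p).det := rfl

theorem fullMatrix_eq {M : ℕ} (τ : Fin M → ι) (ξ : Fin M → ℂ[X]) (p : ℂ[X]) :
    fullMatrix c c' τ ξ p = Matrix.of fun j k : Fin (M + 1) => entry c c'
      ((Fin.snoc (fun k => Finset.univ.erase (τ k)) Finset.univ : Fin (M + 1) → Finset ι) k) M j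
      ((Fin.snoc ξ p : Fin (M + 1) → ℂ[X]) k) := by
  ext j k : 2
  refine Fin.lastCases ?_ (fun k => ?_) k
  · simp [fullMatrix]
  · simp [fullMatrix]

theorem fullDenom_dvd {M : ℕ} (τ : Fin M → ι) (ξ : Fin M → ℂ[X]) (p : ℂ[X]) :
    fullDenom c c' τ ∣ fullDet c c' τ ξ p := by
  rw [fullDet_apply, fullMatrix_eq]
  refine dvd_trans (gaugeDenom_dvd c c' _ fun s => ?_) (gaugeDenom_dvd_det _ _)
  rw [Finset.card_filter, Finset.card_filter, Fin.sum_univ_castSucc]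
  simp [eq_comm]

theorem seedDenom_dvd {M : ℕ} (τ : Fin M → ι) (ξ : Fin M → ℂ[X]) :
    seedDenom c c' τ ∣ (seedMatrix c c' τ ξ).det := by
  rcases M with _ | m
  · simp [seedDenom, gaugeDenom]
  refine dvd_trans (gaugeDenom_dvd c c' _ fun s => ?_) (gaugeDenom_dvd_det _ _)
  simp [eq_comm]

/-- Replacing a seed column by one with all gauge factors can only increase the multiplicities, so
the common factor of the seeds still divides. -/
theorem seedDenom_dvd_cramer {m : ℕ} (τ : Fin (m + 1) → ι) (ξ : Fin (m + 1) → ℂ[X]) (p : ℂ[X])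
    (k : Fin (m + 1)) : seedDenom c c' τ ∣ (seedMatrix c c' τ ξ).cramer
      (fun j => entry c c' Finset.univ m j p) k := by
  have h1 : (seedMatrix c c' τ ξ).updateCol k (fun j => entry c c' Finset.univ m j p) =
      Matrix.of fun j l : Fin (m + 1) => entry c c'
        (Function.update (fun k => Finset.univ.erase (τ k)) k Finset.univ l) m j
        (Function.update ξ k p l) := by
    ext j l : 2
    rcases eq_or_ne l k with rfl | hl
    · simp
    · simp [hl, seedMatrix]
  rw [Matrix.cramer_apply, h1]
  refine dvd_trans (gaugeDenom_dvd c c' _ fun s => ?_) (gaugeDenom_dvd_det _ _)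
  refine Finset.card_le_card fun l hl => ?_
  rw [Finset.mem_filter] at hl ⊢
  refine ⟨hl.1, ?_⟩
  rcases eq_or_ne l k with rfl | hlk
  · simp
  · simpa [hlk, eq_comm] using hl.2

end Divisibility

-- Recurrence relations in general position

section Recurrence

variable {ι : Type*} [Fintype ι] [DecidableEq ι]

/-- Eigenpolynomials `P` of the difference operator with eigenvalues `ev`, and seed solutions `ξ`
with eigenvalues `E`, whose Casorati determinants have the expected degrees. -/
structure Admissible (c c' : ι → ℂ) (κ κ' : ℂ) {M : ℕ} (τ : Fin M → ι) (ξ : Fin M → ℂ[X])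
    (E : Fin M → ℂ) (P : ℕ → ℂ[X]) (ev : ℕ → ℂ) (ℓ D : ℕ) : Prop where
  seed : ∀ k, IsSeed c c' κ κ' (τ k) (ξ k) (E k)
  degree_eq : ∀ n, (P n).degree = n
  eigen : ∀ n, diffOp (C κ * ∏ i, linPlus (c i)) (C κ' * ∏ i, linMinus (c' i)) (P n) = ev n • P n
  ev_ne : ∀ n k, ev n ≠ E k
  ev_inj : Function.Injective ev
  natDegree_full : ∀ n, (fullDet c c' τ ξ (P n)).natDegree = ℓ + n
  full_ne_zero : ∀ n, fullDet c c' τ ξ (P n) ≠ 0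
  natDegree_seed : (seedMatrix c c' τ ξ).det.natDegree = D
  seed_ne_zero : (seedMatrix c c' τ ξ).det ≠ 0

/-- Parameters in general position. -/
structure Generic (c c' : ι → ℂ) (κ κ' : ℂ) (M : ℕ) : Prop where
  add_ne : ∀ (s s' : ι) (n : ℤ), c s + c' s' ≠ n
  pearson : ∀ g, (C κ * ∏ s, linPlus (c s)) * taylor (-Complex.I) g -
    (C κ' * ∏ s, linMinus (c' s - (M - 1 : ℕ))) * g ≠ 1

variable {c c' : ι → ℂ} {κ κ' : ℂ} {M : ℕ} {τ : Fin M → ι} {ξ : Fin M → ℂ[X]} {E : Fin M → ℂ}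
  {P : ℕ → ℂ[X]} {ev : ℕ → ℂ} {ℓ D : ℕ}

/-- The recurrence relations for parameters in general position. -/
theorem Admissible.mul_mem_span_of_generic (h : Admissible c c' κ κ' τ ξ E P ev ℓ D)
    (hg : Generic c c' κ κ' M) (hκ : κ ≠ 0) (hκ' : κ' ≠ 0) {Ξ Xb Yb : ℂ[X]}
    (hΞ : (seedMatrix c c' τ ξ).det = seedDenom c c' τ * Ξ)
    (hX : Xb - taylor Complex.I Xb = Ξ * Yb) {N : ℕ} (hN : Xb.natDegree ≤ N) (n : ℕ) :
    Xb * fullDet c c' τ ξ (P n) ∈ Submodule.span ℂ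
      ((fun k => fullDet c c' τ ξ (P k)) '' {k | n ≤ k + N ∧ k ≤ n + N}) := by
  obtain ⟨Lb, hL0, hL⟩ := exists_pearson hg.pearson
  have hnd : ∀ q, (∀ r, Lb (q * r) = 0) → q = 0 := fun q =>
    Pearson.nondegenerate hκ hκ' q.natDegree c Lb hL0 (fun s s' r h0 =>
      hg.add_ne s s' (r + (M - 1 : ℕ)) (by push_cast; linear_combination h0)) hL q le_rfl
  have hsym : ∀ j ≤ M - 1, ∀ p g, rowFunctional c c' Lb (M - 1) j (p *
      diffOp (C κ * ∏ i, linPlus (c i)) (C κ' * ∏ i, linMinus (c' i)) g) =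
      rowFunctional c c' Lb (M - 1) j
        (diffOp (C κ * ∏ i, linPlus (c i)) (C κ' * ∏ i, linMinus (c' i)) p * g) := by
    intro j hj p g
    have := (pearson_rowFunctional (c := c) (c' := c') hj hL).symm X p g
    rwa [aeval_X] at this
  have hQ : ∀ n, (∏ k, (X - C (E k))).eval (ev n) ≠ 0 := by
    intro n
    rw [eval_prod]
    exact Finset.prod_ne_zero_iff.2 fun k _ => by
      rw [eval_sub, eval_X, eval_C]; exact sub_ne_zero.2 (h.ev_ne n k)
  -- Without seeds the determinant map is the identity, the lift is multiplication by `Xb`, and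
  -- symmetry is commutativity.
  rcases M with _ | m
  · have hF : ∀ p, fullDet c c' τ ξ p = p := by
      intro p
      refine (Matrix.det_fin_one _).trans ?_
      simp [fullMatrix, entry, colFactor, gaugeFactor, poch_zero, Fin.snoc]
    refine mul_mem_span_of_symm (L := rowFunctional c c' Lb 0 0)
      (fun q => rowFunctional_nondegenerate hnd) (hsym 0 le_rfl) h.degree_eq h.eigen h.ev_inj
      (Q := 1) (by simp) h.natDegree_full hN (Z := fun p => Xb * p) (fun p => by simp only [hF])
      (fun p g => ?_) n
    rw [map_one, Module.End.one_apply, Module.End.one_apply]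
    congr 1
    ring
  · have hΞ0 : Ξ ≠ 0 := by
      rintro rfl
      exact h.seed_ne_zero (by rw [hΞ, mul_zero])
    choose w R q hq using exists_isLift hg.add_ne (gaugeDenom_ne_zero _ _ _ _) hΞ
      (seedDenom_dvd_cramer c c' τ ξ) hX
    exact mul_mem_span_of_symm (L := rowFunctional c c' Lb m ((m + 1) / 2))
      (fun q => rowFunctional_nondegenerate hnd) (hsym _ (by omega)) h.degree_eq h.eigen h.ev_inj
      hQ h.natDegree_full hN (Z := q) (fun p => (hq p).det_fullMatrix hX)
      (fun p g => IsLift.symm hL h.seed hΞ0 hX (hq p) (hq g) rfl rfl) n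

end Recurrence

/-! ### Removing the genericity assumption by continuity -/

/-- If the limit vector lay outside the limit span, the enlarged family would be independent at
`t₀`, hence also nearby, because independence is an open condition. -/
theorem mem_span_of_frequently {V : Type*} [NormedAddCommGroup V] [NormedSpace ℂ V]
    [FiniteDimensional ℂ V] {T : Type*} [TopologicalSpace T] {t₀ : T} {κ : Type*} [Finite κ]
    {v : T → V} {w : T → κ → V} (hv : ContinuousAt v t₀)
    (hw : ∀ k, ContinuousAt (fun t => w t k) t₀)
    (hli : LinearIndependent ℂ (w t₀))
    (h : ∃ᶠ t in nhds t₀, v t ∈ Submodule.span ℂ (Set.range (w t))) :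
    v t₀ ∈ Submodule.span ℂ (Set.range (w t₀)) := by
  by_contra hn
  have h1 : LinearIndependent ℂ (fun o : Option κ => o.casesOn' (v t₀) (w t₀)) :=
    linearIndependent_option'.2 ⟨hli, hn⟩
  have hc : ContinuousAt (fun t => fun o : Option κ => o.casesOn' (v t) (w t)) t₀ := by
    rw [continuousAt_pi]
    rintro (_ | k)
    · exact hv
    · exact hw k
  have h2 := hc.eventually (isOpen_setOfPred_linearIndependent.mem_nhds h1)
  obtain ⟨t, ht1, ht2⟩ := (h.and_eventually h2).exists
  exact (linearIndependent_option'.1 ht2).2 ht1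

theorem exists_sub_taylor_eq (g : ℂ[X]) : ∃ f : ℂ[X], f - taylor Complex.I f = g := by
  refine ⟨C Complex.I * taylor (-(Complex.I / 2)) (invDiff g), ?_⟩
  have h := invDiff_spec g
  rw [taylor_mul, taylor_C, taylor_taylor, ← mul_sub,
    show Complex.I + -(Complex.I / 2) = Complex.I / 2 by ring, taylor_apply, taylor_apply, C_neg,
    ← sub_eq_add_neg, h, ← mul_assoc, ← C_mul, mul_neg, Complex.I_mul_I, neg_neg, C_1, one_mul]

theorem natDegree_of_sub_taylor_eq {f g : ℂ[X]} (hg : g ≠ 0) (h : f - taylor Complex.I f = g) :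
    f.natDegree = g.natDegree + 1 := by
  have h0 : f.natDegree ≠ 0 := by
    intro h0
    rw [eq_C_of_natDegree_eq_zero h0, taylor_C, sub_self] at h
    exact hg h.symm
  have h1 := hasTop_sub_taylor (hasTop_natDegree f) Complex.I
  obtain ⟨d, hd⟩ : ∃ d, f.natDegree = d + 1 := ⟨f.natDegree - 1, by omega⟩
  rw [show taylor Complex.I f - f = -g by rw [← h]; ring, hd] at h1
  have h2 := HasTop.natDegree_eq (n := d) (by simpa using h1) ?_
  · rw [hd, ← h2, natDegree_neg]
  · refine mul_ne_zero (mul_ne_zero ?_ Complex.I_ne_zero)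
      (leadingCoeff_ne_zero.2 fun hf => h0 (by rw [hf, natDegree_zero]))
    exact_mod_cast Nat.succ_ne_zero d

theorem linearIndependent_of_natDegree_injective {κ : Type*} {f : κ → ℂ[X]} (h0 : ∀ k, f k ≠ 0)
    (hinj : Function.Injective fun k => (f k).natDegree) : LinearIndependent ℂ f := by
  rw [linearIndependent_iff']
  intro s g hg i hi
  by_contra hgi
  have hdisj := degree_sum_eq_of_disjoint (fun k => g k • f k) s (by
    rintro k ⟨_, hk⟩ l ⟨_, hl⟩ hkl h
    have hk' : g k ≠ 0 := fun h => hk (by simp only [h, zero_smul])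
    have hl' : g l ≠ 0 := fun h => hl (by simp only [h, zero_smul])
    have h2 := natDegree_eq_of_degree_eq (show (g k • f k).degree = (g l • f l).degree from h)
    rw [smul_eq_C_mul, smul_eq_C_mul, natDegree_C_mul hk', natDegree_C_mul hl'] at h2
    exact hkl (hinj h2))
  rw [hg, degree_zero] at hdisj
  have h1 : (g i • f i).degree ≤ ⊥ := by
    rw [hdisj]
    exact Finset.le_sup (f := fun k => (g k • f k).degree) hi
  have h2 := degree_eq_bot.1 (le_bot_iff.1 h1)
  exact (smul_ne_zero hgi (h0 i)) h2

section Continuity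

variable {ι : Type*} {T : Type*} [TopologicalSpace T] {t₀ : T}
  {c c' : T → ι → ℂ}

theorem continuousAt_poch {f : T → ℂ} (hf : ContinuousAt f t₀) (k : ℕ) :
    ContinuousAt (fun t => poch (f t) k) t₀ := by
  simp only [poch_eq_prod]
  fun_prop

theorem continuousAt_eval_entry (hc : ∀ s, ContinuousAt (fun t => c t s) t₀)
    (hc' : ∀ s, ContinuousAt (fun t => c' t s) t₀) {f : T → ℂ[X]}
    (hf : ∀ z, ContinuousAt (fun t => (f t).eval z) t₀) (S : Finset ι) (n j : ℕ) (z : ℂ) :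
    ContinuousAt (fun t => (entry (c t) (c' t) S n j (f t)).eval z) t₀ := by
  simp only [eval_entry, eval_gaugeFactor]
  refine ContinuousAt.mul ?_ (hf _)
  refine tendsto_finsetProd _ fun s _ => ?_
  exact (continuousAt_const.mul (continuousAt_poch ((hc s).add continuousAt_const) _)).mul
    (continuousAt_poch (((hc' s).sub continuousAt_const).sub continuousAt_const) _)

theorem continuousAt_eval_det {N : ℕ} {A : T → Matrix (Fin N) (Fin N) ℂ[X]} {z : ℂ}
    (h : ∀ i j, ContinuousAt (fun t => (A t i j).eval z) t₀) :
    ContinuousAt (fun t => (A t).det.eval z) t₀ := by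
  simp only [Matrix.det_apply', eval_finsetSum, eval_mul, eval_prod]
  refine tendsto_finsetSum _ fun σ _ => ContinuousAt.mul ?_ ?_
  · simp only [eval_intCast]
    exact continuousAt_const
  · exact tendsto_finsetProd _ fun k _ => h _ _

variable [Fintype ι] [DecidableEq ι] {M : ℕ} {τ : Fin M → ι} {ξ : T → Fin M → ℂ[X]}

theorem continuousAt_eval_seedDet (hc : ∀ s, ContinuousAt (fun t => c t s) t₀)
    (hc' : ∀ s, ContinuousAt (fun t => c' t s) t₀)
    (hξ : ∀ k z, ContinuousAt (fun t => (ξ t k).eval z) t₀) (z : ℂ) :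
    ContinuousAt (fun t => (seedMatrix (c t) (c' t) τ (ξ t)).det.eval z) t₀ :=
  continuousAt_eval_det fun _ k => continuousAt_eval_entry hc hc' (hξ k) _ _ _ _

theorem continuousAt_eval_fullDet (hc : ∀ s, ContinuousAt (fun t => c t s) t₀)
    (hc' : ∀ s, ContinuousAt (fun t => c' t s) t₀)
    (hξ : ∀ k z, ContinuousAt (fun t => (ξ t k).eval z) t₀) {p : T → ℂ[X]}
    (hp : ∀ z, ContinuousAt (fun t => (p t).eval z) t₀) (z : ℂ) :
    ContinuousAt (fun t => (fullDet (c t) (c' t) τ (ξ t) (p t)).eval z) t₀ := by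
  simp only [fullDet_apply]
  refine continuousAt_eval_det fun j k => ?_
  refine Fin.lastCases ?_ (fun k => ?_) k
  · simpa [fullMatrix] using continuousAt_eval_entry hc hc' hp _ _ _ _
  · simpa [fullMatrix] using continuousAt_eval_entry hc hc' (hξ k) _ _ _ _

theorem continuousAt_eval_seedDenom (hc : ∀ s, ContinuousAt (fun t => c t s) t₀)
    (hc' : ∀ s, ContinuousAt (fun t => c' t s) t₀) (z : ℂ) :
    ContinuousAt (fun t => (seedDenom (c t) (c' t) τ).eval z) t₀ := by
  simp only [seedDenom, gaugeDenom, eval_prod, eval_mul, eval_poch, eval_linPlus, eval_linMinus]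
  refine tendsto_finsetProd _ fun s _ => tendsto_finsetProd _ fun r _ => ?_
  exact (continuousAt_poch ((hc s).add continuousAt_const) _).mul
    (continuousAt_poch (((hc' s).sub continuousAt_const).sub continuousAt_const) _)

variable {κ κ' : ℂ} {E : T → Fin M → ℂ} {P : T → ℕ → ℂ[X]} {ev : T → ℕ → ℂ} {ℓ D : ℕ}

/-- The recurrence relations at a limit of parameters in general position. -/
theorem mul_mem_span_of_frequently_generic (hc : ∀ s, ContinuousAt (fun t => c t s) t₀)
    (hc' : ∀ s, ContinuousAt (fun t => c' t s) t₀)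
    (hξ : ∀ k z, ContinuousAt (fun t => (ξ t k).eval z) t₀)
    (hP : ∀ n z, ContinuousAt (fun t => (P t n).eval z) t₀)
    (hadm : ∀ᶠ t in nhds t₀,
      Admissible (c t) (c' t) κ κ' τ (ξ t) (E t) (P t) (ev t) ℓ D)
    (hgen : ∃ᶠ t in nhds t₀, Generic (c t) (c' t) κ κ' M) (hκ : κ ≠ 0) (hκ' : κ' ≠ 0)
    {Ξ Xb Yb : ℂ[X]} (hY : Yb ≠ 0)
    (hΞ : (seedMatrix (c t₀) (c' t₀) τ (ξ t₀)).det = seedDenom (c t₀) (c' t₀) τ * Ξ)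
    (hX : Xb - taylor Complex.I Xb = Ξ * Yb) (n : ℕ) :
    Xb * fullDet (c t₀) (c' t₀) τ (ξ t₀) (P t₀ n) ∈ Submodule.span ℂ
      ((fun k => fullDet (c t₀) (c' t₀) τ (ξ t₀) (P t₀ k)) ''
        {k | n ≤ k + Xb.natDegree ∧ k ≤ n + Xb.natDegree}) := by
  have hadm₀ := hadm.self_of_nhds
  set F : T → ℕ → ℂ[X] := fun t k => fullDet (c t) (c' t) τ (ξ t) (P t k) with hF
  choose Ξt hΞt using fun t => seedDenom_dvd (c t) (c' t) τ (ξ t)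
  have hden : ∀ t, seedDenom (c t) (c' t) τ ≠ 0 := fun t => gaugeDenom_ne_zero _ _ _ _
  have hΞt₀ : Ξt t₀ = Ξ := mul_left_cancel₀ (hden t₀) (by rw [← hΞt, hΞ])
  have hΞt0 : ∀ t, Admissible (c t) (c' t) κ κ' τ (ξ t) (E t) (P t) (ev t) ℓ D → Ξt t ≠ 0 := by
    intro t ht h0
    exact ht.seed_ne_zero (by rw [hΞt, h0, mul_zero])
  have hΞdeg : ∀ t, Admissible (c t) (c' t) κ κ' τ (ξ t) (E t) (P t) (ev t) ℓ D →
      (Ξt t).natDegree = Ξ.natDegree := by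
    have h1 : ∀ t, Admissible (c t) (c' t) κ κ' τ (ξ t) (E t) (P t) (ev t) ℓ D →
        ∑ s, (Finset.univ.filter fun k => τ k ≠ s).card *
          ((Finset.univ.filter fun k => τ k ≠ s).card - 1) + (Ξt t).natDegree = D := by
      intro t ht
      rw [← ht.natDegree_seed, hΞt, natDegree_mul (hden t) (hΞt0 t ht), seedDenom,
        natDegree_gaugeDenom]
    intro t ht
    have h2 := h1 t ht
    have h3 := h1 t₀ hadm₀
    rw [hΞt₀] at h3
    omega
  set d := (Ξ * Yb).natDegree with hd
  have hΞ0 : Ξ ≠ 0 := hΞt₀ ▸ hΞt0 t₀ hadm₀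
  have hN : Xb.natDegree = d + 1 := natDegree_of_sub_taylor_eq (mul_ne_zero hΞ0 hY) hX
  rw [hN]
  -- More points than the degree of any polynomial in the relation, so values at `K` points
  -- determine everything. The points avoid the zeros of the common factor at `t₀`, where `Ξt` is
  -- therefore a continuous quotient.
  set K := ℓ + n + (d + 1) + 1 with hK
  have hinf : {z : ℂ | (seedDenom (c t₀) (c' t₀) τ).eval z ≠ 0}.Infinite := by
    have : {z : ℂ | (seedDenom (c t₀) (c' t₀) τ).eval z ≠ 0} =
        {z : ℂ | (seedDenom (c t₀) (c' t₀) τ).IsRoot z}ᶜ := rfl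
    rw [this]
    exact (finite_setOfPred_isRoot (hden t₀)).infinite_compl
  let z : Fin K → ℂ := fun i => (hinf.natEmbedding _ i : ℂ)
  have hz : Function.Injective z := fun i j h =>
    Fin.ext ((hinf.natEmbedding _).injective (Subtype.ext h))
  have hz0 : ∀ i, (seedDenom (c t₀) (c' t₀) τ).eval (z i) ≠ 0 := fun i =>
    (hinf.natEmbedding _ (i : ℕ)).2
  -- Inverting the difference on a fixed Lagrange basis makes `Xt` linear in the values of Ξt Yb,
  -- hence continuous at `t₀`.
  choose f hf using fun i => exists_sub_taylor_eq (Lagrange.basis Finset.univ z i)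
  let Xt : T → ℂ[X] := fun t => ∑ i, C ((Ξt t * Yb).eval (z i)) * f i
  have hXt : ∀ t, Admissible (c t) (c' t) κ κ' τ (ξ t) (E t) (P t) (ev t) ℓ D →
      Xt t - taylor Complex.I (Xt t) = Ξt t * Yb := by
    intro t ht
    have hlt : (Ξt t * Yb).degree < (Finset.univ : Finset (Fin K)).card := by
      refine lt_of_le_of_lt degree_le_natDegree ?_
      rw [natDegree_mul (hΞt0 t ht) hY, hΞdeg t ht, ← natDegree_mul hΞ0 hY, ← hd, Finset.card_univ,
        Fintype.card_fin]
      exact_mod_cast (by omega : d < K)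
    conv_rhs => rw [Lagrange.eq_interpolate (s := Finset.univ) (v := z) hz.injOn hlt]
    rw [Lagrange.interpolate_apply, map_sum, ← Finset.sum_sub_distrib]
    refine Finset.sum_congr rfl fun i _ => ?_
    rw [taylor_mul, taylor_C, ← mul_sub, hf]
  have hXtdeg : ∀ t, Admissible (c t) (c' t) κ κ' τ (ξ t) (E t) (P t) (ev t) ℓ D →
      (Xt t).natDegree = d + 1 := by
    intro t ht
    rw [natDegree_of_sub_taylor_eq (mul_ne_zero (hΞt0 t ht) hY) (hXt t ht),
      natDegree_mul (hΞt0 t ht) hY, hΞdeg t ht, ← natDegree_mul hΞ0 hY]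
  -- evaluation at the chosen points
  let ez : ℂ[X] →ₗ[ℂ] (Fin K → ℂ) := LinearMap.pi fun i => leval (z i)
  have hez : ∀ p i, ez p i = p.eval (z i) := fun p i => rfl
  have hezinj : ∀ p q : ℂ[X], p.natDegree < K → q.natDegree < K → ez p = ez q → p = q := by
    intro p q hp hq h
    refine eq_of_natDegree_lt_card_of_eval_eq p q hz (fun i => congrFun h i) ?_
    rw [Fintype.card_fin]
    exact max_lt hp hq
  let I := {k : ℕ // n ≤ k + (d + 1) ∧ k ≤ n + (d + 1)}
  have hIfin : Finite I := Set.Finite.to_subtype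
    ((Set.finite_Iic (n + (d + 1))).subset fun k hk => hk.2)
  have himg : ∀ t, (fun k => F t k) '' {k | n ≤ k + (d + 1) ∧ k ≤ n + (d + 1)} =
      Set.range fun k : I => F t k := fun t => Set.image_eq_range _ _
  have hspan : ∀ p ∈ Submodule.span ℂ (Set.range fun k : I => F t₀ k), p.natDegree < K := by
    intro p hp
    have : Submodule.span ℂ (Set.range fun k : I => F t₀ k) ≤ degreeLT ℂ K := by
      rw [Submodule.span_le]
      rintro _ ⟨k, rfl⟩
      rw [SetLike.mem_coe, mem_degreeLT]
      refine lt_of_le_of_lt degree_le_natDegree ?_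
      rw [hadm₀.natDegree_full]
      exact_mod_cast (by have := k.2.2; omega : ℓ + k.1 < K)
    have h1 := mem_degreeLT.1 (this hp)
    rcases eq_or_ne p 0 with rfl | hp0
    · simp [hK]
    · rw [degree_eq_natDegree hp0] at h1
      exact_mod_cast h1
  have hcF : ∀ k w, ContinuousAt (fun t => (F t k).eval w) t₀ := fun k w =>
    continuousAt_eval_fullDet hc hc' hξ (hP k) w
  have hcΞ : ∀ i, ContinuousAt (fun t => (Ξt t).eval (z i)) t₀ := by
    intro i
    have h1 := continuousAt_eval_seedDenom (τ := τ) hc hc' (z i)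
    have h2 := (continuousAt_eval_seedDet (τ := τ) hc hc' hξ (z i)).div h1 (hz0 i)
    refine h2.congr ?_
    filter_upwards [h1.eventually_ne (hz0 i)] with t ht
    rw [Pi.div_apply, hΞt, eval_mul, mul_div_cancel_left₀ _ ht]
  have hcX : ∀ w, ContinuousAt (fun t => (Xt t).eval w) t₀ := by
    intro w
    simp only [Xt, eval_finsetSum, eval_mul, eval_C]
    refine tendsto_finsetSum _ fun i _ => ?_
    exact ((hcΞ i).mul continuousAt_const).mul continuousAt_const
  have hmain : ez (Xt t₀ * F t₀ n) ∈
      Submodule.span ℂ (Set.range fun k : I => ez (F t₀ k)) := by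
    refine mem_span_of_frequently (v := fun t => ez (Xt t * F t n))
      (w := fun t (k : I) => ez (F t k)) (t₀ := t₀) ?_ ?_ ?_ ?_
    · rw [continuousAt_pi]
      intro i
      simp only [hez, eval_mul]
      exact (hcX _).mul (hcF _ _)
    · intro k
      rw [continuousAt_pi]
      intro i
      exact hcF _ _
    · refine LinearIndependent.map_injOn (linearIndependent_of_natDegree_injective
        (f := fun k : I => F t₀ k) (fun k => hadm₀.full_ne_zero _) fun k l h => ?_) ez
        fun p hp q hq h => hezinj p q (hspan p hp) (hspan q hq) h
      simp only [hF, hadm₀.natDegree_full] at h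
      exact Subtype.ext (by omega)
    · refine (hgen.and_eventually hadm).mono fun t ht => ?_
      have h1 := ht.2.mul_mem_span_of_generic ht.1 hκ hκ' (hΞt t) (hXt t ht.2)
        (hXtdeg t ht.2).le n
      have h2 := Submodule.mem_map_of_mem (f := ez) h1
      rw [Submodule.map_span, Set.image_image, Set.image_eq_range] at h2
      exact h2
  have hXt₀ : Xt t₀ * F t₀ n ∈ Submodule.span ℂ (Set.range fun k : I => F t₀ k) := by
    have h1 : Submodule.span ℂ (Set.range fun k : I => ez (F t₀ k)) =
        (Submodule.span ℂ (Set.range fun k : I => F t₀ k)).map ez := by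
      rw [Submodule.map_span, ← Set.range_comp]
      rfl
    rw [h1] at hmain
    obtain ⟨p, hp, hpe⟩ := hmain
    rwa [← hezinj p _ (hspan p hp) ?_ hpe]
    refine lt_of_le_of_lt natDegree_mul_le ?_
    rw [hXtdeg t₀ hadm₀, hadm₀.natDegree_full]
    omega
  -- Both solve the same difference equation, so they differ by a constant, which only adds a
  -- multiple of the `n`-th determinant.
  have hconst : (Xb - Xt t₀).natDegree = 0 := by
    refine natDegree_eq_zero_of_taylor_eq Complex.I_ne_zero ?_
    have h1 := hXt t₀ hadm₀
    rw [hΞt₀, ← hX] at h1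
    rw [map_sub]
    linear_combination h1
  rw [himg t₀, show Xb * fullDet (c t₀) (c' t₀) τ (ξ t₀) (P t₀ n) =
    Xt t₀ * F t₀ n + (Xb - Xt t₀) * F t₀ n by ring]
  refine Submodule.add_mem _ hXt₀ ?_
  rw [eq_C_of_natDegree_eq_zero hconst, ← smul_eq_C_mul]
  exact Submodule.smul_mem _ _ (Submodule.subset_span ⟨⟨n, by omega, by omega⟩, rfl⟩)

end Continuity

/-! ### Eigenpolynomials -/

/-- In the basis φ the operator is bidiagonal, so an eigenvector amounts to a two-term recursion for
its coefficients; the weight k kills the term below φ 0. -/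
theorem eigen_of_recursion {H : Module.End ℂ ℂ[X]} {φ : ℕ → ℂ[X]} {lam mu u : ℕ → ℂ} {n : ℕ}
    (hφ : ∀ k, H (φ k) = C (lam k) * φ k - C (k * mu k) * φ (k - 1))
    (hu : ∀ k < n, (lam n - lam k) * u k = -((k + 1) * mu (k + 1) * u (k + 1))) :
    H (∑ k ∈ Finset.range (n + 1), C (u k) * φ k) =
      lam n • ∑ k ∈ Finset.range (n + 1), C (u k) * φ k := by
  have h1 : ∀ k, H (C (u k) * φ k) =
      C (u k * lam k) * φ k - C (u k * (k * mu k)) * φ (k - 1) := by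
    intro k
    rw [← smul_eq_C_mul (u k), map_smul, hφ, smul_eq_C_mul, C_mul (a := u k) (b := lam k),
      C_mul (a := u k)]
    ring
  rw [map_sum, Finset.sum_congr rfl fun k _ => h1 k, Finset.sum_sub_distrib,
    Finset.sum_range_succ' (fun k : ℕ => C (u k * (k * mu k)) * φ (k - 1)), Finset.sum_range_succ,
    Finset.sum_range_succ, smul_add, Finset.smul_sum, Nat.cast_zero, zero_mul, mul_zero, C_0,
    zero_mul, add_zero, add_sub_right_comm, ← Finset.sum_sub_distrib]
  congr 1
  · refine Finset.sum_congr rfl fun k hk => ?_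
    have h2 := hu k (Finset.mem_range.1 hk)
    rw [smul_eq_C_mul, Nat.add_sub_cancel, ← mul_assoc (C (lam n)), ← sub_mul, ← C_mul, ← C_sub]
    congr 2
    push_cast
    linear_combination -h2
  · rw [smul_eq_C_mul, ← mul_assoc, ← C_mul, mul_comm (lam n)]

theorem taylor_neg_I_poch_linPlus (c : ℂ) (k : ℕ) :
    linPlus c * taylor (-Complex.I) (poch (linPlus c) k) =
      poch (linPlus c) k * linPlus (c + k) := by
  have h1 : taylor (-Complex.I) (poch (linPlus c) k) = poch (linPlus (c + 1)) k := by
    rw [← taylor_neg_I_linPlus]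
    exact map_poch (taylorAlgHom (-Complex.I)).toRingHom (linPlus c) k
  have h2 : linPlus (c + 1) = linPlus c + 1 := by
    have := linPlus_add_natCast c 1
    simpa using this.symm
  rw [h1, h2, ← poch_succ_left, poch_succ, linPlus_add_natCast]

theorem taylor_I_poch_linPlus (c : ℂ) (k : ℕ) :
    taylor Complex.I (poch (linPlus c) k) - poch (linPlus c) k =
      -(C (k : ℂ) * poch (linPlus c) (k - 1)) := by
  have h1 : taylor Complex.I (poch (linPlus c) k) = poch (linPlus (c - 1)) k := by
    rw [← taylor_I_linPlus]
    exact map_poch (taylorAlgHom Complex.I).toRingHom (linPlus c) k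
  rcases k with _ | k
  · simp [poch_zero]
  have h2 : linPlus (c - 1) + 1 = linPlus c := by
    have := linPlus_add_natCast (c - 1) 1
    simpa using this
  rw [h1, poch_succ_left, h2, poch_succ, linPlus_add_natCast, Nat.add_sub_cancel]
  simp only [linPlus, C_add, C_sub, map_natCast, C_1]
  push_cast
  ring

theorem linMinus_mul_poch (c c' : ℂ) (k : ℕ) :
    linMinus c' * poch (linPlus c) k =
      C (c + c' + k) * poch (linPlus c) k - poch (linPlus c) (k + 1) := by
  rw [poch_succ, linPlus_add_natCast]
  simp only [linPlus, linMinus, C_add, map_natCast]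
  ring

theorem natCast_mul_linMinus_mul_poch (c c' : ℂ) (k : ℕ) :
    C (k : ℂ) * (linMinus c' * poch (linPlus c) (k - 1)) =
      C (k * (c + c' + k - 1)) * poch (linPlus c) (k - 1) - C (k : ℂ) * poch (linPlus c) k := by
  rcases k with _ | k
  · simp
  rw [Nat.add_sub_cancel, linMinus_mul_poch, C_mul]
  push_cast
  rw [show c + c' + ((k : ℂ) + 1) - 1 = c + c' + k by ring]
  ring

theorem diffOp_poch_one (κ κ' c c' : ℂ) (k : ℕ) :
    diffOp (C κ * linPlus c) (C κ' * linMinus c') (poch (linPlus c) k) =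
      C (k * (κ + κ')) * poch (linPlus c) k -
        C (k * (κ' * (c + c' + k - 1))) * poch (linPlus c) (k - 1) := by
  have h1 := taylor_neg_I_poch_linPlus c k
  have h2 := taylor_I_poch_linPlus c k
  have h3 := natCast_mul_linMinus_mul_poch c c' k
  have h4 : linPlus (c + k) = linPlus c + C (k : ℂ) := by
    rw [← linPlus_add_natCast, map_natCast]
  rw [h4] at h1
  rw [diffOp_apply]
  simp only [C_mul, C_add, C_sub, C_1] at h3 ⊢
  linear_combination C κ * h1 + C κ' * linMinus c' * h2 - C κ' * h3

/-- The basis is built on `c₁`, one of the zeros of V up to rotation: the factor c₁ + iy absorbs the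
shift by -i, and the difference under the shift by +i lowers `k` by one. -/
theorem diffOp_poch_two (c₁ c₁' c₂ c₂' : ℂ) (k : ℕ) :
    diffOp (linPlus c₁ * linPlus c₂) (linMinus c₁' * linMinus c₂') (poch (linPlus c₁) k) =
      C (k * (k + (c₁ + c₂ + c₁' + c₂') - 1)) * poch (linPlus c₁) k -
        C (k * ((c₁ + c₁' + k - 1) * (c₁ + c₂' + k - 1))) * poch (linPlus c₁) (k - 1) := by
  have h1 := taylor_neg_I_poch_linPlus c₁ k
  have h2 := taylor_I_poch_linPlus c₁ k
  have h3 := natCast_mul_linMinus_mul_poch c₁ c₁' k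
  have h5 := natCast_mul_linMinus_mul_poch c₁ c₂' k
  have h4 : linPlus (c₁ + k) = linPlus c₁ + C (k : ℂ) := by
    rw [← linPlus_add_natCast, map_natCast]
  have h6 : linPlus c₂ + linMinus c₂' = C (c₂ + c₂') := by
    simp only [linPlus, linMinus, C_add]; ring
  rw [h4] at h1
  rw [diffOp_apply]
  simp only [C_mul, C_add, C_sub, C_1] at h3 h5 h6 ⊢
  linear_combination linPlus c₂ * h1 + linMinus c₁' * linMinus c₂' * h2 - linMinus c₂' * h3 -
    (C c₁ + C c₁' + C (k : ℂ) - 1) * h5 + C (k : ℂ) * poch (linPlus c₁) k * h6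

theorem HasTop.of_lt {f : ℂ[X]} {d e : ℤ} {a : ℂ} (h : HasTop f d a) (hde : d < e) :
    HasTop f e 0 :=
  ⟨fun n hn => h.1 n (hde.trans hn), fun n hn => h.1 n (by omega), fun _ => rfl⟩

theorem hasTop_sum_poch (u : ℕ → ℂ) (c : ℂ) (n : ℕ) :
    HasTop (∑ k ∈ Finset.range (n + 1), C (u k) * poch (linPlus c) k) n (u n * Complex.I ^ n) := by
  rw [Finset.sum_range_succ, ← zero_add (u n * Complex.I ^ n)]
  have h : ∀ k, HasTop (C (u k) * poch (linPlus c) k) k (u k * Complex.I ^ k) := fun k => by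
    simpa using (hasTop_C (u k)).mul (hasTop_poch_linPlus c k)
  refine HasTop.add ?_ (h n)
  simpa using HasTop.sum (s := Finset.range n) (a := fun _ => 0) fun k hk =>
    (h k).of_lt (by exact_mod_cast Finset.mem_range.1 hk)

theorem poch_neg_self (n : ℕ) : poch (-(n : ℂ)) n = (-1) ^ n * n.factorial := by
  rw [poch, ascPochhammer_eval_neg_eq_descPochhammer, descPochhammer_eval_eq_descFactorial,
    Nat.descFactorial_self]

theorem poch_shift_succ (z : ℂ) {n k : ℕ} (hk : k < n) :
    poch (z + k) (n - k) = (z + k) * poch (z + (k + 1 : ℕ)) (n - (k + 1)) := by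
  rw [show n - k = n - (k + 1) + 1 by omega, poch_succ_left]
  push_cast
  rw [add_assoc]

/-! ### Meixner–Pollaczek -/

theorem diffOp_mpPoly (a φ : ℝ) (n : ℕ) :
    diffOp (C (-Complex.exp (-2 * Complex.I * φ)) * linPlus a) (C 1 * linMinus a) (mpPoly a φ n) =
      (n * (1 - Complex.exp (-2 * Complex.I * φ))) • mpPoly a φ n := by
  rw [mpPoly, ← smul_eq_C_mul (Complex.exp _ / _), map_smul, smul_comm _ (Complex.exp _ / _)]
  congr 1
  refine eigen_of_recursion (lam := fun k => k * (1 - Complex.exp (-2 * Complex.I * φ)))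
    (mu := fun k => (a : ℂ) + a + k - 1) (fun k => ?_) fun k hk => ?_
  · rw [diffOp_poch_one, one_mul, neg_add_eq_sub]
  · rw [poch_succ, poch_shift_succ _ hk, Nat.factorial_succ]
    have h1 : (k.factorial : ℂ) ≠ 0 := by exact_mod_cast k.factorial_ne_zero
    have h2 : (k + 1 : ℂ) ≠ 0 := by exact_mod_cast k.succ_ne_zero
    push_cast
    field_simp
    ring

theorem hasTop_mpPoly (a φ : ℝ) (n : ℕ) : ∃ u, (Complex.exp (-2 * Complex.I * φ) ≠ 1 → u ≠ 0) ∧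
    HasTop (mpPoly a φ n) n u := by
  have h := (hasTop_C (Complex.exp (Complex.I * n * φ) / (n.factorial : ℂ))).mul
    (hasTop_sum_poch (fun k => poch (-(n : ℂ)) k * poch (2 * (a : ℂ) + k) (n - k) /
      (k.factorial : ℂ) * (1 - Complex.exp (-2 * Complex.I * φ)) ^ k) a n)
  rw [zero_add] at h
  refine ⟨_, fun hφ => ?_, h⟩
  have h1 : (n.factorial : ℂ) ≠ 0 := by exact_mod_cast n.factorial_ne_zero
  rw [poch_neg_self, Nat.sub_self, poch_zero, mul_one, mul_div_cancel_right₀ _ h1]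
  refine mul_ne_zero (div_ne_zero (Complex.exp_ne_zero _) h1)
    (mul_ne_zero (mul_ne_zero (pow_ne_zero _ (by norm_num)) (pow_ne_zero _ ?_))
      (pow_ne_zero _ Complex.I_ne_zero))
  exact sub_ne_zero.2 hφ.symm

theorem continuousAt_eval_mpPoly {T : Type*} [TopologicalSpace T] {t₀ : T} {a : T → ℝ}
    (ha : ContinuousAt (fun t => (a t : ℂ)) t₀) (φ : ℝ) (n : ℕ) (z : ℂ) :
    ContinuousAt (fun t => (mpPoly (a t) φ n).eval z) t₀ := by
  simp only [mpPoly, eval_mul, eval_C, eval_finsetSum, eval_poch, eval_linPlus]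
  simp only [poch_eq_prod, div_eq_mul_inv]
  fun_prop

/-! ### Continuous Hahn -/

theorem diffOp_chPoly (a₁ a₂ : ℂ) (n : ℕ) :
    diffOp (linPlus a₁ * linPlus a₂) (linMinus (star a₁) * linMinus (star a₂)) (chPoly a₁ a₂ n) =
      (n * (n + chB a₁ a₂ - 1)) • chPoly a₁ a₂ n := by
  rw [chPoly, ← smul_eq_C_mul, map_smul, smul_comm _ (Complex.I ^ n / _)]
  congr 1
  refine eigen_of_recursion (lam := fun k => k * (k + chB a₁ a₂ - 1))
    (mu := fun k => (a₁ + star a₁ + k - 1) * (a₁ + star a₂ + k - 1)) (fun k => ?_) fun k hk => ?_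
  · rw [diffOp_poch_two, chB]
  · rw [poch_succ, poch_succ, poch_shift_succ _ hk, poch_shift_succ (a₁ + star a₂) hk,
      Nat.factorial_succ]
    have h1 : (k.factorial : ℂ) ≠ 0 := by exact_mod_cast k.factorial_ne_zero
    have h2 : (k + 1 : ℂ) ≠ 0 := by exact_mod_cast k.succ_ne_zero
    push_cast
    field_simp
    ring

theorem hasTop_chPoly (a₁ a₂ : ℂ) (n : ℕ) : HasTop (chPoly a₁ a₂ n) n (chLead a₁ a₂ n) := by
  have h := (hasTop_C (Complex.I ^ n / (n.factorial : ℂ))).mul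
    (hasTop_sum_poch (fun k => poch (-(n : ℂ)) k * poch ((n : ℂ) + chB a₁ a₂ - 1) k *
          poch (a₁ + star a₁ + k) (n - k) * poch (a₁ + star a₂ + k) (n - k) /
            (k.factorial : ℂ)) a₁ n)
  rw [zero_add, ← chPoly] at h
  convert h using 1
  have h1 : (n.factorial : ℂ) ≠ 0 := by exact_mod_cast n.factorial_ne_zero
  have h2 : Complex.I ^ n * Complex.I ^ n * (-1) ^ n = 1 := by
    rw [← mul_pow, ← mul_pow, Complex.I_mul_I]
    simp
  rw [poch_neg_self, Nat.sub_self, poch_zero, poch_zero, mul_one, mul_one, chLead]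
  field_simp
  linear_combination (-poch ((n : ℂ) + chB a₁ a₂ - 1) n) * h2

theorem continuousAt_eval_chPoly {T : Type*} [TopologicalSpace T] {t₀ : T} {a₁ a₂ : T → ℂ}
    (h₁ : ContinuousAt a₁ t₀) (h₂ : ContinuousAt a₂ t₀) (n : ℕ) (z : ℂ) :
    ContinuousAt (fun t => (chPoly (a₁ t) (a₂ t) n).eval z) t₀ := by
  simp only [chPoly, eval_mul, eval_C, eval_finsetSum, eval_poch, eval_linPlus]
  simp only [poch_eq_prod, chB, div_eq_mul_inv]
  fun_prop

theorem continuousAt_chLead {T : Type*} [TopologicalSpace T] {t₀ : T} {a₁ a₂ : T → ℂ}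
    (h₁ : ContinuousAt a₁ t₀) (h₂ : ContinuousAt a₂ t₀) (n : ℕ) :
    ContinuousAt (fun t => chLead (a₁ t) (a₂ t) n) t₀ := by
  simp only [chLead, poch_eq_prod, chB]
  fun_prop

-- Admissibility from leading coefficients

section Admissibility

theorem HasTop.natDegree_cast {f : ℂ[X]} {d : ℤ} {a : ℂ} (h : HasTop f d a) (ha : a ≠ 0) :
    f ≠ 0 ∧ (f.natDegree : ℤ) = d := by
  have hd : 0 ≤ d := by
    by_contra hd
    exact ha (h.2.2 (not_le.1 hd))
  lift d to ℕ using hd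
  refine ⟨?_, by rw [h.natDegree_eq ha]⟩
  rintro rfl
  exact ha ((h.2.1 d rfl).symm.trans (coeff_zero d))

theorem prod_sub_ne_zero {N : ℕ} {e : Fin N → ℂ} (he : Function.Injective e) :
    ∏ i, ∏ j ∈ Finset.Ioi i, (e j - e i) ≠ 0 :=
  Finset.prod_ne_zero_iff.2 fun _ _ => Finset.prod_ne_zero_iff.2 fun _ hj =>
    sub_ne_zero.2 (he.ne (Finset.mem_Ioi.1 hj).ne')

variable {ι : Type*} [Fintype ι] [DecidableEq ι] {c c' : ι → ℂ} {κ κ' : ℂ} {M : ℕ} {τ : Fin M → ι}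
  {ξ : Fin M → ℂ[X]} {E : Fin M → ℂ} {P : ℕ → ℂ[X]} {ev : ℕ → ℂ}

/-- The hypothesis `he` says that the Vandermonde nodes of `hasTop_casorati` are distinct. For
`fullDet`, `hn` separates the node of the added column from the others. -/
theorem natDegree_seedDet {d : Fin M → ℕ} {a : Fin M → ℂ} (h : ∀ k, HasTop (ξ k) (d k) (a k))
    (ha : ∀ k, a k ≠ 0) (he : Function.Injective fun k =>
      (d k : ℂ) + ∑ s ∈ Finset.univ.erase (τ k), (c s + c' s - 1)) :
    (seedMatrix c c' τ ξ).det ≠ 0 ∧ ((seedMatrix c c' τ ξ).det.natDegree : ℤ) =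
      ∑ k, (((Finset.univ.erase (τ k)).card : ℤ) * (M - 1 : ℕ) + d k) -
        ∑ i : Fin M, ((i : ℕ) : ℤ) := by
  rcases M with _ | m
  · simp
  obtain ⟨u, hu, h1⟩ := hasTop_casorati (c := c) (c' := c') (fun k => Finset.univ.erase (τ k)) h
  exact h1.natDegree_cast (mul_ne_zero (mul_ne_zero hu (Finset.prod_ne_zero_iff.2 fun k _ => ha k))
    (prod_sub_ne_zero (by simpa only [Int.cast_natCast] using he)))

theorem natDegree_fullDet {d : Fin M → ℕ} {a : Fin M → ℂ} (h : ∀ k, HasTop (ξ k) (d k) (a k))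
    (ha : ∀ k, a k ≠ 0) (he : Function.Injective fun k =>
      (d k : ℂ) + ∑ s ∈ Finset.univ.erase (τ k), (c s + c' s - 1)) {p : ℂ[X]} {n : ℕ} {b : ℂ}
    (hp : HasTop p n b) (hb : b ≠ 0) (hn : ∀ k, (n : ℂ) + ∑ s, (c s + c' s - 1) ≠
      d k + ∑ s ∈ Finset.univ.erase (τ k), (c s + c' s - 1)) :
    fullDet c c' τ ξ p ≠ 0 ∧ ((fullDet c c' τ ξ p).natDegree : ℤ) =
      ∑ k, (((Finset.univ.erase (τ k)).card : ℤ) * M + d k) + ((Fintype.card ι : ℤ) * M + n) -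
        ∑ i : Fin (M + 1), ((i : ℕ) : ℤ) := by
  obtain ⟨u, hu, h1⟩ := hasTop_casorati (c := c) (c' := c')
    (Fin.snoc (fun k => Finset.univ.erase (τ k)) Finset.univ : Fin (M + 1) → Finset ι)
    (f := Fin.snoc ξ p) (d := Fin.snoc (fun k => (d k : ℤ)) (n : ℤ))
    (a := (Fin.snoc a b : Fin (M + 1) → ℂ)) (fun k => by
      refine Fin.lastCases ?_ (fun k => ?_) k
      · simpa using hp
      · simpa using h k)
  have h2 := h1.natDegree_cast (mul_ne_zero (mul_ne_zero hu ?_) (prod_sub_ne_zero ?_))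
  · rw [fullDet_apply, fullMatrix_eq]
    refine ⟨h2.1, h2.2.trans ?_⟩
    congr 1
    rw [Fin.sum_univ_castSucc]
    simp
  · refine Finset.prod_ne_zero_iff.2 fun k _ => ?_
    refine Fin.lastCases ?_ (fun k => ?_) k
    · simpa using hb
    · simpa using ha k
  · intro k l
    refine Fin.lastCases ?_ (fun k => ?_) k <;> refine Fin.lastCases ?_ (fun l => ?_) l
    · exact fun _ => rfl
    · intro hkl
      simp only [Fin.snoc_last, Fin.snoc_castSucc, Int.cast_natCast] at hkl
      exact absurd hkl (hn l)
    · intro hkl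
      simp only [Fin.snoc_last, Fin.snoc_castSucc, Int.cast_natCast] at hkl
      exact absurd hkl.symm (hn k)
    · intro hkl
      simp only [Fin.snoc_castSucc, Int.cast_natCast] at hkl
      rw [he hkl]

theorem admissible_of_hasTop (hseed : ∀ k, IsSeed c c' κ κ' (τ k) (ξ k) (E k)) {d : Fin M → ℕ}
    {a : Fin M → ℂ} (h : ∀ k, HasTop (ξ k) (d k) (a k)) (ha : ∀ k, a k ≠ 0)
    (he : Function.Injective fun k =>
      (d k : ℂ) + ∑ s ∈ Finset.univ.erase (τ k), (c s + c' s - 1))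
    {b : ℕ → ℂ} (hP : ∀ n, HasTop (P n) n (b n)) (hb : ∀ n, b n ≠ 0)
    (hn : ∀ (n : ℕ) k, (n : ℂ) + ∑ s, (c s + c' s - 1) ≠
      d k + ∑ s ∈ Finset.univ.erase (τ k), (c s + c' s - 1))
    (heigen : ∀ n, diffOp (C κ * ∏ i, linPlus (c i)) (C κ' * ∏ i, linMinus (c' i)) (P n) =
      ev n • P n) (hev : ∀ n k, ev n ≠ E k) (hinj : Function.Injective ev) :
    Admissible c c' κ κ' τ ξ E P ev
      (∑ k, (((Finset.univ.erase (τ k)).card : ℤ) * M + d k) + (Fintype.card ι : ℤ) * M -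
        ∑ i : Fin (M + 1), ((i : ℕ) : ℤ)).toNat
      (∑ k, (((Finset.univ.erase (τ k)).card : ℤ) * (M - 1 : ℕ) + d k) -
        ∑ i : Fin M, ((i : ℕ) : ℤ)).toNat where
  seed := hseed
  degree_eq n := by
    have h1 := hP n
    rw [degree_eq_natDegree (h1.natDegree_cast (hb n)).1, h1.natDegree_eq (hb n)]
  eigen := heigen
  ev_ne := hev
  ev_inj := hinj
  natDegree_full n := by
    -- The case n = 0 shows that the integer under `toNat` is nonnegative, so nothing is truncated.
    have h1 := (natDegree_fullDet h ha he (hP n) (hb n) (hn n)).2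
    have h2 := (natDegree_fullDet h ha he (hP 0) (hb 0) (hn 0)).2
    push_cast at h2
    omega
  full_ne_zero n := (natDegree_fullDet h ha he (hP n) (hb n) (hn n)).1
  natDegree_seed := by
    have h1 := (natDegree_seedDet (c := c) (c' := c') (τ := τ) h ha he).2
    omega
  seed_ne_zero := (natDegree_seedDet h ha he).1

/-- A virtual state is an eigenpolynomial of the operator with twisted coefficients. The
off-diagonal parts are those of the seed equation, and the diagonal parts differ by the constant γ,
which shifts the eigenvalue. -/
theorem isSeed_of_diffOp {s : ι} {f Vt Vt' : ℂ[X]} {lam γ : ℂ}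
    (hV : Vt = -((C κ * ∏ i ∈ Finset.univ.erase s, linPlus (c i)) * linMinus (c' s - 1)))
    (hV' : Vt' = -((C κ' * ∏ i ∈ Finset.univ.erase s, linMinus (c' i)) * linPlus (c s - 1)))
    (hγ : Vt + Vt' - (C κ * ∏ i, linPlus (c i) + C κ' * ∏ i, linMinus (c' i)) = C γ)
    (h : diffOp Vt Vt' f = lam • f) : IsSeed c c' κ κ' s f (lam + γ) := by
  rw [diffOp_apply, smul_eq_C_mul] at h
  rw [IsSeed, C_add, ← hγ]
  linear_combination h + taylor (-Complex.I) f * (-hV) + taylor Complex.I f * (-hV')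

end Admissibility

/-! ### General position -/

/-- For nonzero `g` the coefficient in degree `deg g + 1` is i(κ + κ') times the leading
coefficient, so the left side cannot be constant. -/
theorem pearson_one {κ κ' : ℂ} (h : κ + κ' ≠ 0) (c c' : ℂ) (g : ℂ[X]) :
    (C κ * linPlus c) * taylor (-Complex.I) g - (C κ' * linMinus c') * g ≠ 1 := by
  intro h1
  have h2 := (((hasTop_C κ).mul (hasTop_linPlus c)).mul
    ((hasTop_natDegree g).taylor (-Complex.I))).add
    (((hasTop_C (-κ')).mul (hasTop_linMinus c')).mul (hasTop_natDegree g))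
  rw [C_neg, neg_mul, neg_mul, ← sub_eq_add_neg, h1] at h2
  have h3 := h2.2.1 (g.natDegree + 1) (by push_cast; ring)
  rw [coeff_one, if_neg (by omega)] at h3
  have h4 : Complex.I * (κ + κ') * g.leadingCoeff = 0 := by linear_combination -h3
  have h5 := (mul_eq_zero.1 h4).resolve_left (mul_ne_zero Complex.I_ne_zero h)
  rw [leadingCoeff_eq_zero.1 h5] at h1
  simp at h1

/-- Here the top terms cancel, and the coefficient in degree `deg g + 1` carries the factor c₁ + c₂
+ c₁' + c₂' + deg g. -/
theorem pearson_two {c₁ c₂ c₁' c₂' : ℂ} (h : ∀ n : ℤ, c₁ + c₂ + c₁' + c₂' ≠ n) (g : ℂ[X]) :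
    (linPlus c₁ * linPlus c₂) * taylor (-Complex.I) g - (linMinus c₁' * linMinus c₂') * g ≠ 1 := by
  intro h1
  have h0 := hasTopTwo_of_natDegree_le (le_refl g.natDegree)
  have h2 := ((((hasTopTwo_linPlus c₁).mul (hasTopTwo_linPlus c₂)).mul
    (h0.taylor (-Complex.I))).sub
    (((hasTopTwo_linMinus c₁').mul (hasTopTwo_linMinus c₂')).mul h0))
  have h3 := (h2.congr (a' := 0) (b' := Complex.I * (c₁ + c₂ + c₁' + c₂' + g.natDegree) *
    g.coeff g.natDegree) (by ring) (by
      linear_combination (-g.natDegree * Complex.I * g.coeff g.natDegree) * Complex.I_mul_I)).hasTop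
  rw [h1] at h3
  have h4 := h3.2.1 (g.natDegree + 1) (by push_cast; ring)
  rw [coeff_one, if_neg (by omega)] at h4
  have h6 : c₁ + c₂ + c₁' + c₂' + g.natDegree ≠ 0 := fun h0 =>
    h (-(g.natDegree : ℤ)) (by push_cast; linear_combination h0)
  have h5 := (mul_eq_zero.1 h4.symm).resolve_left (mul_ne_zero Complex.I_ne_zero h6)
  rw [coeff_natDegree] at h5
  rw [leadingCoeff_eq_zero.1 h5] at h1
  simp at h1

theorem countable_setOf_add_mul_eq_intCast {β : ℂ} (hβ : β ≠ 0) (α : ℂ) :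
    {t : ℝ | ∃ n : ℤ, α + β * t = n}.Countable := by
  have : {t : ℝ | ∃ n : ℤ, α + β * t = n} = ⋃ n : ℤ, {t : ℝ | α + β * t = n} := by
    ext t; simp
  rw [this]
  refine Set.countable_iUnion fun n => Set.Subsingleton.countable fun t ht t' ht' => ?_
  simp only [Set.mem_ofPred_eq] at ht ht'
  have h : β * (t - t') = 0 := by linear_combination ht - ht'
  exact Complex.ofReal_injective (sub_eq_zero.1 ((mul_eq_zero.1 h).resolve_left hβ))

theorem frequently_of_countable_compl {p : ℝ → Prop} (h : {t | ¬ p t}.Countable) (t₀ : ℝ) :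
    ∃ᶠ t in nhds t₀, p t := by
  have h1 := (h.dense_compl ℝ) t₀
  rw [mem_closure_iff_frequently] at h1
  exact h1.mono fun t ht => not_not.1 ht

/-! ### From the base coordinate to the centred one -/

theorem exists_recurrence_of_mem_span {R : ℕ → ℂ[X]} {Q : ℂ[X]} {L : ℕ}
    (h : ∀ n, Q * R n ∈ Submodule.span ℂ (R '' {k | n ≤ k + L ∧ k ≤ n + L})) :
    ∃ r : ℕ → ℤ → ℂ, ∀ n : ℕ, Q * R n =
      ∑ k ∈ Finset.Icc (-(L : ℤ)) (L : ℤ), C (r n k) * extendZero R ((n : ℤ) + k) := by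
  have h1 : ∀ n, ∃ a : ℕ → ℂ, ∑ k ∈ Finset.Icc (n - L) (n + L), a k • R k = Q * R n := by
    intro n
    have h2 : Q * R n ∈ Submodule.span ℂ (R '' (Finset.Icc (n - L) (n + L) : Finset ℕ)) := by
      convert h n using 3
      ext k
      simp only [Finset.coe_Icc, Set.mem_Icc, Set.mem_ofPred_eq]
      omega
    obtain ⟨a, ha⟩ := (Submodule.mem_span_image_finset_iff_exists_fun ℂ).1 h2
    refine ⟨fun k => if hk : k ∈ Finset.Icc (n - L) (n + L) then a ⟨k, hk⟩ else 0, ?_⟩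
    rw [← ha, ← Finset.sum_coe_sort]
    exact Finset.sum_congr rfl fun k _ => by simp only [dif_pos k.2]
  choose a ha using h1
  refine ⟨fun n k => a n (n + k).toNat, fun n => ?_⟩
  rw [← ha n]
  refine Finset.sum_of_injOn (fun k : ℕ => (k : ℤ) - n) (fun i _ j _ hij => ?_) (fun k hk => ?_)
    (fun k hk hk' => ?_) fun k _ => ?_
  · simp only at hij
    omega
  · simp only [Finset.coe_Icc, Set.mem_Icc] at hk ⊢
    omega
  · have : ¬ (0 : ℤ) ≤ n + k := by
      intro h0
      refine hk' ⟨(n + k).toNat, ?_, ?_⟩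
      · simp only [Finset.mem_Icc] at hk
        simp only [Finset.coe_Icc, Set.mem_Icc]
        omega
      · simp only
        omega
    rw [extendZero, if_neg this, mul_zero]
  · have e : (n : ℤ) + ((k : ℤ) - n) = k := by ring
    simp only [e, Int.toNat_natCast, extendZero, smul_eq_C_mul]
    rw [if_pos (by omega)]

theorem mem_span_of_map_mem_span {V : Type*} [AddCommGroup V] [Module ℂ V] {f : V →ₗ[ℂ] V}
    (hf : Function.Injective f) {κ : Type*} {s : Set κ} {w : κ → V} {v : V}
    (h : f v ∈ Submodule.span ℂ ((fun k => f (w k)) '' s)) : v ∈ Submodule.span ℂ (w '' s) := by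
  rw [← Set.image_image f w, ← Submodule.map_span] at h
  obtain ⟨x, hx, hxv⟩ := h
  rwa [← hf hxv]

/-- Recurrence relations in the base coordinate give those in the centred coordinate. -/
theorem recurrence_of_base {F : ℕ → ℂ[X]} {Ξ Ξc B Y Q : ℂ[X]} {R : ℕ → ℂ[X]} {u v r : ℂ}
    (hbase : ∀ Xb Yb : ℂ[X], Yb ≠ 0 → Xb - taylor Complex.I Xb = Ξ * Yb → ∀ n,
      Xb * F n ∈ Submodule.span ℂ (F '' {k | n ≤ k + Xb.natDegree ∧ k ≤ n + Xb.natDegree}))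
    (hΞ : Ξ ≠ 0) (hu : u ≠ 0) (hΞc : Ξc = C u * taylor r Ξ) (hB : B ≠ 0)
    (hR : ∀ n, R n * B = C v * taylor (r + Complex.I / 2) (F n)) (hY : Y ≠ 0)
    (hQ : Q = invDiff (Ξc * Y)) {L : ℕ} (hL : L = Ξ.natDegree + Y.natDegree + 1) :
    Q.natDegree = L ∧ ∃ r : ℕ → ℤ → ℂ, ∀ n : ℕ, Q * R n =
      ∑ k ∈ Finset.Icc (-(L : ℤ)) (L : ℤ), C (r n k) * extendZero R ((n : ℤ) + k) := by
  -- The determinant with one more row has its top node higher by i/2. Transporting `Q` from that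
  -- node turns its values at x ∓ i/2 into `Xb` at y and y + i, where y = x + r is the top node for
  -- `Ξ`.
  set Xb := taylor (-(r + Complex.I / 2)) Q with hXb
  set Yb := C (-Complex.I * u) * taylor (-r) Y with hYb
  have hYb0 : Yb ≠ 0 := mul_ne_zero (C_ne_zero.2 (mul_ne_zero (neg_ne_zero.2 Complex.I_ne_zero) hu))
    (fun h => hY ((taylor_eq_zero _ _).1 h))
  have hXb' : Xb - taylor Complex.I Xb = Ξ * Yb := by
    have h1 := congrArg (taylor (-r)) (invDiff_spec (Ξc * Y))
    rw [← hQ, sub_eq_add_neg X, ← C_neg, ← taylor_apply, ← taylor_apply, map_sub, taylor_taylor,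
      taylor_taylor, taylor_mul, taylor_mul, taylor_C, hΞc, taylor_mul, taylor_C, taylor_taylor,
      neg_add_cancel, taylor_zero] at h1
    rw [hXb, taylor_taylor, hYb, show -(r + Complex.I / 2) = -r + -(Complex.I / 2) by ring,
      show Complex.I + (-r + -(Complex.I / 2)) = -r + Complex.I / 2 by ring, h1, C_mul]
    ring
  have hdeg : Xb.natDegree = L := by
    rw [natDegree_of_sub_taylor_eq (mul_ne_zero hΞ hYb0) hXb', natDegree_mul hΞ hYb0, hYb,
      natDegree_C_mul (mul_ne_zero (neg_ne_zero.2 Complex.I_ne_zero) hu), natDegree_taylor, hL]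
  refine ⟨by rw [← hdeg, hXb, natDegree_taylor], exists_recurrence_of_mem_span fun n => ?_⟩
  have h2 := hbase Xb Yb hYb0 hXb' n
  rw [hdeg] at h2
  refine mem_span_of_map_mem_span (f := LinearMap.mulRight ℂ B) (fun p q h => ?_) ?_
  · exact mul_right_cancel₀ hB h
  let ψ : ℂ[X] →ₗ[ℂ] ℂ[X] := (LinearMap.mulLeft ℂ (C v)).comp (taylor (r + Complex.I / 2))
  have h3 := Submodule.mem_map_of_mem (f := ψ) h2
  rw [Submodule.map_span, Set.image_image] at h3
  convert h3 using 1
  · simp only [LinearMap.mulRight_apply, ψ, LinearMap.comp_apply, LinearMap.mulLeft_apply, hR]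
  · simp only [LinearMap.mulRight_apply, ψ, LinearMap.comp_apply, LinearMap.mulLeft_apply]
    rw [mul_assoc, hR, taylor_mul, hXb, taylor_taylor, add_neg_cancel, taylor_zero]
    ring

theorem taylor_poch_linPlus (r c : ℂ) (k : ℕ) :
    taylor r (poch (linPlus c) k) = poch (linPlus (c + Complex.I * r)) k := by
  have h : taylor r (linPlus c) = linPlus (c + Complex.I * r) := by
    simp only [linPlus, map_add, taylor_mul, taylor_C, taylor_X, mul_add, ← C_mul]
    ring
  rw [← h]
  exact map_poch (taylorAlgHom r).toRingHom (linPlus c) k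

theorem taylor_poch_linMinus (r c : ℂ) (k : ℕ) :
    taylor r (poch (linMinus c) k) = poch (linMinus (c - Complex.I * r)) k := by
  have h : taylor r (linMinus c) = linMinus (c - Complex.I * r) := by
    simp only [linMinus, map_sub, taylor_mul, taylor_C, taylor_X, mul_add, ← C_mul]
    ring
  rw [← h]
  exact map_poch (taylorAlgHom r).toRingHom (linMinus c) k

theorem comp_node (f : ℂ[X]) (N : ℕ) (j : Fin N) :
    f.comp (node N j) =
      taylor (Complex.I * ((N : ℂ) - 1) / 2) (taylor (-(Complex.I * (j : ℕ))) f) := by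
  rw [taylor_taylor, taylor_apply, node]
  congr 3
  ring

theorem rFun_eq (c : ℂ) (N : ℕ) (j : Fin N) : rFun c N j = C (Complex.I ^ (1 - (N : ℤ))) *
    taylor (Complex.I * ((N : ℂ) - 1) / 2) (gaugeFactor c (star c) (N - 1) j) := by
  have hN : ((N - 1 : ℕ) : ℂ) = N - 1 := by
    have := j.2
    rw [Nat.cast_sub (by omega), Nat.cast_one]
  rw [rFun, gaugeFactor, taylor_mul, taylor_mul, taylor_C, taylor_poch_linPlus,
    taylor_poch_linMinus, hN, C_mul,
    show c + Complex.I * (Complex.I * ((N : ℂ) - 1) / 2) = c - ((N : ℂ) - 1) / 2 by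
      linear_combination (((N : ℂ) - 1) / 2) * Complex.I_mul_I,
    show star c - ((N : ℂ) - 1) - Complex.I * (Complex.I * ((N : ℂ) - 1) / 2) =
        star c - ((N : ℂ) - 1) / 2 by
      linear_combination (-((N : ℂ) - 1) / 2) * Complex.I_mul_I]
  ring

theorem det_C_mul_taylor {N : ℕ} (A : Matrix (Fin N) (Fin N) ℂ[X]) (u : Fin N → ℂ) (r : ℂ) :
    (Matrix.of fun j k => C (u k) * taylor r (A j k)).det = C (∏ k, u k) * taylor r A.det := by
  have h : taylor r A.det = (Matrix.of fun j k => taylor r (A j k)).det :=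
    (taylorAlgHom r).toRingHom.map_det A
  rw [h, map_prod, ← Matrix.det_mul_row]
  rfl

theorem prod_range_eq_prod_Icc {f : ℕ → ℂ[X]} (hf : f 0 = 1) (m : ℕ) :
    ∏ r ∈ Finset.range m, f r = ∏ r ∈ Finset.Icc 1 (m - 1), f r := by
  rcases m with _ | m
  · simp
  rw [Finset.prod_range_succ', hf, mul_one, Nat.add_sub_cancel, Finset.range_eq_Ico,
    Finset.prod_Ico_add' f 0 m 1]
  rfl

/-! ### Multi-indexed Meixner–Pollaczek polynomials -/

theorem isSeed_mpXiV (a φ : ℝ) (v : ℕ) :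
    IsSeed (fun _ : Unit => (a : ℂ)) (fun _ => (a : ℂ)) (-Complex.exp (-2 * Complex.I * φ)) 1 ()
      (mpXiV a φ v) ((1 - Complex.exp (-2 * Complex.I * φ)) * (v + 1 - 2 * a)) := by
  have h := diffOp_mpPoly (1 - a) φ v
  have h1 := isSeed_of_diffOp (c := fun _ : Unit => (a : ℂ)) (c' := fun _ => (a : ℂ))
    (κ := -Complex.exp (-2 * Complex.I * φ)) (κ' := 1) (s := ())
    (γ := (1 - Complex.exp (-2 * Complex.I * φ)) * (1 - (a + a))) ?_ ?_ ?_ h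
  · rw [mpXiV]
    convert h1 using 1
    ring
  · simp [linPlus, linMinus]
    ring
  · simp [linPlus, linMinus]
    ring
  · simp [linPlus, linMinus]
    ring

theorem admissible_mp {a φ : ℝ} (hφ : Complex.exp (-2 * Complex.I * φ) ≠ 1) {M : ℕ}
    {d : Fin M → ℕ} (hd : Function.Injective d) (hlt : ∀ j, (d j : ℝ) < 2 * a - 1) :
    Admissible (fun _ : Unit => (a : ℂ)) (fun _ => (a : ℂ)) (-Complex.exp (-2 * Complex.I * φ)) 1
      (fun _ => ()) (fun k => mpXiV a φ (d k))
      (fun k => (1 - Complex.exp (-2 * Complex.I * φ)) * (d k + 1 - 2 * a)) (mpPoly a φ)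
      (fun n => n * (1 - Complex.exp (-2 * Complex.I * φ)))
      (∑ k, (((Finset.univ.erase ((fun _ => ()) k : Unit)).card : ℤ) * M + d k) +
        (Fintype.card Unit : ℤ) * M - ∑ i : Fin (M + 1), ((i : ℕ) : ℤ)).toNat
      (∑ k, (((Finset.univ.erase ((fun _ => ()) k : Unit)).card : ℤ) * (M - 1 : ℕ) + d k) -
        ∑ i : Fin M, ((i : ℕ) : ℤ)).toNat := by
  have hω : 1 - Complex.exp (-2 * Complex.I * φ) ≠ 0 := sub_ne_zero.2 hφ.symm
  have hpos : ∀ (n : ℕ) k, (n : ℂ) + 2 * a - 1 - d k ≠ 0 := by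
    intro n k h
    have h1 : ((n + 2 * a - 1 - d k : ℝ) : ℂ) = 0 := by push_cast; exact h
    have h2 : (n : ℝ) + 2 * a - 1 - d k = 0 := by exact_mod_cast h1
    have h3 := hlt k
    have h4 : (0 : ℝ) ≤ n := n.cast_nonneg
    linarith
  choose u hu hu' using fun k => hasTop_mpPoly (1 - a) φ (d k)
  choose b hb hb' using hasTop_mpPoly a φ
  refine admissible_of_hasTop (fun k => isSeed_mpXiV a φ (d k)) hu' (fun k => hu k hφ) ?_
    hb' (fun n => hb n hφ) ?_ ?_ ?_ ?_
  · intro k l h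
    simpa using hd (by simpa using h)
  · intro n k h
    refine hpos n k ?_
    simp at h
    linear_combination h
  · intro n
    simpa using diffOp_mpPoly a φ n
  · intro n k h
    refine mul_ne_zero hω (hpos n k) ?_
    linear_combination h
  · intro n m h
    exact_mod_cast mul_right_cancel₀ hω h

theorem mem_span_mp {a φ : ℝ} (hφ : Complex.exp (-2 * Complex.I * φ) ≠ 1) {M : ℕ}
    {d : Fin M → ℕ} (hd : Function.Injective d) (hlt : ∀ j, (d j : ℝ) < 2 * a - 1)
    {Xb Yb : ℂ[X]} (hY : Yb ≠ 0) (hX : Xb - taylor Complex.I Xb =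
      (seedMatrix (fun _ : Unit => (a : ℂ)) (fun _ => (a : ℂ)) (fun _ => ())
        (fun k => mpXiV a φ (d k))).det * Yb) (n : ℕ) :
    Xb * fullDet (fun _ : Unit => (a : ℂ)) (fun _ => (a : ℂ)) (fun _ => ())
        (fun k => mpXiV a φ (d k)) (mpPoly a φ n) ∈
      Submodule.span ℂ ((fun n => fullDet (fun _ : Unit => (a : ℂ)) (fun _ => (a : ℂ)) (fun _ => ())
        (fun k => mpXiV a φ (d k)) (mpPoly a φ n)) ''
          {k | n ≤ k + Xb.natDegree ∧ k ≤ n + Xb.natDegree}) := by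
  have hofReal : ContinuousAt (fun t : ℝ => (t : ℂ)) a := Complex.continuous_ofReal.continuousAt
  have h1 : ∀ᶠ t : ℝ in nhds a, ∀ j, (d j : ℝ) < 2 * t - 1 := by
    rw [Filter.eventually_all]
    intro j
    have hc : ContinuousAt (fun t : ℝ => 2 * t - 1) a := by fun_prop
    exact hc.eventually (lt_mem_nhds (hlt j))
  refine mul_mem_span_of_frequently_generic (t₀ := a) (c := fun (t : ℝ) (_ : Unit) => (t : ℂ))
    (c' := fun (t : ℝ) (_ : Unit) => (t : ℂ)) (ξ := fun t k => mpXiV t φ (d k))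
    (P := fun t n => mpPoly t φ n) (fun _ => hofReal) (fun _ => hofReal) ?_
    (fun n z => continuousAt_eval_mpPoly hofReal φ n z) (κ := -Complex.exp (-2 * Complex.I * φ))
    (κ' := 1) (h1.mono fun t ht => admissible_mp hφ hd ht) ?_
    (neg_ne_zero.2 (Complex.exp_ne_zero _)) one_ne_zero hY ?_ hX n
  · intro k z
    refine continuousAt_eval_mpPoly (a := fun t => 1 - t) ?_ φ (d k) z
    push_cast
    exact continuousAt_const.sub hofReal
  -- Along the real parameter general position fails only when 2t is an integer.
  · refine frequently_of_countable_compl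
      ((countable_setOf_add_mul_eq_intCast two_ne_zero 0).mono fun t ht => ?_) a
    by_contra hn
    refine ht ⟨fun s s' n h => hn ⟨n, ?_⟩, fun g => ?_⟩
    · linear_combination h
    · simpa using pearson_one (κ := -Complex.exp (-2 * Complex.I * φ)) (κ' := 1)
        (by rw [neg_add_eq_sub]; exact sub_ne_zero.2 hφ.symm) (t : ℂ) (t - (M - 1 : ℕ)) g
  · simp [seedDenom, gaugeDenom]

theorem mpDenom_eq (a φ : ℝ) {M : ℕ} (d : Fin M → ℕ) :
    mpDenom a φ d = C (Complex.I ^ (M * (M - 1) / 2)) * taylor (Complex.I * ((M : ℂ) - 1) / 2)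
      (seedMatrix (fun _ : Unit => (a : ℂ)) (fun _ => (a : ℂ)) (fun _ => ())
        (fun k => mpXiV a φ (d k))).det := by
  rw [mpDenom]
  congr 1
  have := det_C_mul_taylor (seedMatrix (fun _ : Unit => (a : ℂ)) (fun _ => (a : ℂ)) (fun _ => ())
    (fun k => mpXiV a φ (d k))) (fun _ => 1) (Complex.I * ((M : ℂ) - 1) / 2)
  rw [Finset.prod_const_one, C_1, one_mul] at this
  rw [← this]
  congr 1
  ext j k : 2
  simp [seedMatrix, comp_node, entry, colFactor]

theorem mpMulti_eq (a φ : ℝ) {M : ℕ} (d : Fin M → ℕ) : ∃ v : ℂ, ∀ n, mpMulti a φ d n =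
    C v * taylor (Complex.I * ((M : ℂ) - 1) / 2 + Complex.I / 2)
      (fullDet (fun _ : Unit => (a : ℂ)) (fun _ => (a : ℂ)) (fun _ => ())
        (fun k => mpXiV a φ (d k)) (mpPoly a φ n)) := by
  refine ⟨Complex.I ^ (M * (M + 1) / 2) * ∏ k, (Fin.snoc (fun _ => 1)
    (Complex.I ^ (1 - ((M + 1 : ℕ) : ℤ))) : Fin (M + 1) → ℂ) k, fun n => ?_⟩
  rw [mpMulti, C_mul, mul_assoc, fullDet_apply, ← det_C_mul_taylor]
  congr 2
  have e : Complex.I * ((M : ℂ) - 1) / 2 + Complex.I / 2 =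
      Complex.I * (((M + 1 : ℕ) : ℂ) - 1) / 2 := by push_cast; ring
  rw [e]
  ext j k : 2
  refine Fin.lastCases ?_ (fun k => ?_) k
  · simp only [Matrix.of_apply, Fin.snoc_last, fullMatrix, rFun_eq, comp_node, entry, taylor_mul,
      colFactor, Finset.univ_unique, Finset.prod_singleton, Nat.add_sub_cancel]
    simp only [Complex.star_def, Complex.conj_ofReal]
    rw [mul_assoc]
  · simp [fullMatrix, comp_node, entry, colFactor]

/-- The recurrence relations of the multi-indexed Meixner–Pollaczek polynomials. -/
theorem mp_recurrence {a φ : ℝ} (h0 : 0 < φ) (hπ : φ < Real.pi) {M : ℕ} {d : Fin M → ℕ}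
    (hd : Function.Injective d) (hlt : ∀ j, (d j : ℝ) < 2 * a - 1) {Y : ℂ[X]} (hY : Y ≠ 0)
    {Q : ℂ[X]} (hQ : Q = invDiff (mpDenom a φ d * Y)) {L : ℕ}
    (hL : L = mpEll d + Y.natDegree + 1) :
    Q.natDegree = L ∧ ∃ r : ℕ → ℤ → ℂ, ∀ n : ℕ, Q * mpMulti a φ d n =
      ∑ k ∈ Finset.Icc (-(L : ℤ)) (L : ℤ),
        C (r n k) * extendZero (mpMulti a φ d) ((n : ℤ) + k) := by
  have hφ : Complex.exp (-2 * Complex.I * φ) ≠ 1 := by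
    rw [Ne, Complex.exp_eq_one_iff]
    rintro ⟨n, hn⟩
    have h1 : (-φ : ℂ) = n * Real.pi := by
      have h2 : (2 * Complex.I) ≠ 0 := mul_ne_zero two_ne_zero Complex.I_ne_zero
      apply mul_left_cancel₀ h2
      linear_combination hn
    have h3 : -φ = n * Real.pi := by exact_mod_cast h1
    have h4 : (n : ℝ) < 0 := by
      by_contra h
      have := mul_nonneg (not_lt.1 h) Real.pi_pos.le
      linarith
    have h5 : (-1 : ℝ) < n := by
      by_contra h
      have := mul_le_mul_of_nonneg_right (not_lt.1 h) Real.pi_pos.le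
      linarith
    have h6 : n < 0 := by exact_mod_cast h4
    have h7 : -1 < n := by exact_mod_cast h5
    omega
  obtain ⟨v, hv⟩ := mpMulti_eq a φ d
  have hadm := admissible_mp hφ hd hlt
  refine recurrence_of_base (B := 1) (fun Xb Yb hY hX n => mem_span_mp hφ hd hlt hY hX n)
    hadm.seed_ne_zero (pow_ne_zero _ Complex.I_ne_zero) (mpDenom_eq a φ d) one_ne_zero
    (fun n => by rw [mul_one, hv]) hY hQ ?_
  rw [hL, hadm.natDegree_seed, mpEll]
  congr 2
  have h1 : ∑ i : Fin M, (i : ℕ) = M * (M - 1) / 2 := by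
    rw [Fin.sum_univ_eq_sum_range (fun i => i) M, Finset.sum_range_id]
  rw [← h1]
  simp only [Finset.card_erase_of_mem (Finset.mem_univ _), Finset.card_univ, Fintype.card_unit]
  zify
  push_cast
  simp
  have h2 : ∑ i : Fin M, ((i : ℕ) : ℤ) = ((∑ i : Fin M, (i : ℕ) : ℕ) : ℤ) := by push_cast; rfl
  have h3 : ∑ i : Fin M, ((d i : ℕ) : ℤ) = ((∑ i : Fin M, d i : ℕ) : ℤ) := by push_cast; rfl
  omega

/-! ### Multi-indexed continuous Hahn polynomials -/

theorem isSeed_chXiI (a₁ a₂ : ℂ) (v : ℕ) :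
    IsSeed ![a₁, a₂] ![star a₁, star a₂] 1 1 0 (chXiI a₁ a₂ v)
      ((v + (a₂ + star a₂)) * (v + 1 - (a₁ + star a₁))) := by
  have he : Finset.univ.erase (0 : Fin 2) = {1} := by decide
  have h1 := isSeed_of_diffOp (c := ![a₁, a₂]) (c' := ![star a₁, star a₂]) (κ := 1) (κ' := 1)
    (s := 0) (γ := (a₂ + star a₂) * (1 - (a₁ + star a₁))) ?_ ?_ ?_
    (diffOp_chPoly (1 - star a₁) a₂ v)
  · rw [chXiI]
    convert h1 using 1
    simp only [chB, star_sub, star_one, star_star]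
    ring
  · rw [he]
    simp [linPlus, linMinus]
    ring
  · rw [he]
    simp [linPlus, linMinus]
    ring
  · rw [Fin.prod_univ_two, Fin.prod_univ_two]
    simp [linPlus, linMinus]
    ring

theorem isSeed_chXiII (a₁ a₂ : ℂ) (v : ℕ) :
    IsSeed ![a₁, a₂] ![star a₁, star a₂] 1 1 1 (chXiII a₁ a₂ v)
      ((v + (a₁ + star a₁)) * (v + 1 - (a₂ + star a₂))) := by
  have he : Finset.univ.erase (1 : Fin 2) = {0} := by decide
  have h1 := isSeed_of_diffOp (c := ![a₁, a₂]) (c' := ![star a₁, star a₂]) (κ := 1) (κ' := 1)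
    (s := 1) (γ := (a₁ + star a₁) * (1 - (a₂ + star a₂))) ?_ ?_ ?_
    (diffOp_chPoly a₁ (1 - star a₂) v)
  · rw [chXiII]
    convert h1 using 1
    simp only [chB, star_sub, star_one, star_star]
    ring
  · rw [he]
    simp [linPlus, linMinus]
    ring
  · rw [he]
    simp [linPlus, linMinus]
    ring
  · rw [Fin.prod_univ_two, Fin.prod_univ_two]
    simp [linPlus, linMinus]
    ring

/-- The types of the seeds: `0` for type I and `1` for type II. -/
def chType (M₁ M₂ : ℕ) : Fin (M₁ + M₂) → Fin 2 := Fin.append (fun _ => 0) (fun _ => 1)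

/-- The seed polynomials. -/
def chSeed (a₁ a₂ : ℂ) {M₁ M₂ : ℕ} (d₁ : Fin M₁ → ℕ) (d₂ : Fin M₂ → ℕ) : Fin (M₁ + M₂) → ℂ[X] :=
  Fin.append (fun k => chXiI a₁ a₂ (d₁ k)) (fun k => chXiII a₁ a₂ (d₂ k))

/-- The eigenvalues of the seed polynomials. -/
def chSeedEigenvalue (a₁ a₂ : ℂ) {M₁ M₂ : ℕ} (d₁ : Fin M₁ → ℕ) (d₂ : Fin M₂ → ℕ) :
    Fin (M₁ + M₂) → ℂ :=
  Fin.append (fun k => (d₁ k + (a₂ + star a₂)) * (d₁ k + 1 - (a₁ + star a₁)))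
    (fun k => (d₂ k + (a₁ + star a₁)) * (d₂ k + 1 - (a₂ + star a₂)))

/-- These are the Vandermonde nodes. Differences between the two types are, up to sign, the mixed
factors of the constant `chDenomLead`. -/
theorem sum_erase_chType (a₁ a₂ : ℂ) {M₁ M₂ : ℕ} (d₁ : Fin M₁ → ℕ) (d₂ : Fin M₂ → ℕ)
    (k : Fin (M₁ + M₂)) :
    ((Fin.append d₁ d₂ k : ℕ) : ℂ) + ∑ s ∈ Finset.univ.erase (chType M₁ M₂ k),
      (![a₁, a₂] s + ![star a₁, star a₂] s - 1) =
    Fin.append (fun k => (d₁ k : ℂ) + (a₂ + star a₂ - 1))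
      (fun k => d₂ k + (a₁ + star a₁ - 1)) k := by
  refine Fin.addCases (fun k => ?_) (fun k => ?_) k
  · simp [chType, show Finset.univ.erase (0 : Fin 2) = {1} by decide]
  · simp [chType, show Finset.univ.erase (1 : Fin 2) = {0} by decide]

theorem ne_zero_of_re_pos {z : ℂ} (h : 0 < z.re) : z ≠ 0 := by
  rintro rfl
  simp at h

theorem chLead_ne_zero {a₁ a₂ : ℂ} (h₁ : 0 < a₁.re) (h₂ : 0 < a₂.re) (n : ℕ) :
    chLead a₁ a₂ n ≠ 0 := by
  rw [chLead, poch_eq_prod]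
  refine div_ne_zero (Finset.prod_ne_zero_iff.2 fun r hr => ne_zero_of_re_pos ?_)
    (by exact_mod_cast n.factorial_ne_zero)
  have h3 : (1 : ℝ) ≤ n := by
    have := Finset.mem_range.1 hr
    exact_mod_cast (by omega : 1 ≤ n)
  have h4 : (0 : ℝ) ≤ r := r.cast_nonneg
  simp [chB]
  linarith

theorem factors_ne_zero_of_chDenomLead_ne_zero {a₁ a₂ : ℂ} {M₁ M₂ : ℕ} {d₁ : Fin M₁ → ℕ}
    {d₂ : Fin M₂ → ℕ} (h : chDenomLead a₁ a₂ d₁ d₂ ≠ 0) :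
    (∀ j, chLead (1 - star a₁) a₂ (d₁ j) ≠ 0) ∧
      (∀ j, chLead a₁ (1 - star a₂) (d₂ j) ≠ 0) ∧
      ∀ j k, -a₂ - star a₂ - d₁ j + a₁ + star a₁ + d₂ k ≠ 0 := by
  simp only [chDenomLead, mul_ne_zero_iff, Finset.prod_ne_zero_iff, Finset.mem_univ,
    forall_true_left] at h
  exact ⟨h.1.1.1.1, h.1.1.1.2, h.2⟩

/-- The assumptions on the parameters of the multi-indexed continuous Hahn polynomials. -/
structure ChAssumptions (a₁ a₂ : ℂ) {M₁ M₂ : ℕ} (d₁ : Fin M₁ → ℕ) (d₂ : Fin M₂ → ℕ) : Prop where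
  re_pos₁ : 0 < a₁.re
  re_pos₂ : 0 < a₂.re
  lt₁ : ∀ j, (d₁ j : ℝ) < 2 * a₁.re - 1
  lt₂ : ∀ j, (d₂ j : ℝ) < 2 * a₂.re - 1
  lead_ne_zero : chDenomLead a₁ a₂ d₁ d₂ ≠ 0

section Fixed

variable {a₁ a₂ : ℂ} {M₁ M₂ : ℕ} {d₁ : Fin M₁ → ℕ} {d₂ : Fin M₂ → ℕ}

theorem admissible_ch (hd₁ : Function.Injective d₁) (hd₂ : Function.Injective d₂)
    (h : ChAssumptions a₁ a₂ d₁ d₂) :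
    Admissible ![a₁, a₂] ![star a₁, star a₂] 1 1 (chType M₁ M₂) (chSeed a₁ a₂ d₁ d₂)
      (chSeedEigenvalue a₁ a₂ d₁ d₂) (chPoly a₁ a₂) (fun n => n * (n + chB a₁ a₂ - 1))
      (∑ k, (((Finset.univ.erase (chType M₁ M₂ k)).card : ℤ) * (M₁ + M₂ : ℕ) +
        (Fin.append d₁ d₂ k : ℕ)) + (Fintype.card (Fin 2) : ℤ) * (M₁ + M₂ : ℕ) -
        ∑ i : Fin (M₁ + M₂ + 1), ((i : ℕ) : ℤ)).toNat
      (∑ k, (((Finset.univ.erase (chType M₁ M₂ k)).card : ℤ) * (M₁ + M₂ - 1 : ℕ) +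
        (Fin.append d₁ d₂ k : ℕ)) - ∑ i : Fin (M₁ + M₂), ((i : ℕ) : ℤ)).toNat := by
  obtain ⟨hI, hII, hX⟩ := factors_ne_zero_of_chDenomLead_ne_zero h.lead_ne_zero
  have hp₁ : ∀ (n : ℕ) k, (n : ℂ) + (a₁ + star a₁) - 1 - d₁ k ≠ 0 := fun n k =>
    ne_zero_of_re_pos (by
      have h1 := h.lt₁ k
      have h2 : (0 : ℝ) ≤ n := n.cast_nonneg
      simp
      linarith)
  have hp₂ : ∀ (n : ℕ) k, (n : ℂ) + (a₂ + star a₂) - 1 - d₂ k ≠ 0 := fun n k =>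
    ne_zero_of_re_pos (by
      have h1 := h.lt₂ k
      have h2 : (0 : ℝ) ≤ n := n.cast_nonneg
      simp
      linarith)
  have hq₁ : ∀ n m : ℕ, (n : ℂ) + (a₁ + star a₁) + m ≠ 0 := fun n m =>
    ne_zero_of_re_pos (by
      have h1 := h.re_pos₁
      have h2 : (0 : ℝ) ≤ n := n.cast_nonneg
      have h3 : (0 : ℝ) ≤ m := m.cast_nonneg
      simp
      linarith)
  have hq₂ : ∀ n m : ℕ, (n : ℂ) + (a₂ + star a₂) + m ≠ 0 := fun n m =>
    ne_zero_of_re_pos (by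
      have h1 := h.re_pos₂
      have h2 : (0 : ℝ) ≤ n := n.cast_nonneg
      have h3 : (0 : ℝ) ≤ m := m.cast_nonneg
      simp
      linarith)
  refine admissible_of_hasTop (d := Fin.append d₁ d₂)
    (a := Fin.append (fun k => chLead (1 - star a₁) a₂ (d₁ k))
      (fun k => chLead a₁ (1 - star a₂) (d₂ k))) (fun k => ?_) (fun k => ?_) (fun k => ?_) ?_
    (fun n => hasTop_chPoly a₁ a₂ n) (fun n => chLead_ne_zero h.re_pos₁ h.re_pos₂ n)
    (fun n k => ?_) (fun n => ?_) (fun n k => ?_) (fun n m hnm => ?_)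
  · refine Fin.addCases (fun k => ?_) (fun k => ?_) k
    · simpa [chType, chSeed, chSeedEigenvalue] using isSeed_chXiI a₁ a₂ (d₁ k)
    · simpa [chType, chSeed, chSeedEigenvalue] using isSeed_chXiII a₁ a₂ (d₂ k)
  · refine Fin.addCases (fun k => ?_) (fun k => ?_) k
    · simpa [chSeed, chXiI] using hasTop_chPoly (1 - star a₁) a₂ (d₁ k)
    · simpa [chSeed, chXiII] using hasTop_chPoly a₁ (1 - star a₂) (d₂ k)
  · refine Fin.addCases (fun k => ?_) (fun k => ?_) k
    · simpa using hI k
    · simpa using hII k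
  · simp only [sum_erase_chType]
    intro k l
    refine Fin.addCases (fun k => ?_) (fun k => ?_) k <;>
      refine Fin.addCases (fun l => ?_) (fun l => ?_) l <;>
      simp only [Fin.append_left, Fin.append_right] <;> intro hkl
    · rw [hd₁ (Nat.cast_injective (R := ℂ) (add_right_cancel hkl))]
    · exact absurd (by linear_combination -hkl) (hX k l)
    · exact absurd (by linear_combination hkl) (hX l k)
    · rw [hd₂ (Nat.cast_injective (R := ℂ) (add_right_cancel hkl))]
  · rw [sum_erase_chType, Fin.sum_univ_two]
    refine Fin.addCases (fun k => ?_) (fun k => ?_) k <;>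
      simp only [Fin.append_left, Fin.append_right, Matrix.cons_val_zero, Matrix.cons_val_one] <;>
      intro hnk
    · exact hp₁ n k (by linear_combination hnk)
    · exact hp₂ n k (by linear_combination hnk)
  · simpa [Fin.prod_univ_two] using diffOp_chPoly a₁ a₂ n
  -- For type I the difference of eigenvalues factors as (n + a₂ + a₂* + d)(n + a₁ + a₁* - 1 - d),
  -- and for type II with the indices exchanged. The bounds on `d` make the real part of the second
  -- factor positive.
  · refine Fin.addCases (fun k => ?_) (fun k => ?_) k <;>
      simp only [chSeedEigenvalue, Fin.append_left, Fin.append_right, chB] <;> intro hnk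
    · exact mul_ne_zero (hq₂ n (d₁ k)) (hp₁ n k) (by linear_combination hnk)
    · exact mul_ne_zero (hq₁ n (d₂ k)) (hp₂ n k) (by linear_combination hnk)
  · by_contra hne
    have h1 : ((n : ℂ) - m) * (n + m + chB a₁ a₂ - 1) = 0 := by linear_combination hnm
    refine (mul_ne_zero (sub_ne_zero.2 (Nat.cast_injective.ne hne)) (ne_zero_of_re_pos ?_)) h1
    have h2 : (1 : ℝ) ≤ n + m := by exact_mod_cast (by omega : 1 ≤ n + m)
    have h3 := h.re_pos₁
    have h4 := h.re_pos₂
    simp [chB]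
    linarith

end Fixed

theorem generic_ch {a₁ a₂ : ℂ} (M : ℕ) (h : ∀ s s' (n : ℤ),
    (![a₁, a₂] : Fin 2 → ℂ) s + (![star a₁, star a₂] : Fin 2 → ℂ) s' ≠ n)
    (hb : ∀ n : ℤ, a₁ + a₂ + star a₁ + star a₂ ≠ n) :
    Generic ![a₁, a₂] ![star a₁, star a₂] 1 1 M := by
  refine ⟨h, fun g => ?_⟩
  have := pearson_two (c₁ := a₁) (c₂ := a₂) (c₁' := star a₁ - (M - 1 : ℕ))
    (c₂' := star a₂ - (M - 1 : ℕ)) (fun n h0 => hb (n + 2 * (M - 1 : ℕ))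
      (by push_cast; linear_combination h0)) g
  simpa [Fin.prod_univ_two] using this

theorem frequently_generic_ch (a₁ a₂ : ℂ) (M : ℕ) : ∃ᶠ p : ℂ × ℂ in nhds (a₁, a₂),
    Generic ![p.1, p.2] ![star p.1, star p.2] 1 1 M := by
  -- Along this line every sum that must avoid the integers has slope 2, 3, 4 or 6 in t, so only
  -- countably many t are exceptional.
  have hc : Filter.Tendsto (fun t : ℝ => (a₁ + t, a₂ + 2 * t)) (nhds 0) (nhds (a₁, a₂)) := by
    have h1 : Continuous fun t : ℝ => (a₁ + (t : ℂ), a₂ + 2 * (t : ℂ)) := by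
      have := Complex.continuous_ofReal
      fun_prop
    simpa using h1.tendsto 0
  refine hc.frequently (frequently_of_countable_compl ?_ 0)
  have hcount := ((((countable_setOf_add_mul_eq_intCast (β := 2) (by norm_num) (a₁ + star a₁)).union
    (countable_setOf_add_mul_eq_intCast (β := 3) (by norm_num) (a₁ + star a₂))).union
    (countable_setOf_add_mul_eq_intCast (β := 3) (by norm_num) (a₂ + star a₁))).union
    (countable_setOf_add_mul_eq_intCast (β := 4) (by norm_num) (a₂ + star a₂))).union
    (countable_setOf_add_mul_eq_intCast (β := 6) (by norm_num) (a₁ + a₂ + star a₁ + star a₂))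
  refine hcount.mono fun t ht => ?_
  by_contra hn
  simp only [Set.mem_union, Set.mem_ofPred_eq, not_or, not_exists] at hn
  obtain ⟨⟨⟨⟨h1, h2⟩, h3⟩, h4⟩, h5⟩ := hn
  refine ht (generic_ch M (fun s s' n => ?_) fun n => ?_)
  · fin_cases s <;> fin_cases s' <;> intro h
    · refine h1 n ?_
      simp at h
      simp only [Complex.star_def]
      linear_combination h
    · refine h2 n ?_
      simp at h
      simp only [Complex.star_def]
      linear_combination h
    · refine h3 n ?_
      simp at h
      simp only [Complex.star_def]
      linear_combination h
    · refine h4 n ?_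
      simp at h
      simp only [Complex.star_def]
      linear_combination h
  · intro h
    refine h5 n ?_
    simp at h
    simp only [Complex.star_def]
    linear_combination h

theorem eventually_chAssumptions {a₁ a₂ : ℂ} {M₁ M₂ : ℕ} {d₁ : Fin M₁ → ℕ} {d₂ : Fin M₂ → ℕ}
    (h : ChAssumptions a₁ a₂ d₁ d₂) :
    ∀ᶠ p : ℂ × ℂ in nhds (a₁, a₂), ChAssumptions p.1 p.2 d₁ d₂ := by
  have c1 : ContinuousAt (fun p : ℂ × ℂ => p.1) (a₁, a₂) := continuousAt_fst
  have c2 : ContinuousAt (fun p : ℂ × ℂ => p.2) (a₁, a₂) := continuousAt_snd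
  have r1 : ContinuousAt (fun p : ℂ × ℂ => p.1.re) (a₁, a₂) :=
    Complex.continuous_re.continuousAt.comp c1
  have r2 : ContinuousAt (fun p : ℂ × ℂ => p.2.re) (a₁, a₂) :=
    Complex.continuous_re.continuousAt.comp c2
  have hl : ContinuousAt (fun p : ℂ × ℂ => chDenomLead p.1 p.2 d₁ d₂) (a₁, a₂) := by
    simp only [chDenomLead]
    refine ((((ContinuousAt.mul ?_ ?_).mul continuousAt_const).mul continuousAt_const).mul ?_)
    · exact tendsto_finsetProd _ fun j _ =>
        continuousAt_chLead (continuousAt_const.sub c1.star) c2 _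
    · exact tendsto_finsetProd _ fun j _ =>
        continuousAt_chLead c1 (continuousAt_const.sub c2.star) _
    · refine tendsto_finsetProd _ fun j _ => tendsto_finsetProd _ fun k _ => ?_
      exact ((((c2.neg.sub c2.star).sub continuousAt_const).add c1).add c1.star).add
        continuousAt_const
  have e1 : ∀ᶠ p : ℂ × ℂ in nhds (a₁, a₂), ∀ j, (d₁ j : ℝ) < 2 * p.1.re - 1 := by
    rw [Filter.eventually_all]
    exact fun j => ((continuousAt_const.mul r1).sub continuousAt_const).eventually
      (lt_mem_nhds (h.lt₁ j))
  have e2 : ∀ᶠ p : ℂ × ℂ in nhds (a₁, a₂), ∀ j, (d₂ j : ℝ) < 2 * p.2.re - 1 := by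
    rw [Filter.eventually_all]
    exact fun j => ((continuousAt_const.mul r2).sub continuousAt_const).eventually
      (lt_mem_nhds (h.lt₂ j))
  filter_upwards [r1.eventually (lt_mem_nhds h.re_pos₁), r2.eventually (lt_mem_nhds h.re_pos₂),
    e1, e2, hl.eventually_ne h.lead_ne_zero] with p h1 h2 h3 h4 h5
  exact ⟨h1, h2, h3, h4, h5⟩

section Fixed

variable {a₁ a₂ : ℂ} {M₁ M₂ : ℕ} {d₁ : Fin M₁ → ℕ} {d₂ : Fin M₂ → ℕ}

theorem mem_span_ch (hd₁ : Function.Injective d₁) (hd₂ : Function.Injective d₂)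
    (h : ChAssumptions a₁ a₂ d₁ d₂) {Ξ Xb Yb : ℂ[X]} (hY : Yb ≠ 0)
    (hΞ : (seedMatrix ![a₁, a₂] ![star a₁, star a₂] (chType M₁ M₂) (chSeed a₁ a₂ d₁ d₂)).det =
      seedDenom ![a₁, a₂] ![star a₁, star a₂] (chType M₁ M₂) * Ξ)
    (hX : Xb - taylor Complex.I Xb = Ξ * Yb) (n : ℕ) :
    Xb * fullDet ![a₁, a₂] ![star a₁, star a₂] (chType M₁ M₂) (chSeed a₁ a₂ d₁ d₂)
        (chPoly a₁ a₂ n) ∈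
      Submodule.span ℂ ((fun n => fullDet ![a₁, a₂] ![star a₁, star a₂] (chType M₁ M₂)
        (chSeed a₁ a₂ d₁ d₂) (chPoly a₁ a₂ n)) ''
          {k | n ≤ k + Xb.natDegree ∧ k ≤ n + Xb.natDegree}) := by
  have c1 : ContinuousAt (fun p : ℂ × ℂ => p.1) (a₁, a₂) := continuousAt_fst
  have c2 : ContinuousAt (fun p : ℂ × ℂ => p.2) (a₁, a₂) := continuousAt_snd
  refine mul_mem_span_of_frequently_generic (t₀ := (a₁, a₂))
    (c := fun p : ℂ × ℂ => ![p.1, p.2]) (c' := fun p => ![star p.1, star p.2])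
    (ξ := fun p => chSeed p.1 p.2 d₁ d₂) (P := fun p => chPoly p.1 p.2) (fun s => ?_) (fun s => ?_)
    (fun k z => ?_) (fun n z => continuousAt_eval_chPoly c1 c2 n z)
    ((eventually_chAssumptions h).mono fun p hp => admissible_ch hd₁ hd₂ hp)
    (frequently_generic_ch a₁ a₂ _) one_ne_zero one_ne_zero hY hΞ hX n
  · fin_cases s
    · exact c1
    · exact c2
  · fin_cases s
    · exact c1.star
    · exact c2.star
  · refine Fin.addCases (fun k => ?_) (fun k => ?_) k
    · simp only [chSeed, Fin.append_left, chXiI]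
      exact continuousAt_eval_chPoly (continuousAt_const.sub c1.star) c2 _ _
    · simp only [chSeed, Fin.append_right, chXiII]
      exact continuousAt_eval_chPoly c1 (continuousAt_const.sub c2.star) _ _

end Fixed

theorem chRow_eq (a₁ a₂ : ℂ) {M₁ M₂ : ℕ} (d₁ : Fin M₁ → ℕ) (d₂ : Fin M₂ → ℕ) (N : ℕ) (j : Fin N)
    (k : Fin (M₁ + M₂)) : chRow a₁ a₂ d₁ d₂ N j k = C (Complex.I ^ (1 - (N : ℤ))) *
      taylor (Complex.I * ((N : ℂ) - 1) / 2) (entry ![a₁, a₂] ![star a₁, star a₂]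
        (Finset.univ.erase (chType M₁ M₂ k)) (N - 1) j (chSeed a₁ a₂ d₁ d₂ k)) := by
  refine Fin.addCases (fun k => ?_) (fun k => ?_) k
  · simp only [chRow, chType, chSeed, Fin.append_left, rFun_eq, comp_node, entry, taylor_mul,
      colFactor, show Finset.univ.erase (0 : Fin 2) = {1} by decide, Finset.prod_singleton,
      Matrix.cons_val_one, mul_assoc]
    rfl
  · simp only [chRow, chType, chSeed, Fin.append_right, rFun_eq, comp_node, entry, taylor_mul,
      colFactor, show Finset.univ.erase (1 : Fin 2) = {0} by decide, Finset.prod_singleton,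
      Matrix.cons_val_zero, mul_assoc]

theorem chDenomDet_eq (a₁ a₂ : ℂ) {M₁ M₂ : ℕ} (d₁ : Fin M₁ → ℕ) (d₂ : Fin M₂ → ℕ) :
    ∃ u : ℂ, u ≠ 0 ∧ chDenomDet a₁ a₂ d₁ d₂ =
      C u * taylor (Complex.I * (((M₁ + M₂ : ℕ) : ℂ) - 1) / 2) (seedMatrix ![a₁, a₂]
        ![star a₁, star a₂] (chType M₁ M₂) (chSeed a₁ a₂ d₁ d₂)).det := by
  refine ⟨Complex.I ^ ((M₁ + M₂) * (M₁ + M₂ - 1) / 2) *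
    ∏ _k : Fin (M₁ + M₂), Complex.I ^ (1 - ((M₁ + M₂ : ℕ) : ℤ)),
    mul_ne_zero (pow_ne_zero _ Complex.I_ne_zero) (Finset.prod_ne_zero_iff.2 fun _ _ =>
      zpow_ne_zero _ Complex.I_ne_zero), ?_⟩
  rw [chDenomDet, C_mul, mul_assoc, ← det_C_mul_taylor]
  congr 2
  ext j k : 2
  rw [Matrix.of_apply, Matrix.of_apply, chRow_eq, seedMatrix, Matrix.of_apply]

theorem chMultiDet_eq (a₁ a₂ : ℂ) {M₁ M₂ : ℕ} (d₁ : Fin M₁ → ℕ) (d₂ : Fin M₂ → ℕ) :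
    ∃ v : ℂ, ∀ n, chMultiDet a₁ a₂ d₁ d₂ n =
      C v * taylor (Complex.I * (((M₁ + M₂ : ℕ) : ℂ) - 1) / 2 + Complex.I / 2)
        (fullDet ![a₁, a₂] ![star a₁, star a₂] (chType M₁ M₂) (chSeed a₁ a₂ d₁ d₂)
          (chPoly a₁ a₂ n)) := by
  refine ⟨Complex.I ^ ((M₁ + M₂) * (M₁ + M₂ + 1) / 2) * ∏ k, (Fin.snoc
    (fun _ => Complex.I ^ (1 - ((M₁ + M₂ + 1 : ℕ) : ℤ)))
    (Complex.I ^ (1 - ((M₁ + M₂ + 1 : ℕ) : ℤ)) * Complex.I ^ (1 - ((M₁ + M₂ + 1 : ℕ) : ℤ))) :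
      Fin (M₁ + M₂ + 1) → ℂ) k, fun n => ?_⟩
  rw [chMultiDet, C_mul, mul_assoc, fullDet_apply, ← det_C_mul_taylor]
  congr 2
  have e : Complex.I * (((M₁ + M₂ : ℕ) : ℂ) - 1) / 2 + Complex.I / 2 =
      Complex.I * (((M₁ + M₂ + 1 : ℕ) : ℂ) - 1) / 2 := by push_cast; ring
  rw [e]
  ext j k : 2
  refine Fin.lastCases ?_ (fun k => ?_) k
  · simp only [Matrix.of_apply, Fin.snoc_last, fullMatrix, rFun_eq, comp_node, entry, taylor_mul,
      colFactor, Fin.prod_univ_two, Nat.add_sub_cancel, Matrix.cons_val_zero, Matrix.cons_val_one,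
      C_mul]
    ring_nf
  · simp only [Matrix.of_apply, Fin.snoc_castSucc, fullMatrix, chRow_eq, Nat.add_sub_cancel]

theorem card_filter_chType_ne_zero (M₁ M₂ : ℕ) :
    (Finset.univ.filter fun k => chType M₁ M₂ k ≠ 0).card = M₂ := by
  rw [Finset.card_filter, Fin.sum_univ_add]
  simp [chType]

theorem card_filter_chType_ne_one (M₁ M₂ : ℕ) :
    (Finset.univ.filter fun k => chType M₁ M₂ k ≠ 1).card = M₁ := by
  rw [Finset.card_filter, Fin.sum_univ_add]
  simp [chType]

/-- Half the window length centres both Pochhammer factors. The products on the left start at the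
trivial index 0, whence `m - 1`, and index 1 stands for a₂, which comes first in `chFactor`. -/
theorem taylor_gaugeDenom (a₁ a₂ : ℂ) (n : ℕ) (m : Fin 2 → ℕ) :
    taylor (Complex.I * n / 2) (gaugeDenom ![a₁, a₂] ![star a₁, star a₂] n m) =
      chFactor a₁ a₂ (n / 2) (m 1 - 1) (m 0 - 1) := by
  have h1 : ∀ (c : ℂ) (r : ℕ), taylor (Complex.I * n / 2) (poch (linPlus c) r) =
      poch (linPlus (c - n / 2)) r := fun c r => by
    rw [taylor_poch_linPlus]
    congr 2
    linear_combination ((n : ℂ) / 2) * Complex.I_mul_I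
  have h2 : ∀ (c : ℂ) (r : ℕ), taylor (Complex.I * n / 2) (poch (linMinus (c - n)) r) =
      poch (linMinus (c - n / 2)) r := fun c r => by
    rw [taylor_poch_linMinus]
    congr 2
    linear_combination (-(n : ℂ) / 2) * Complex.I_mul_I
  have h3 : ∀ (s : Finset ℕ) (f : ℕ → ℂ[X]), taylor (Complex.I * n / 2) (∏ r ∈ s, f r) =
      ∏ r ∈ s, taylor (Complex.I * n / 2) (f r) := fun s f =>
    map_prod (taylorAlgHom (Complex.I * n / 2)) f s
  rw [gaugeDenom, Fin.prod_univ_two, taylor_mul, h3, h3, chFactor, mul_comm,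
    prod_range_eq_prod_Icc (by simp [poch_zero]), prod_range_eq_prod_Icc (by simp [poch_zero])]
  simp only [taylor_mul, h1, h2, Matrix.cons_val_zero, Matrix.cons_val_one]

theorem chDenomFactor_eq (a₁ a₂ : ℂ) (M₁ M₂ : ℕ) : chDenomFactor a₁ a₂ M₁ M₂ =
    taylor (Complex.I * (((M₁ + M₂ : ℕ) : ℂ) - 1) / 2)
      (seedDenom ![a₁, a₂] ![star a₁, star a₂] (chType M₁ M₂)) := by
  rcases Nat.eq_zero_or_pos (M₁ + M₂) with h0 | h0
  · obtain ⟨rfl, rfl⟩ : M₁ = 0 ∧ M₂ = 0 := by omega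
    simp [chDenomFactor, chFactor, seedDenom, gaugeDenom]
  have e : ((M₁ + M₂ : ℕ) : ℂ) - 1 = ((M₁ + M₂ - 1 : ℕ) : ℂ) := by
    rw [Nat.cast_sub h0, Nat.cast_one]
  rw [seedDenom, chDenomFactor, e, taylor_gaugeDenom, card_filter_chType_ne_zero,
    card_filter_chType_ne_one]

theorem chMultiFactor_eq (a₁ a₂ : ℂ) (M₁ M₂ : ℕ) : chMultiFactor a₁ a₂ M₁ M₂ =
    taylor (Complex.I * (((M₁ + M₂ : ℕ) : ℂ) - 1) / 2 + Complex.I / 2)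
      (fullDenom ![a₁, a₂] ![star a₁, star a₂] (chType M₁ M₂)) := by
  rw [show Complex.I * (((M₁ + M₂ : ℕ) : ℂ) - 1) / 2 + Complex.I / 2 =
    Complex.I * ((M₁ + M₂ : ℕ) : ℂ) / 2 by ring, fullDenom, chMultiFactor, taylor_gaugeDenom,
    card_filter_chType_ne_zero, card_filter_chType_ne_one]
  rfl

theorem eq_div_mul_of_dvd {f g : ℂ[X]} (hg : g ≠ 0) (h : g ∣ f) : f = f / g * g := by
  obtain ⟨q, rfl⟩ := h
  rw [mul_div_cancel_left₀ q hg, mul_comm]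

theorem chDenomFactor_ne_zero (a₁ a₂ : ℂ) (M₁ M₂ : ℕ) : chDenomFactor a₁ a₂ M₁ M₂ ≠ 0 := by
  rw [chDenomFactor_eq, Ne, taylor_eq_zero]
  exact gaugeDenom_ne_zero _ _ _ _

theorem chMultiFactor_ne_zero (a₁ a₂ : ℂ) (M₁ M₂ : ℕ) : chMultiFactor a₁ a₂ M₁ M₂ ≠ 0 := by
  rw [chMultiFactor_eq, Ne, taylor_eq_zero]
  exact gaugeDenom_ne_zero _ _ _ _

theorem taylor_dvd_taylor {f g : ℂ[X]} (h : f ∣ g) (r : ℂ) : taylor r f ∣ taylor r g := by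
  obtain ⟨q, rfl⟩ := h
  exact ⟨taylor r q, taylor_mul r f q⟩

theorem chDenomDet_eq_mul (a₁ a₂ : ℂ) {M₁ M₂ : ℕ} (d₁ : Fin M₁ → ℕ) (d₂ : Fin M₂ → ℕ) :
    chDenomDet a₁ a₂ d₁ d₂ = chDenom a₁ a₂ d₁ d₂ * chDenomFactor a₁ a₂ M₁ M₂ := by
  refine eq_div_mul_of_dvd (chDenomFactor_ne_zero _ _ _ _) ?_
  obtain ⟨u, -, hu⟩ := chDenomDet_eq a₁ a₂ d₁ d₂
  rw [hu, chDenomFactor_eq]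
  exact Dvd.dvd.mul_left (taylor_dvd_taylor (seedDenom_dvd _ _ _ _) _) _

theorem chMultiDet_eq_mul (a₁ a₂ : ℂ) {M₁ M₂ : ℕ} (d₁ : Fin M₁ → ℕ) (d₂ : Fin M₂ → ℕ) (n : ℕ) :
    chMultiDet a₁ a₂ d₁ d₂ n = chMulti a₁ a₂ d₁ d₂ n * chMultiFactor a₁ a₂ M₁ M₂ := by
  refine eq_div_mul_of_dvd (chMultiFactor_ne_zero _ _ _ _) ?_
  obtain ⟨u, hu⟩ := chMultiDet_eq a₁ a₂ d₁ d₂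
  rw [hu, chMultiFactor_eq]
  exact Dvd.dvd.mul_left (taylor_dvd_taylor (fullDenom_dvd _ _ _ _ _) _) _

/-- The recurrence relations of the multi-indexed continuous Hahn polynomials. -/
theorem ch_recurrence {a₁ a₂ : ℂ} {M₁ M₂ : ℕ} {d₁ : Fin M₁ → ℕ} {d₂ : Fin M₂ → ℕ}
    (hd₁ : Function.Injective d₁) (hd₂ : Function.Injective d₂) (h : ChAssumptions a₁ a₂ d₁ d₂)
    {Y : ℂ[X]} (hY : Y ≠ 0) {Q : ℂ[X]} (hQ : Q = invDiff (chDenom a₁ a₂ d₁ d₂ * Y)) {L : ℕ}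
    (hL : L = chEll d₁ d₂ + Y.natDegree + 1) :
    Q.natDegree = L ∧ ∃ r : ℕ → ℤ → ℂ, ∀ n : ℕ, Q * chMulti a₁ a₂ d₁ d₂ n =
      ∑ k ∈ Finset.Icc (-(L : ℤ)) (L : ℤ),
        C (r n k) * extendZero (chMulti a₁ a₂ d₁ d₂) ((n : ℤ) + k) := by
  obtain ⟨u, hu0, hu⟩ := chDenomDet_eq a₁ a₂ d₁ d₂
  obtain ⟨v, hv⟩ := chMultiDet_eq a₁ a₂ d₁ d₂
  have hadm := admissible_ch hd₁ hd₂ h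
  obtain ⟨Ξ, hΞ⟩ := seedDenom_dvd ![a₁, a₂] ![star a₁, star a₂] (chType M₁ M₂)
    (chSeed a₁ a₂ d₁ d₂)
  have hΞ0 : Ξ ≠ 0 := by
    rintro rfl
    exact hadm.seed_ne_zero (by rw [hΞ, mul_zero])
  have hΞc : chDenom a₁ a₂ d₁ d₂ =
      C u * taylor (Complex.I * (((M₁ + M₂ : ℕ) : ℂ) - 1) / 2) Ξ := by
    apply mul_right_cancel₀ (chDenomFactor_ne_zero a₁ a₂ M₁ M₂)
    rw [← chDenomDet_eq_mul, hu, hΞ, taylor_mul, ← chDenomFactor_eq]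
    ring
  refine recurrence_of_base (fun Xb Yb hY hX n => mem_span_ch hd₁ hd₂ h hY hΞ hX n) hΞ0 hu0 hΞc
    (chMultiFactor_ne_zero a₁ a₂ M₁ M₂) (fun n => by rw [← chMultiDet_eq_mul, hv]) hY hQ ?_
  rw [hL]
  congr 2
  have h1 := (natDegree_mul (gaugeDenom_ne_zero ![a₁, a₂] ![star a₁, star a₂] (M₁ + M₂ - 1)
    (fun s => (Finset.univ.filter fun k => chType M₁ M₂ k ≠ s).card)) hΞ0)
  rw [← seedDenom, ← hΞ, hadm.natDegree_seed, seedDenom, natDegree_gaugeDenom, Fin.sum_univ_two,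
    card_filter_chType_ne_zero, card_filter_chType_ne_one] at h1
  have h2 : ∑ i : Fin (M₁ + M₂), ((i : ℕ) : ℤ) =
      (((M₁ + M₂) * (M₁ + M₂ - 1) / 2 : ℕ) : ℤ) := by
    rw [← Finset.sum_range_id, ← Fin.sum_univ_eq_sum_range (fun i => i) (M₁ + M₂)]
    push_cast
    rfl
  have h3 : ∑ k, (((Finset.univ.erase (chType M₁ M₂ k)).card : ℤ) * (M₁ + M₂ - 1 : ℕ) +
      (Fin.append d₁ d₂ k : ℕ)) =
      (((M₁ + M₂) * (M₁ + M₂ - 1) + (∑ j, d₁ j + ∑ j, d₂ j) : ℕ) : ℤ) := by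
    simp only [Finset.card_erase_of_mem (Finset.mem_univ _), Finset.card_univ, Fintype.card_fin]
    rw [Finset.sum_add_distrib, Fin.sum_univ_add (fun k => ((Fin.append d₁ d₂ k : ℕ) : ℤ))]
    simp
  -- Dividing out the common factor removes M₁(M₁ - 1) + M₂(M₂ - 1) from the gauge contribution M(M
  -- - 1) to the degree; what remains is the term 2 M₁ M₂ of `chEll`.
  have h4 : (M₁ + M₂) * (M₁ + M₂ - 1) = M₂ * (M₂ - 1) + M₁ * (M₁ - 1) + 2 * M₁ * M₂ := by
    rcases M₁ with _ | m₁ <;> rcases M₂ with _ | m₂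
    · simp
    · simp
    · simp
    · rw [show m₁ + 1 + (m₂ + 1) - 1 = m₁ + m₂ + 1 by omega, Nat.add_sub_cancel,
        Nat.add_sub_cancel]
      ring
  rw [h2, h3] at h1
  rw [chEll]
  generalize (M₁ + M₂) * (M₁ + M₂ - 1) = T at *
  generalize 2 * M₁ * M₂ = U at *
  omega

end MultiIndexed

end

theorem theorem2 :
    (∀ (a φ : ℝ), 0 < a → 0 < φ → φ < Real.pi →
      ∀ (M : ℕ) (d : Fin M → ℕ), Function.Injective d →
      (∀ j, (d j : ℝ) < 2 * a - 1) →
      (∀ x : ℂ, |x.im| ≤ 1 / 2 → (MultiIndexed.mpDenom a φ d).eval x ≠ 0) →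
      ∀ (Y : Polynomial ℂ), Y ≠ 0 →
      ∀ (X : Polynomial ℂ), X = MultiIndexed.invDiff (MultiIndexed.mpDenom a φ d * Y) →
      ∀ (L : ℕ), L = MultiIndexed.mpEll d + Y.natDegree + 1 →
        X.natDegree = L ∧
        ∃ r : ℕ → ℤ → ℂ, ∀ n : ℕ,
          X * MultiIndexed.mpMulti a φ d n =
            ∑ k ∈ Finset.Icc (-(L : ℤ)) (L : ℤ),
              Polynomial.C (r n k) *
                MultiIndexed.extendZero (MultiIndexed.mpMulti a φ d) ((n : ℤ) + k)) ∧
    (∀ (a₁ a₂ : ℂ), 0 < a₁.re → 0 < a₂.re →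
      ∀ (M₁ M₂ : ℕ) (d₁ : Fin M₁ → ℕ) (d₂ : Fin M₂ → ℕ),
      Function.Injective d₁ → Function.Injective d₂ →
      (∀ j, (d₁ j : ℝ) < 2 * a₁.re - 1) → (∀ j, (d₂ j : ℝ) < 2 * a₂.re - 1) →
      MultiIndexed.chDenomLead a₁ a₂ d₁ d₂ ≠ 0 →
      (∀ x : ℂ, |x.im| ≤ 1 / 2 → (MultiIndexed.chDenom a₁ a₂ d₁ d₂).eval x ≠ 0) →
      ∀ (Y : Polynomial ℂ), Y ≠ 0 →
      ∀ (X : Polynomial ℂ), X = MultiIndexed.invDiff (MultiIndexed.chDenom a₁ a₂ d₁ d₂ * Y) →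
      ∀ (L : ℕ), L = MultiIndexed.chEll d₁ d₂ + Y.natDegree + 1 →
        -- the divisions that define the denominator polynomial and the multi-indexed
        -- polynomials are exact
        MultiIndexed.chDenomDet a₁ a₂ d₁ d₂ =
          MultiIndexed.chDenom a₁ a₂ d₁ d₂ * MultiIndexed.chDenomFactor a₁ a₂ M₁ M₂ ∧
        (∀ n : ℕ, MultiIndexed.chMultiDet a₁ a₂ d₁ d₂ n =
          MultiIndexed.chMulti a₁ a₂ d₁ d₂ n * MultiIndexed.chMultiFactor a₁ a₂ M₁ M₂) ∧
        X.natDegree = L ∧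
        ∃ r : ℕ → ℤ → ℂ, ∀ n : ℕ,
          X * MultiIndexed.chMulti a₁ a₂ d₁ d₂ n =
            ∑ k ∈ Finset.Icc (-(L : ℤ)) (L : ℤ),
              Polynomial.C (r n k) *
                MultiIndexed.extendZero (MultiIndexed.chMulti a₁ a₂ d₁ d₂) ((n : ℤ) + k)) := by
  refine ⟨?_, ?_⟩
  · intro a φ _ h0 hπ M d hd hlt _ Y hY Q hQ L hL
    exact MultiIndexed.mp_recurrence h0 hπ hd hlt hY hQ hL
  · intro a₁ a₂ h₁ h₂ M₁ M₂ d₁ d₂ hd₁ hd₂ hlt₁ hlt₂ hlead _ Y hY Q hQ L hL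
    exact ⟨MultiIndexed.chDenomDet_eq_mul a₁ a₂ d₁ d₂, MultiIndexed.chMultiDet_eq_mul a₁ a₂ d₁ d₂,
      MultiIndexed.ch_recurrence hd₁ hd₂ ⟨h₁, h₂, hlt₁, hlt₂, hlead⟩ hY hQ hL⟩
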